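/- For $a>0$ and $w\in\mathbb C$ let $\gamma(a,w)=\int_0^w e^{-t}t^{a-1}\,dt$ and $\Gamma(a,w)=\Gamma(a)-\gamma(a,w)$ (principal branches). **Coefficients.** Put $F_0^-(z)=-\dfrac{z}{(z-1)^2}$, $F_1^-(z)=-\dfrac{2z(z+1)}{(z-1)^4}$, $$F_{s+1}^-(z)=\frac{z}{1-z}\frac{dF_s^-(z)}{dz}-\frac12\sum_{j=0}^{s}F_j^-(z)F_{s-j}^-(z)\quad(s\ge1),\qquad E_s^-(z)=\int_0^z\frac{(t-1)F_s^-(t)}{2t}\,dt .$$ **Domains.** Put $\Xi(a,z)=\operatorname{Re}\{\tfrac12a(z-1-\ln z)+\tfrac12\ln(1-z)\}$. All paths are finite chains of $R_2$ arcs (twice continuously differentiable, nonvanishing derivative) bounded away from $1$. $Z^{(0)}(a)$ consists of $0$ and of all $z$ that can be joined to $0$ by a path $\mathcal L^{(0)}$ along which $\Xi(a,t)$ is nonincreasing as $t$ passes from $0$ to $z$. $Z^{(\infty)}(a)$ consists of all $z$ that can be joined to $+\infty$ by a path $\mathcal L^{(\infty)}$ in the cut plane $-\pi\le\arg t\le\pi$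 (with $\operatorname{Re}t\to+\infty$ along it) on which $\Xi(a,t)$ is nonincreasing as $t$ passes from $+\infty$ to $z$; on the cut, $\arg z=\pi$ is taken at the endpoint $z$. Let $x^{\pm}(a)=1\pm\frac{\sqrt{4a+1}}{2a}+\frac1{2a}$. **Error bound.** For such a path $\mathcal L$ put $$\Phi_n=\int_{\mathcal L}\left|\frac{t-1}{t}F_n^-(t)\,dt\right|+\frac12\sum_{s=1}^{n-1}\frac1{a^s}\sum_{k=s}^{n-1}\int_{\mathcal L}\left|\frac{t-1}{t}F_k^-(t)F_{s+n-k-1}^-(t)\,dt\right|,$$ $$\Psi_n=2\sum_{s=0}^{n-2}\frac1{a^s}\int_{\mathcal L}\left|\frac{t-1}{t}F_{s+1}^-(t)\,dt\right|,\qquad \kappa_0=\sup_{t\in\mathcal L}\left|1+\frac{t}{a(t-1)^2}\right|^{-1},\qquad \kappa_2=\sup_{t\in\mathcal L}\left|\frac{t}{(t-1)^2}\right|,$$ $$B_n(a,\mathcal L)=\frac{\kappa_0}{a^n}\Phi_n\exp\left\{\frac1a\left(2+2\kappa_0+\frac{\kappa_0\kappa_2}{a}\right)\Psi_n+\frac{\kappa_0}{a}\int_{\mathcal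 L}\left|\frac{t+1}{(t-1)^3}\,dt\right|+\frac{\kappa_0}{a^n}\Phi_n\right\}\in[0,\infty].$$ **Theorem.** 1. For every $s\ge1$, $E_s^-$ is a rational function whose only possible finite pole is $z=1$; it vanishes at $z=0$, has derivative $(z-1)F_s^-(z)/(2z)$, and $E_s^-(z)\to0$ as $z\to\infty$. 2. For $a\ge1$, $Z^{(0)}(a)$ contains all $z$ with $\operatorname{Re}z\le x^-(a)$, and hence the whole imaginary axis. For $a>0$, $Z^{(\infty)}(a)$ contains all $z$ with $\operatorname{Re}z\ge x^+(a)$. 3. There are functions $\eta_n^{(0)}(a,z)$ and $\eta_n^{(\infty)}(a,z)$ such that, for all $n\ge1$ and $a>0$, $$\gamma(a,az)=\frac{(az)^a}{a(1-z)}\exp\left\{-az+\sum_{s=1}^{n-1}(-1)^s\frac{E_s^-(z)}{a^s}\right\}\{1+\eta_n^{(0)}(a,z)\}\qquad(z\in Z^{(0)}(a)),$$ $$\Gamma(a,az)=\frac{(az)^a}{a(z-1)}\exp\left\{-az+\sum_{s=1}^{n-1}(-1)^s\frac{E_s^-(z)}{a^s}\right\}\{1+\eta_n^{(\infty)}(a,z)\}\qquad(z\in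 Z^{(\infty)}(a)),$$ with $\eta_n^{(0)}(a,0)=0$, $\eta_n^{(\infty)}(a,x)\to0$ as $x\to+\infty$, and $|\eta_n^{(0)}(a,z)|\le B_n(a,\mathcal L^{(0)})$, $|\eta_n^{(\infty)}(a,z)|\le B_n(a,\mathcal L^{(\infty)})$ for every admissible path to $z$ of the respective kind. 4. For every $n\ge1$ and $\delta>0$, as $a\to\infty$, $\eta_n^{(0)}(a,z)=O(a^{-n})$ uniformly for $\operatorname{Re}z\le1-\delta$, and $\eta_n^{(\infty)}(a,z)=O(a^{-n})$ uniformly for $\operatorname{Re}z\ge1+\delta$. -/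

import Mathlib

open scoped ENNReal Topology

namespace LGGamma

noncomputable section

/-- `γ(a, w) = ∫_0^w e^{-t} t^{a-1} dt` for `a > 0`, integrated along the segment from `0` to `w`,
with principal powers. -/
def lowerGamma (a : ℝ) (w : ℂ) : ℂ :=
  ∫ τ in (0 : ℝ)..1, Complex.exp (-(τ * w)) * ((τ : ℂ) * w) ^ ((a : ℂ) - 1) * w

/-- `Γ(a, w) = Γ(a) - γ(a, w)`. -/
def upperGamma (a : ℝ) (w : ℂ) : ℂ :=
  Complex.Gamma a - lowerGamma a w

/-- The functions `F_s^-`. -/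
def F : ℕ → ℂ → ℂ
  | 0 => fun z => -z / (z - 1) ^ 2
  | 1 => fun z => -(2 * z * (z + 1)) / (z - 1) ^ 4
  | s + 2 => fun z =>
      z / (1 - z) * deriv (F (s + 1)) z
        - 1 / 2 * ∑ j : Fin (s + 2), F j z * F (s + 1 - j) z
termination_by s => s
decreasing_by all_goals omega

/-- The recursion in its usual form: for `s ≥ 1`,
`F_{s+1} = z/(1-z) F_s' - (1/2) ∑_{j=0}^{s} F_j F_{s-j}`. -/
theorem F_succ (s : ℕ) (hs : 1 ≤ s) (z : ℂ) :
    F (s + 1) z = z / (1 - z) * deriv (F s) z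
      - 1 / 2 * ∑ j ∈ Finset.range (s + 1), F j z * F (s - j) z := by
  obtain ⟨m, rfl⟩ : ∃ m, s = m + 1 := ⟨s - 1, by omega⟩
  rw [F, Finset.sum_range]

/-- The integrand `(t - 1) F_s^-(t) / (2 t)`. -/
def integrandE (s : ℕ) (t : ℂ) : ℂ := (t - 1) * F s t / (2 * t)

/-- The integral of `f` along the straight segment from `p` to `q`. -/
def segInt (f : ℂ → ℂ) (p q : ℂ) : ℂ :=
  ∫ τ in (0 : ℝ)..1, f (p + τ * (q - p)) * (q - p)

open Classical in
/-- `E_s^-(z) = ∫_0^z (t - 1) F_s^-(t) / (2 t) dt`. The integral is taken along the segment from `0`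
to `z`; when this segment would run through the pole `t = 1` (that is, `z` real and `z > 1`) it is
taken along the broken line `0 → i → z`. -/
def E (s : ℕ) (z : ℂ) : ℂ :=
  if z.im = 0 ∧ 1 < z.re then
    segInt (integrandE s) 0 Complex.I + segInt (integrandE s) Complex.I z
  else segInt (integrandE s) 0 z

/-- The function `Ξ(a, t) = Re {a ξ(t) - E_0^-(t)}`, with `ξ(t) = (t - 1 - ln t) / 2` and
`E_0^-(t) = -ln(1 - t) / 2`, for `t ≠ 0, 1`. -/
def Xi (a : ℝ) (t : ℂ) : ℝ :=
  a / 2 * (t.re - 1 - Real.log ‖t‖) + 1 / 2 * Real.log ‖1 - t‖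

/-- `p` restricted to the interval `S` is an `R₂` arc: twice continuously differentiable with
nonvanishing derivative. -/
def IsR2Arc (p : ℝ → ℂ) (S : Set ℝ) : Prop :=
  ContDiffOn ℝ 2 p S ∧ ∀ s ∈ S, derivWithin p S s ≠ 0

/-- `p : [0, 1] → ℂ` is a finite chain of `R₂` arcs. -/
def IsR2Chain (p : ℝ → ℂ) : Prop :=
  ∃ (k : ℕ) (b : ℕ → ℝ), StrictMono b ∧ b 0 = 0 ∧ b (k + 1) = 1 ∧
    ∀ i ≤ k, IsR2Arc p (Set.Icc (b i) (b (i + 1)))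

/-- `p : [0, ∞) → ℂ` is a finite chain of `R₂` arcs, the last of which is unbounded in the
parameter. -/
def IsR2ChainInfinite (p : ℝ → ℂ) : Prop :=
  ∃ (k : ℕ) (b : ℕ → ℝ), StrictMono b ∧ b 0 = 0 ∧
    (∀ i < k, IsR2Arc p (Set.Icc (b i) (b (i + 1)))) ∧ IsR2Arc p (Set.Ici (b k))

/-- `p : [0, 1] → ℂ` is an admissible path from `0` to `z`: a finite chain of `R₂` arcs, bounded away
from `1`, along which `Ξ(a, ·)` is nonincreasing from `0` to `z`. (`Ξ(a, 0) = +∞`, so the path does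
not return to `0`.) -/
structure PathFromZero (a : ℝ) (z : ℂ) (p : ℝ → ℂ) : Prop where
  chain : IsR2Chain p
  source : p 0 = 0
  target : p 1 = z
  ne_zero : ∀ s ∈ Set.Ioc (0 : ℝ) 1, p s ≠ 0
  away : ∃ δ > 0, ∀ s ∈ Set.Icc (0 : ℝ) 1, δ ≤ ‖p s - 1‖
  antitone : AntitoneOn (fun s => Xi a (p s)) (Set.Ioc 0 1)

/-- `p : [0, ∞) → ℂ` is an admissible path between `z = p 0` and `+∞`, in the cut plane
`-π ≤ arg t ≤ π`: a finite chain of `R₂` arcs, bounded away from `1`, along which `Ξ(a, ·)` is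
nonincreasing from `+∞` to `z` (hence nondecreasing in the parameter, which runs from `z` to `+∞`).
The function `θ` is a continuous choice of the argument along the path with values in `[-π, π]`, equal
to the principal argument at `z`. -/
structure PathToInfinity (a : ℝ) (z : ℂ) (p : ℝ → ℂ) : Prop where
  chain : IsR2ChainInfinite p
  source : p 0 = z
  target : Filter.Tendsto (fun s => (p s).re) Filter.atTop Filter.atTop
  ne_zero : ∀ s ∈ Set.Ici (0 : ℝ), p s ≠ 0
  away : ∃ δ > 0, ∀ s ∈ Set.Ici (0 : ℝ), δ ≤ ‖p s - 1‖
  monotone : MonotoneOn (fun s => Xi a (p s)) (Set.Ici 0)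
  cut : ∃ θ : ℝ → ℝ, ContinuousOn θ (Set.Ici 0) ∧ θ 0 = Complex.arg z ∧
    ∀ s ∈ Set.Ici (0 : ℝ), |θ s| ≤ Real.pi ∧ p s = ‖p s‖ * Complex.exp (θ s * Complex.I)

/-- The domain `Z^{(0)}(a)`; the point `0` itself belongs to it, by the trivial path. -/
def ZZero (a : ℝ) : Set ℂ := {z | z = 0 ∨ ∃ p, PathFromZero a z p}

/-- The domain `Z^{(∞)}(a)`. -/
def ZInf (a : ℝ) : Set ℂ := {z | ∃ p, PathToInfinity a z p}

/-- `∫_L |f(t) dt|`, with values in `[0, ∞]`, for the path `L` given by `p` on the interval `S`. -/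
def pathInt (f : ℂ → ℂ) (p : ℝ → ℂ) (S : Set ℝ) : ℝ≥0∞ :=
  ∫⁻ s in S, ‖f (p s) * deriv p s‖ₑ

/-- `Φ_n`. -/
def Phi (n : ℕ) (a : ℝ) (p : ℝ → ℂ) (S : Set ℝ) : ℝ≥0∞ :=
  pathInt (fun t => (t - 1) / t * F n t) p S
    + 2⁻¹ * ∑ s ∈ Finset.Ico 1 n, (ENNReal.ofReal a ^ s)⁻¹ *
        ∑ k ∈ Finset.Ico s n, pathInt (fun t => (t - 1) / t * F k t * F (s + n - k - 1) t) p S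

/-- `Ψ_n`; the sum over `0 ≤ s ≤ n - 2` is empty for `n = 1`. -/
def Psi (n : ℕ) (a : ℝ) (p : ℝ → ℂ) (S : Set ℝ) : ℝ≥0∞ :=
  2 * ∑ s ∈ Finset.range (n - 1), (ENNReal.ofReal a ^ s)⁻¹ *
    pathInt (fun t => (t - 1) / t * F (s + 1) t) p S

/-- `κ_0`, the supremum of `|1 + t / (a (t - 1)^2)|⁻¹` over the path, with values in `[0, ∞]`. -/
def kappa0 (a : ℝ) (p : ℝ → ℂ) (S : Set ℝ) : ℝ≥0∞ :=
  ⨆ s ∈ S, ‖1 + p s / (a * (p s - 1) ^ 2)‖ₑ⁻¹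

/-- `κ_2`, the supremum of `|t / (t - 1)^2|` over the path, with values in `[0, ∞]`. -/
def kappa2 (p : ℝ → ℂ) (S : Set ℝ) : ℝ≥0∞ :=
  ⨆ s ∈ S, ‖p s / (p s - 1) ^ 2‖ₑ

/-- The explicit error bound, with values in `[0, ∞]`. -/
def errorBound (n : ℕ) (a : ℝ) (p : ℝ → ℂ) (S : Set ℝ) : ℝ≥0∞ :=
  let A := ENNReal.ofReal a
  let κ₀ := kappa0 a p S
  let κ₂ := kappa2 p S
  κ₀ / A ^ n * Phi n a p S *
    EReal.exp (((1 / A * (2 + 2 * κ₀ + κ₀ * κ₂ / A) * Psi n a p S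
      + κ₀ / A * pathInt (fun t => (t + 1) / (t - 1) ^ 3) p S
      + κ₀ / A ^ n * Phi n a p S : ℝ≥0∞)) : EReal)

/-- `x^-(a) = 1 - √(4a+1)/(2a) + 1/(2a)`. -/
def xMinus (a : ℝ) : ℝ := 1 - √(4 * a + 1) / (2 * a) + 1 / (2 * a)

/-- `x^+(a) = 1 + √(4a+1)/(2a) + 1/(2a)`. -/
def xPlus (a : ℝ) : ℝ := 1 + √(4 * a + 1) / (2 * a) + 1 / (2 * a)

/-- `exp {-a z + ∑_{s=1}^{n-1} (-1)^s E_s^-(z) / a^s}`. -/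
def expFactor (n : ℕ) (a : ℝ) (z : ℂ) : ℂ :=
  Complex.exp (-(a * z) + ∑ s ∈ Finset.Ico 1 n, (-1) ^ s * (E s z / (a : ℂ) ^ s))

end

end LGGamma

/-! Algebra. Put `u = 1 / a`, `v = 1 / (z - 1)` and `ξ = (z - 1 - ln z) / 2`, so that `d/dξ = (2z /
(z - 1)) d/dz`. In the variable `v` both `F_s` and `d/dξ` are polynomial. With `S = ∑_{s ≥ 1} (-1)^s
F_s u^s` and `Y = -u (F_0 + S / 2)`, the recursion for `F_s` says precisely that `dY/dξ = -S (1 +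
Y)`. Hence, formally, `∑ (-1)^s E_s u^s = -log (1 + Y)`. The coefficients of this logarithm are
polynomials in the `F_j`, so integrating `F_s` produces no logarithmic term in `z`, and `E_s`
vanishes wherever all `F_j` do, in particular at `z = 0` and `z = ∞` (`coeffDeriv_ySeries`,
`xiDeriv_ePoly`, `eval_ePoly_eq_zero`).

Analysis. For `h = 1 + η` the first-order equation of the incomplete gamma functions reads `h' = G
ω` with `G = a (1 - z) / z` and `ω = exp (-∑ (-1)^s E_s / a^s) - ρ h`, where `ρ` (`ratioFun`) is the
truncation of `1 + Y` at `u = 1 / a`. The exponential and `ρ` satisfy the same linear equation up to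
a residual `R` of order `a^{-n}`. Therefore `ω' = -(G K + 2σ) ω - R h`, with `K = 1 + z / (a (z -
1)^2)` and `σ` the derivative of the sum of the `E_s` (`hasDerivAt_ratioFun`,
`hasDerivAt_omegaFun`).

The coefficient `G K` is large, but `Re (G K dz) = -2 dΞ`, so along an admissible path its
integrating factor has nondecreasing modulus and `ω` is only damped by it. In the derivative of `ω +
K (h - 1)` the function `G` cancels, so `h - 1` is controlled by integrals of `R`, `σ` and `K'`
alone, and Gronwall's inequality closes the estimate (`linear_system_bound`). The initial error
tends to `0` at the origin, because `w^{-a} γ(a, w)` is entire, and at `+∞`, because `Γ(a, w) ~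
e^{-w} w^{a-1}`.

Domains and uniformity. Points to the left of `1` are reached from `0` by a horizontal and then a
vertical segment, points to the right by a horizontal ray. On such paths at distance `δ` from `1`
one has `∫ |dt| / |t - 1|^2 ≤ 2π / δ`. Every integrand of the error bound is bounded by `|t -
1|^{-2}` times the modulus of a polynomial in `1 / (t - 1)`, which makes the bound uniformly
`O(a^{-n})` (`exists_errorBound_le`). -/

namespace LGGamma

noncomputable section

/-! ### The coefficients as polynomials in `1 / (z - 1)`. -/

section

open Polynomial in
/-- `F_s^-` as a polynomial in `v = 1 / (z - 1)`. -/
def fPoly : ℕ → ℂ[X]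
  | 0 => -(X * (1 + X))
  | 1 => -(C 2 * X ^ 2 * (1 + X) * (1 + C 2 * X))
  | s + 2 => X ^ 2 * (1 + X) * derivative (fPoly (s + 1))
      - C (1 / 2) * ∑ j : Fin (s + 2), fPoly j * fPoly (s + 1 - j)
termination_by s => s
decreasing_by all_goals omega

open Polynomial in
theorem fPoly_succ (s : ℕ) (hs : 1 ≤ s) :
    fPoly (s + 1) = X ^ 2 * (1 + X) * derivative (fPoly s)
      - C (1 / 2) * ∑ j ∈ Finset.range (s + 1), fPoly j * fPoly (s - j) := by
  obtain ⟨m, rfl⟩ : ∃ m, s = m + 1 := ⟨s - 1, by omega⟩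
  rw [fPoly, Finset.sum_range]

open Polynomial in
/-- `d/dξ` in the variable `v = 1 / (z - 1)`. -/
def xiDeriv : Derivation ℂ ℂ[X] ℂ[X] := (-(C 2 * X ^ 2 * (1 + X)) : ℂ[X]) • derivative'

open Polynomial in
theorem xiDeriv_apply (p : ℂ[X]) : xiDeriv p = -(C 2 * X ^ 2 * (1 + X)) * derivative p := by
  simp [xiDeriv, derivative'_apply]

open Polynomial in
-- The recursion starts only at `s = 1`; the separate choice of `F_1` is what makes the coefficient
-- of `u` in `coeffDeriv_ySeries` come out right.
theorem xiDeriv_fPoly_zero : xiDeriv (fPoly 0) = -fPoly 1 := by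
  rw [xiDeriv_apply]
  have h2 : (C 2 : ℂ[X]) = 2 := rfl
  simp only [fPoly, h2, derivative_neg, derivative_mul, derivative_X, derivative_add,
    derivative_one]
  ring

open Polynomial in
theorem xiDeriv_fPoly (s : ℕ) (hs : 1 ≤ s) :
    xiDeriv (fPoly s) = -(2 * fPoly (s + 1))
      - ∑ j ∈ Finset.range (s + 1), fPoly j * fPoly (s - j) := by
  rw [xiDeriv_apply, fPoly_succ s hs]
  have h2 : (C 2 : ℂ[X]) = 2 := rfl
  have h : (C (1 / 2) : ℂ[X]) * 2 = 1 := by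
    rw [← h2, ← C_mul]; norm_num
  rw [h2]
  linear_combination (-∑ j ∈ Finset.range (s + 1), fPoly j * fPoly (s - j)) * h

open Polynomial in
-- The roots `v = 0` and `v = -1` correspond to `z = ∞` and `z = 0`.
theorem dvd_fPoly : ∀ s : ℕ, X * (1 + X) ∣ fPoly s
  | 0 => by rw [fPoly]; exact dvd_neg.2 dvd_rfl
  | 1 => by
      rw [fPoly]; exact dvd_neg.2 ⟨C 2 * X * (1 + C 2 * X), by ring⟩
  | s + 2 => by
      rw [fPoly_succ (s + 1) (by omega)]
      refine dvd_sub ⟨X * derivative (fPoly (s + 1)), by ring⟩ (dvd_mul_of_dvd_right ?_ _)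
      refine Finset.dvd_sum fun j hj => dvd_mul_of_dvd_left ?_ _
      have := Finset.mem_range.1 hj
      exact dvd_fPoly j

open Polynomial in
-- A product of two `F_j` already contains `X ^ 2 * (1 + X) ^ 2`. Since `(t - 1) / t = 1 / (1 + v)`,
-- this divisibility later turns `(t - 1) / t * F_s` into `v ^ 2` times a polynomial in `v`.
theorem sq_dvd_fPoly (s : ℕ) (hs : 1 ≤ s) : X ^ 2 * (1 + X) ∣ fPoly s := by
  obtain ⟨m, rfl⟩ : ∃ m, s = m + 1 := ⟨s - 1, by omega⟩
  rcases m with _ | m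
  · rw [fPoly]; exact dvd_neg.2 ⟨C 2 * (1 + C 2 * X), by ring⟩
  · rw [fPoly_succ (m + 1) (by omega)]
    refine dvd_sub ⟨derivative (fPoly (m + 1)), by ring⟩ (dvd_mul_of_dvd_right ?_ _)
    refine Finset.dvd_sum fun j _ => ?_
    obtain ⟨q, hq⟩ := dvd_fPoly j
    obtain ⟨r, hr⟩ := dvd_fPoly (m + 1 - j)
    exact ⟨q * r * (1 + X), by rw [hq, hr]; ring⟩

open Polynomial in
theorem eval_fPoly_zero (s : ℕ) : (fPoly s).eval 0 = 0 := by
  obtain ⟨q, hq⟩ := dvd_fPoly s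
  simp [hq]

open Polynomial in
theorem eval_fPoly_neg_one (s : ℕ) : (fPoly s).eval (-1) = 0 := by
  obtain ⟨q, hq⟩ := dvd_fPoly s
  simp [hq]

open Polynomial in
-- At `v = -1` the quadratic terms have a double zero and `X ^ 2 = 1`, so the recursion hands the
-- slope on unchanged. The purpose is `fPoly_ne_zero`.
theorem eval_derivative_fPoly (s : ℕ) (hs : 1 ≤ s) :
    (derivative (fPoly s)).eval (-1) = 2 := by
  induction s, hs using Nat.le_induction with
  | base => simp [fPoly]; norm_num
  | succ s hs ih =>
    rw [fPoly_succ s hs]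
    simp [ih, eval_finsetSum, eval_fPoly_neg_one]

theorem fPoly_ne_zero (s : ℕ) (hs : 1 ≤ s) : fPoly s ≠ 0 := by
  intro h
  simpa [h] using eval_derivative_fPoly s hs

/-! ### The primitives of the coefficients -/

section Primitive

variable {R : Type*} [CommRing R] [Algebra ℂ R]

/-- A derivation applied coefficientwise to a power series. -/
def coeffDeriv (D : Derivation ℂ R R) (φ : PowerSeries R) : PowerSeries R :=
  PowerSeries.mk fun n => D (PowerSeries.coeff n φ)

theorem coeff_coeffDeriv (D : Derivation ℂ R R) (φ : PowerSeries R) (n : ℕ) :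
    PowerSeries.coeff n (coeffDeriv D φ) = D (PowerSeries.coeff n φ) := by
  simp [coeffDeriv]

theorem coeffDeriv_mul (D : Derivation ℂ R R) (φ ψ : PowerSeries R) :
    coeffDeriv D (φ * ψ) = φ * coeffDeriv D ψ + coeffDeriv D φ * ψ := by
  ext n
  simp only [coeff_coeffDeriv, PowerSeries.coeff_mul, map_add, map_sum, Derivation.leibniz,
    smul_eq_mul, Finset.sum_add_distrib]
  congr 1
  exact Finset.sum_congr rfl fun _ _ => mul_comm _ _

theorem coeffDeriv_add (D : Derivation ℂ R R) (φ ψ : PowerSeries R) :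
    coeffDeriv D (φ + ψ) = coeffDeriv D φ + coeffDeriv D ψ := by
  ext n; simp [coeff_coeffDeriv]

theorem coeffDeriv_neg (D : Derivation ℂ R R) (φ : PowerSeries R) :
    coeffDeriv D (-φ) = -coeffDeriv D φ := by
  ext n; simp [coeff_coeffDeriv]

theorem coeffDeriv_one (D : Derivation ℂ R R) : coeffDeriv D (1 : PowerSeries R) = 0 := by
  ext n; simp [coeff_coeffDeriv, PowerSeries.coeff_one]; split_ifs <;> simp

theorem coeffDeriv_derivative (D : Derivation ℂ R R) (φ : PowerSeries R) :
    coeffDeriv D (PowerSeries.derivative R φ) = PowerSeries.derivative R (coeffDeriv D φ) := by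
  ext n
  simp only [coeff_coeffDeriv, PowerSeries.coeff_derivative, Derivation.leibniz, smul_eq_mul]
  have : D ((n : R) + 1) = 0 := by simp
  rw [this]; ring

/-- If `δ Y = - S (1 + Y)` then `δ` of the derivative of `- log (1 + Y)` is the derivative
of `S`. -/
theorem coeffDeriv_logDeriv (D : Derivation ℂ R R) (Y S I : PowerSeries R)
    (hI : (1 + Y) * I = 1) (h : coeffDeriv D Y = -(S * (1 + Y))) :
    coeffDeriv D (-(PowerSeries.derivative R Y * I)) = PowerSeries.derivative R S := by
  set Y' := PowerSeries.derivative R Y with hY'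
  set W := -(Y' * I) with hW
  have h1 : W * (1 + Y) = -Y' := by rw [hW]; linear_combination (-Y') * hI
  clear_value W
  have h2 := congrArg (coeffDeriv D) h1
  rw [coeffDeriv_mul, coeffDeriv_neg, hY', coeffDeriv_derivative, coeffDeriv_add, coeffDeriv_one,
    h] at h2
  simp only [map_neg, Derivation.leibniz, smul_eq_mul, map_add, ← hY',
    Derivation.map_one_eq_zero] at h2
  have h3 : coeffDeriv D W * (1 + Y) = PowerSeries.derivative R S * (1 + Y) := by
    linear_combination h2 + S * h1
  calc coeffDeriv D W = coeffDeriv D W * (1 + Y) * I := by rw [mul_assoc, hI, mul_one]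
    _ = _ := by rw [h3, mul_assoc, hI, mul_one]

end Primitive

open Polynomial in
/-- The formal series `∑_{s ≥ 1} (-1)^s F_s u^s`. -/
def fSeries : PowerSeries ℂ[X] :=
  PowerSeries.mk fun s => if s = 0 then 0 else (-1) ^ s * fPoly s

open Polynomial in
/-- The formal series `- F_0 u - (u / 2) ∑_{s ≥ 1} (-1)^s F_s u^s`. -/
def ySeries : PowerSeries ℂ[X] :=
  -(PowerSeries.X * (PowerSeries.C (fPoly 0) + PowerSeries.C (C (1 / 2)) * fSeries))

open Polynomial in
theorem coeff_fSeries_sq (s : ℕ) : PowerSeries.coeff s (fSeries * fSeries)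
    = (-1) ^ s * ∑ j ∈ Finset.Ico 1 s, fPoly j * fPoly (s - j) := by
  rw [PowerSeries.coeff_mul, Finset.Nat.sum_antidiagonal_eq_sum_range_succ_mk, Finset.mul_sum]
  symm
  refine Finset.sum_subset_zero_on_sdiff ?_ ?_ ?_
  · intro j hj; simp at hj ⊢; omega
  · intro j hj
    simp only [Finset.mem_sdiff, Finset.mem_range, Finset.mem_Ico, not_and, not_lt] at hj
    rcases Nat.eq_zero_or_pos j with h | h
    · simp [fSeries, h]
    · have : s - j = 0 := by have := hj.2 h; omega
      simp [fSeries, this]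
  · intro j hj
    rw [Finset.mem_Ico] at hj
    have h1 : j ≠ 0 := by omega
    have h2 : s - j ≠ 0 := by omega
    simp only [fSeries, PowerSeries.coeff_mk, h1, h2, if_false]
    have : (-1 : ℂ[X]) ^ s = (-1) ^ j * (-1) ^ (s - j) := by
      rw [← pow_add]; congr 1; omega
    rw [this]; ring

theorem sum_range_succ_eq_Ico {R : Type*} [CommRing R] (f : ℕ → R) (s : ℕ) (hs : 1 ≤ s) :
    ∑ j ∈ Finset.range (s + 1), f j * f (s - j)
      = 2 * (f 0 * f s) + ∑ j ∈ Finset.Ico 1 s, f j * f (s - j) := by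
  rw [Finset.sum_range_succ, Finset.range_eq_Ico, Finset.sum_eq_sum_Ico_succ_bot (by omega)]
  simp; ring

open Polynomial in
-- Coefficient by coefficient this is the recursion: the end terms `j = 0` and `j = s` of its sum
-- form `2 F_0 F_s`, matching the term `F_0` of `Y`, and the inner terms form the coefficient of
-- `fSeries ^ 2`.
theorem coeffDeriv_ySeries : coeffDeriv xiDeriv ySeries = -(fSeries * (1 + ySeries)) := by
  have hC : (C (1 / 2) : ℂ[X]) * 2 = 1 := by
    have h2 : (C 2 : ℂ[X]) = 2 := rfl
    rw [← h2, ← C_mul]; norm_num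
  have key : -(fSeries * (1 + ySeries)) = -fSeries + PowerSeries.X *
      (PowerSeries.C (fPoly 0) * fSeries + PowerSeries.C (C (1 / 2)) * (fSeries * fSeries)) := by
    rw [ySeries]; ring
  rw [key]
  ext1 n
  rw [coeff_coeffDeriv]
  rcases n with _ | s
  · simp [ySeries, fSeries]
  · rw [ySeries]
    simp only [map_neg, map_add, PowerSeries.coeff_succ_X_mul, PowerSeries.coeff_C_mul,
      coeff_fSeries_sq]
    rcases Nat.eq_zero_or_pos s with h | h
    · subst h
      simp [fSeries, xiDeriv_fPoly_zero]
    · have h0 : s ≠ 0 := by omega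
      have hD : xiDeriv (C (1 / 2) * ((-1) ^ s * fPoly s))
          = C (1 / 2) * ((-1) ^ s * xiDeriv (fPoly s)) := by
        simp only [xiDeriv_apply]
        rw [← C_1, ← C_neg, ← C_pow, derivative_C_mul, derivative_C_mul]; ring
      simp only [fSeries, PowerSeries.coeff_mk, PowerSeries.coeff_C, h0, if_false, map_zero,
        Nat.succ_ne_zero]
      rw [hD, xiDeriv_fPoly s h, sum_range_succ_eq_Ico _ _ h]
      linear_combination (-1) ^ s * (fPoly (s + 1) + fPoly 0 * fPoly s) * hC

theorem constantCoeff_one_add_ySeries :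
    PowerSeries.constantCoeff (1 + ySeries) = ((1 : (Polynomial ℂ)ˣ) : Polynomial ℂ) := by
  simp [ySeries]

open Polynomial in
/-- The derivative of `- log (1 + Y)` for `Y = ySeries`. -/
def wSeries : PowerSeries ℂ[X] :=
  -(PowerSeries.derivative _ ySeries * PowerSeries.invOfUnit (1 + ySeries) 1)

open Polynomial in
/-- `E_s^-` as a polynomial in `v = 1 / (z - 1)`. -/
def ePoly (s : ℕ) : ℂ[X] :=
  C ((-1) ^ s / (s : ℂ)) * PowerSeries.coeff (s - 1) wSeries

open Polynomial in
-- By `coeffDeriv_logDeriv`, `d/dξ` maps the `u`-derivative of `-log (1 + Y)` to that of `S`.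
-- Comparing coefficients of `u ^ (s - 1)` produces a factor `s` from the `u`-derivative, which the
-- division in `ePoly` removes.
theorem xiDeriv_ePoly (s : ℕ) (hs : 1 ≤ s) : xiDeriv (ePoly s) = fPoly s := by
  have h := coeffDeriv_logDeriv xiDeriv ySeries fSeries _
    (PowerSeries.mul_invOfUnit _ _ constantCoeff_one_add_ySeries) coeffDeriv_ySeries
  obtain ⟨m, rfl⟩ : ∃ m, s = m + 1 := ⟨s - 1, by omega⟩
  have h' := congrArg (PowerSeries.coeff m) h
  rw [coeff_coeffDeriv, PowerSeries.coeff_derivative] at h'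
  have hs' : ((m : ℂ) + 1) ≠ 0 := by exact_mod_cast Nat.succ_ne_zero m
  have hD : xiDeriv (ePoly (m + 1))
      = C ((-1) ^ (m + 1) / ((m + 1 : ℕ) : ℂ)) * xiDeriv (PowerSeries.coeff m wSeries) := by
    simp only [xiDeriv_apply, ePoly, derivative_C_mul, Nat.add_sub_cancel]; ring
  rw [hD, wSeries, h']
  simp only [fSeries, PowerSeries.coeff_mk, Nat.succ_ne_zero, if_false]
  have e1 : ((m : ℂ[X]) + 1) = C ((m : ℂ) + 1) := by simp
  have e2 : (-1 : ℂ[X]) ^ (m + 1) = C ((-1) ^ (m + 1)) := by simp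
  rw [e1, e2]
  have : C ((-1) ^ (m + 1) / ((m + 1 : ℕ) : ℂ)) * (C ((-1) ^ (m + 1)) * fPoly (m + 1) *
      C ((m : ℂ) + 1)) = C ((-1) ^ (m + 1) / ((m + 1 : ℕ) : ℂ) * (-1) ^ (m + 1) * ((m : ℂ) + 1))
        * fPoly (m + 1) := by
    simp only [C_mul]; ring
  rw [this]
  have : (-1 : ℂ) ^ (m + 1) / ((m + 1 : ℕ) : ℂ) * (-1) ^ (m + 1) * ((m : ℂ) + 1) = 1 := by
    push_cast
    field_simp
    rw [← pow_mul]; simp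
  rw [this]; simp

open Polynomial in
-- At a common zero of the `F_s` the series `Y` specialises to `0`, and so does the derivative of
-- `-log (1 + Y)`. This fixes the constant of integration at `z = 0` and gives the limit at `z = ∞`
-- at the same time.
theorem eval_ePoly_eq_zero (v : ℂ) (hv : ∀ s, (fPoly s).eval v = 0) (s : ℕ) :
    (ePoly s).eval v = 0 := by
  have hS : PowerSeries.map (evalRingHom v) fSeries = 0 := by
    ext n; simp [fSeries]; split_ifs <;> simp [hv]
  have hY : PowerSeries.map (evalRingHom v) ySeries = 0 := by
    simp [ySeries, hS, hv]
  have hY' : PowerSeries.map (evalRingHom v) (PowerSeries.derivative _ ySeries) = 0 := by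
    ext n
    have := congrArg (PowerSeries.coeff (n + 1)) hY
    rw [PowerSeries.coeff_map] at this ⊢
    rw [PowerSeries.coeff_derivative, map_mul, this]; simp
  have hW : PowerSeries.map (evalRingHom v) wSeries = 0 := by
    rw [wSeries, map_neg, map_mul, hY']; simp
  have := congrArg (PowerSeries.coeff (s - 1)) hW
  rw [PowerSeries.coeff_map] at this
  simp only [coe_evalRingHom, map_zero] at this
  simp [ePoly, this]

open Polynomial in
theorem dvd_ePoly (s : ℕ) : X * (1 + X) ∣ ePoly s := by
  refine IsCoprime.mul_dvd ⟨-1, 1, by ring⟩ ?_ ?_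
  · rw [X_dvd_iff, coeff_zero_eq_eval_zero]
    exact eval_ePoly_eq_zero 0 eval_fPoly_zero s
  · have : (1 + X : ℂ[X]) = X - C (-1) := by simp; ring
    rw [this, dvd_iff_isRoot]
    exact eval_ePoly_eq_zero (-1) eval_fPoly_neg_one s

end

/-! ### The rational functions `F s` and `E s`. -/

section

open Polynomial in
theorem hasDerivAt_eval_inv (p : ℂ[X]) {z : ℂ} (hz : z ≠ 1) :
    HasDerivAt (fun t : ℂ => p.eval (t - 1)⁻¹)
      (-((z - 1)⁻¹ ^ 2 * (derivative p).eval (z - 1)⁻¹)) z := by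
  have hz' : z - 1 ≠ 0 := sub_ne_zero.2 hz
  have h := (p.hasDerivAt (z - 1)⁻¹).comp z (((hasDerivAt_id z).sub_const 1).inv hz')
  refine h.congr_deriv ?_
  simp [div_eq_mul_inv]; ring

open Polynomial in
-- The factor `(z - 1) / (2z)` is `dξ/dz`, so this is the chain rule.
theorem eval_xiDeriv (p : ℂ[X]) {z : ℂ} (hz0 : z ≠ 0) (hz : z ≠ 1) :
    (z - 1) * (xiDeriv p).eval (z - 1)⁻¹ / (2 * z)
      = -((z - 1)⁻¹ ^ 2 * (derivative p).eval (z - 1)⁻¹) := by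
  have hz' : z - 1 ≠ 0 := sub_ne_zero.2 hz
  simp only [xiDeriv_apply, eval_mul, eval_neg, eval_C, eval_pow, eval_X, eval_add, eval_one]
  field_simp
  ring

theorem F_eq_eval (s : ℕ) : ∀ z : ℂ, z ≠ 1 → F s z = (fPoly s).eval (z - 1)⁻¹ := by
  induction s using Nat.strong_induction_on with
  | _ s ih =>
    intro z hz
    have hz' : z - 1 ≠ 0 := sub_ne_zero.2 hz
    have hz'' : 1 - z ≠ 0 := sub_ne_zero.2 hz.symm
    rcases s with _ | _ | s
    · simp [F, fPoly]; field_simp; ring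
    · simp [F, fPoly]; field_simp; ring
    · rw [F_succ (s + 1) (by omega), fPoly_succ (s + 1) (by omega)]
      have hd : deriv (F (s + 1)) z
          = -((z - 1)⁻¹ ^ 2 * (Polynomial.derivative (fPoly (s + 1))).eval (z - 1)⁻¹) := by
        rw [← (hasDerivAt_eval_inv (fPoly (s + 1)) hz).deriv]
        apply Filter.EventuallyEq.deriv_eq
        filter_upwards [isOpen_ne.mem_nhds hz] with t ht using ih (s + 1) (by omega) t ht
      rw [hd]
      simp only [Polynomial.eval_sub, Polynomial.eval_mul, Polynomial.eval_pow, Polynomial.eval_X,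
        Polynomial.eval_add, Polynomial.eval_one, Polynomial.eval_C, Polynomial.eval_finsetSum]
      congr 1
      · have : z / (1 - z) = -(1 + (z - 1)⁻¹) := by
          rw [← neg_sub z 1]; field_simp; ring
        rw [this]; ring
      · congr 1
        refine Finset.sum_congr rfl fun j hj => ?_
        have := Finset.mem_range.1 hj
        rw [ih j (by omega) z hz, ih (s + 1 - j) (by omega) z hz]

theorem integrandE_eq (s : ℕ) (hs : 1 ≤ s) {z : ℂ} (hz0 : z ≠ 0) (hz : z ≠ 1) :
    integrandE s z = -((z - 1)⁻¹ ^ 2 * (Polynomial.derivative (ePoly s)).eval (z - 1)⁻¹) := by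
  rw [integrandE, F_eq_eval s z hz, ← xiDeriv_ePoly s hs, eval_xiDeriv _ hz0 hz]

/-- Only interior points must avoid `0`: at `t = 0` division by zero gives `integrandE` the value
`0` instead of its limit, and a segment may begin there. A single point does not affect the
integral. -/
theorem segInt_integrandE (s : ℕ) (hs : 1 ≤ s) (p q : ℂ)
    (h1 : ∀ τ ∈ Set.Icc (0 : ℝ) 1, p + τ * (q - p) ≠ 1)
    (h0 : ∀ τ ∈ Set.Ioo (0 : ℝ) 1, p + τ * (q - p) ≠ 0) :
    segInt (integrandE s) p q = (ePoly s).eval (q - 1)⁻¹ - (ePoly s).eval (p - 1)⁻¹ := by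
  have hc : Continuous fun τ : ℝ => p + τ * (q - p) := by fun_prop
  have e : segInt (integrandE s) p q = ∫ τ in (0 : ℝ)..1,
      -((p + τ * (q - p) - 1)⁻¹ ^ 2 * (Polynomial.derivative (ePoly s)).eval
        (p + τ * (q - p) - 1)⁻¹) * (q - p) := by
    rw [segInt, intervalIntegral.integral_of_le zero_le_one,
      intervalIntegral.integral_of_le zero_le_one, MeasureTheory.integral_Ioc_eq_integral_Ioo,
      MeasureTheory.integral_Ioc_eq_integral_Ioo]
    refine MeasureTheory.setIntegral_congr_fun measurableSet_Ioo fun τ hτ => ?_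
    rw [integrandE_eq s hs (h0 τ hτ) (h1 τ (Set.Ioo_subset_Icc_self hτ))]
  rw [e, intervalIntegral.integral_eq_sub_of_hasDerivAt
    (f := fun τ : ℝ => (ePoly s).eval (p + τ * (q - p) - 1)⁻¹)]
  · simp
  · intro τ hτ
    rw [Set.uIcc_of_le zero_le_one] at hτ
    have hl : HasDerivAt (fun τ : ℝ => p + τ * (q - p)) (q - p) τ := by
      simpa using ((Complex.ofRealCLM.hasDerivAt (x := τ)).mul_const (q - p)).const_add p
    exact (hasDerivAt_eval_inv (ePoly s) (h1 τ hτ)).comp τ hl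
  · apply ContinuousOn.intervalIntegrable
    rw [Set.uIcc_of_le zero_le_one]
    have : ContinuousOn (fun τ : ℝ => (p + τ * (q - p) - 1)⁻¹) (Set.Icc 0 1) :=
      (hc.sub continuous_const).continuousOn.inv₀ fun τ hτ => sub_ne_zero.2 (h1 τ hτ)
    exact (((this.pow 2).mul ((Polynomial.continuous _).comp_continuousOn this)).neg).mul
      continuousOn_const

/-- The primitive is single-valued off `1`, so both choices of path give the same formula; the lower
limit `z = 0`, that is `v = -1`, contributes `0`. -/
theorem E_eq_eval (s : ℕ) (hs : 1 ≤ s) (z : ℂ) (hz : z ≠ 1) :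
    E s z = (ePoly s).eval (z - 1)⁻¹ := by
  have hm1 : (ePoly s).eval ((0 : ℂ) - 1)⁻¹ = 0 := by
    have : ((0 : ℂ) - 1)⁻¹ = -1 := by norm_num
    rw [this, eval_ePoly_eq_zero _ eval_fPoly_neg_one]
  rw [E]
  split_ifs with h
  · rw [segInt_integrandE s hs, segInt_integrandE s hs, hm1]
    · ring
    · rintro τ hτ h1
      have hre := congrArg Complex.re h1
      have him := congrArg Complex.im h1
      simp [h.1] at hre him
      have : τ = 1 := by linarith
      rw [this] at hre
      linarith [h.2]
    · rintro τ hτ h0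
      have := congrArg Complex.im h0
      simp [h.1] at this
      linarith [hτ.2]
    · rintro τ hτ h1
      have := congrArg Complex.re h1
      simp at this
    · rintro τ hτ h0
      have := congrArg Complex.im h0
      simp at this
      linarith [hτ.1]
  · by_cases hz0 : z = 0
    · subst hz0
      simpa [segInt] using hm1.symm
    rw [segInt_integrandE s hs, hm1, sub_zero]
    -- The segment from `0` to `z` meets `1` only when `z` is real and at least `1`; the value `1`
    -- is excluded by `hz` and larger ones by the case distinction.
    · intro τ hτ h1
      have hre := congrArg Complex.re h1
      have him := congrArg Complex.im h1
      simp at hre him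
      have hτ0 : τ ≠ 0 := by rintro rfl; simp at hre
      have him' : z.im = 0 := by tauto
      have hle : z.re ≤ 1 := not_lt.1 fun h' => h ⟨him', h'⟩
      apply hz
      apply Complex.ext
      · have : 1 ≤ z.re := by
          by_contra h'
          push Not at h'
          have : 0 < τ := lt_of_le_of_ne hτ.1 (Ne.symm hτ0)
          nlinarith [hτ.2]
        simpa using le_antisymm hle this
      · simpa using him'
    · intro τ hτ
      simpa using ⟨hτ.1.ne', hz0⟩

theorem tendsto_inv_sub_one_cobounded :
    Filter.Tendsto (fun z : ℂ => (z - 1)⁻¹) (Bornology.cobounded ℂ) (𝓝 0) := by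
  apply Filter.tendsto_inv₀_cobounded.comp
  rw [← tendsto_norm_atTop_iff_cobounded]
  refine Filter.tendsto_atTop_mono (fun z => ?_)
    (Filter.tendsto_atTop_add_const_right _ (-1) tendsto_norm_cobounded_atTop)
  have := norm_sub_norm_le z 1
  simp only [norm_one] at this
  linarith

theorem tendsto_eval_cobounded (p : Polynomial ℂ) :
    Filter.Tendsto (fun z : ℂ => p.eval (z - 1)⁻¹) (Bornology.cobounded ℂ) (𝓝 (p.eval 0)) :=
  ((Polynomial.continuous p).tendsto 0).comp tendsto_inv_sub_one_cobounded

theorem eventually_cobounded_ne_one : ∀ᶠ z : ℂ in Bornology.cobounded ℂ, z ≠ 1 := by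
  have : ∀ᶠ z : ℂ in Bornology.cobounded ℂ, z ∉ ({1} : Set ℂ) :=
    Bornology.isBounded_singleton
  simpa using this

theorem exists_eval_inv (q : Polynomial ℂ) :
    ∃ (P : Polynomial ℂ) (m : ℕ), ∀ z : ℂ, z ≠ 1 →
      q.eval (z - 1)⁻¹ = P.eval z / (z - 1) ^ m := by
  induction q using Polynomial.induction_on' with
  | add p q hp hq =>
    obtain ⟨P, m, hP⟩ := hp
    obtain ⟨Q, k, hQ⟩ := hq
    refine ⟨P * (Polynomial.X - 1) ^ k + Q * (Polynomial.X - 1) ^ m, m + k, fun z hz => ?_⟩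
    have hz' : z - 1 ≠ 0 := sub_ne_zero.2 hz
    simp [hP z hz, hQ z hz]
    field_simp
    ring
  | monomial n c =>
    exact ⟨Polynomial.C c, n, fun z hz => by simp [div_eq_mul_inv]⟩

theorem E_rational (s : ℕ) (hs : 1 ≤ s) :
    ∃ (P : Polynomial ℂ) (m : ℕ), ∀ z : ℂ, z ≠ 1 → E s z = z * P.eval z / (z - 1) ^ m := by
  obtain ⟨q, hq⟩ := dvd_ePoly s
  obtain ⟨P, m, hP⟩ := exists_eval_inv q
  -- At `v = 1 / (z - 1)` the factor `X * (1 + X)` equals `z / (z - 1) ^ 2`, whence the zero at `0`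
  -- and the two extra powers.
  refine ⟨P, m + 2, fun z hz => ?_⟩
  have hz' : z - 1 ≠ 0 := sub_ne_zero.2 hz
  rw [E_eq_eval s hs z hz, hq]
  simp [hP z hz]
  field_simp
  ring

theorem E_hasDerivAt (s : ℕ) (hs : 1 ≤ s) {z : ℂ} (hz0 : z ≠ 0) (hz : z ≠ 1) :
    HasDerivAt (E s) ((z - 1) * F s z / (2 * z)) z := by
  rw [F_eq_eval s z hz, ← xiDeriv_ePoly s hs, eval_xiDeriv _ hz0 hz]
  refine (hasDerivAt_eval_inv (ePoly s) hz).congr_of_eventuallyEq ?_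
  filter_upwards [isOpen_ne.mem_nhds hz] with t ht using E_eq_eval s hs t ht

theorem E_tendsto (s : ℕ) (hs : 1 ≤ s) :
    Filter.Tendsto (E s) (Bornology.cobounded ℂ) (𝓝 0) := by
  have h := tendsto_eval_cobounded (ePoly s)
  rw [eval_ePoly_eq_zero _ eval_fPoly_zero] at h
  refine h.congr' ?_
  filter_upwards [eventually_cobounded_ne_one] with z hz using (E_eq_eval s hs z hz).symm

end

/-! ### A Gronwall estimate for the linear system. -/

section

open Set MeasureTheory intervalIntegral

theorem hasDerivAt_primitive {V : Type*} [NormedAddCommGroup V] [NormedSpace ℝ V] [CompleteSpace V]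
    {f : ℝ → V} {α β s : ℝ} (hf : IntervalIntegrable f volume α β) (hs : s ∈ Ioo α β)
    (hc : ContinuousAt f s) : HasDerivAt (fun u => ∫ x in α..u, f x) (f s) s := by
  have hsub : IntervalIntegrable f volume α s := hf.mono_set (by
    rw [uIcc_of_le hs.1.le, uIcc_of_le (hs.1.trans hs.2).le]; exact Icc_subset_Icc_right hs.2.le)
  exact integral_hasDerivAt_right hsub
    ⟨Ioc α β, Ioc_mem_nhds hs.1 hs.2, hf.1.aestronglyMeasurable⟩ hc

theorem continuousOn_primitive_Icc {V : Type*} [NormedAddCommGroup V] [NormedSpace ℝ V]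
    {f : ℝ → V} {α β : ℝ} (hαβ : α ≤ β) (hf : IntervalIntegrable f volume α β) :
    ContinuousOn (fun u => ∫ x in α..u, f x) (Icc α β) := by
  have := continuousOn_primitive_interval' hf (a := α) left_mem_uIcc
  rwa [uIcc_of_le hαβ] at this

theorem intervalIntegrable_left {V : Type*} [NormedAddCommGroup V]
    {f : ℝ → V} {α β s : ℝ} (hf : IntervalIntegrable f volume α β) (hs : s ∈ Icc α β) :
    IntervalIntegrable f volume α s := hf.mono_set (by
    rw [uIcc_of_le hs.1, uIcc_of_le (hs.1.trans hs.2)]; exact Icc_subset_Icc_right hs.2)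

/-- Gronwall's inequality with an integrable, piecewise continuous rate. -/
theorem gronwall_integral {α β c : ℝ} (hαβ : α ≤ β) {S : Set ℝ} (hS : S.Countable)
    {Z b : ℝ → ℝ} (hZ : ContinuousOn Z (Icc α β)) (hb : IntervalIntegrable b volume α β)
    (hb0 : ∀ s, 0 ≤ b s) (hbc : ∀ s ∈ Ioo α β \ S, ContinuousAt b s)
    (h : ∀ s ∈ Icc α β, Z s ≤ c + ∫ x in α..s, b x * Z x) :
    Z β ≤ c * Real.exp (∫ x in α..β, b x) := by
  have hbZ : IntervalIntegrable (fun x => b x * Z x) volume α β :=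
    hb.mul_continuousOn (by rwa [uIcc_of_le hαβ])
  set W : ℝ → ℝ := fun s => c + ∫ x in α..s, b x * Z x with hW
  set B : ℝ → ℝ := fun s => ∫ x in α..s, b x with hB
  have hWc : ContinuousOn W (Icc α β) :=
    continuousOn_const.add (continuousOn_primitive_Icc hαβ hbZ)
  have hBc : ContinuousOn B (Icc α β) := continuousOn_primitive_Icc hαβ hb
  have hEc : ContinuousOn (fun s => Real.exp (-B s)) (Icc α β) := hBc.neg.rexp
  have hint : IntervalIntegrable
      (fun s => b s * ((Z s - W s) * Real.exp (-B s))) volume α β :=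
    hb.mul_continuousOn (by rw [uIcc_of_le hαβ]; exact (hZ.sub hWc).mul hEc)
  -- `W e^{-B}` has derivative `b (Z - W) e^{-B} ≤ 0`, hence `W(β) e^{-B(β)} ≤ W(α) = c`.
  have key := integral_eq_of_hasDerivAt_off_countable_of_le
    (fun s => W s * Real.exp (-B s)) (fun s => b s * ((Z s - W s) * Real.exp (-B s)))
    hαβ hS (hWc.mul hEc) (fun s hs => by
      have hsI := hs.1
      have hZs : ContinuousAt Z s := hZ.continuousAt (Icc_mem_nhds hsI.1 hsI.2)
      have d1 : HasDerivAt W (b s * Z s) s :=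
        (hasDerivAt_primitive hbZ hsI ((hbc s hs).mul hZs)).const_add c
      have d2 : HasDerivAt B (b s) s := hasDerivAt_primitive hb hsI (hbc s hs)
      refine (d1.mul d2.neg.exp).congr_deriv ?_
      simp only [Pi.neg_apply]
      ring) hint
  have hle : ∫ s in α..β, b s * ((Z s - W s) * Real.exp (-B s)) ≤ 0 := by
    rw [intervalIntegral.integral_of_le hαβ]
    refine setIntegral_nonpos measurableSet_Ioc fun s hs => ?_
    exact mul_nonpos_of_nonneg_of_nonpos (hb0 s) (mul_nonpos_of_nonpos_of_nonneg
      (sub_nonpos.2 (h s (Ioc_subset_Icc_self hs))) (Real.exp_pos _).le)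
  rw [key] at hle
  simp only [hW, hB, integral_same, neg_zero, Real.exp_zero, add_zero, mul_one] at hle
  have h1 := h β (right_mem_Icc.2 hαβ)
  rw [Real.exp_neg] at hle
  have hpos := Real.exp_pos (∫ x in α..β, b x)
  have h2 : (c + ∫ x in α..β, b x * Z x) ≤ c * Real.exp (∫ x in α..β, b x) := by
    have := mul_le_mul_of_nonneg_right (sub_nonpos.1 hle) hpos.le
    rwa [mul_assoc, inv_mul_cancel₀ hpos.ne', mul_one] at this
  exact h1.trans h2

/-- A bound for the first component of a linear system
`η' = G ω`, `ω' = - (G K + 2 σ) ω - R (1 + η)` when `Re ∫ G K` is nondecreasing. -/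
theorem linear_system_bound {α β κ : ℝ} (hαβ : α ≤ β) (hκ : 0 < κ) {S : Set ℝ} (hS : S.Countable)
    {η ω K G σ R k : ℝ → ℂ} {m : ℝ → ℝ}
    (hη : ContinuousOn η (Icc α β)) (hω : ContinuousOn ω (Icc α β)) (hK : ContinuousOn K (Icc α β))
    (hm : ContinuousOn m (Icc α β)) (hmono : MonotoneOn m (Icc α β))
    (hG : IntervalIntegrable G volume α β) (hσ : IntervalIntegrable σ volume α β)
    (hR : IntervalIntegrable R volume α β) (hk : IntervalIntegrable k volume α β)
    (hGc : ∀ s ∈ Ioo α β \ S, ContinuousAt G s) (hσc : ∀ s ∈ Ioo α β \ S, ContinuousAt σ s)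
    (hRc : ∀ s ∈ Ioo α β \ S, ContinuousAt R s) (hkc : ∀ s ∈ Ioo α β \ S, ContinuousAt k s)
    (dη : ∀ s ∈ Ioo α β \ S, HasDerivAt η (G s * ω s) s)
    (dω : ∀ s ∈ Ioo α β \ S,
      HasDerivAt ω (-(G s * K s + 2 * σ s) * ω s - R s * (1 + η s)) s)
    (dK : ∀ s ∈ Ioo α β \ S, HasDerivAt K (k s) s)
    (dm : ∀ s ∈ Ioo α β \ S, HasDerivAt m (G s * K s).re s)
    (hKκ : ∀ s ∈ Icc α β, 1 ≤ κ * ‖K s‖) :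
    ‖η β‖ ≤ κ * ((2 * ‖ω α‖ + ‖K α‖ * ‖η α‖ + ∫ s in α..β, 2 * ‖R s‖) *
      Real.exp (∫ s in α..β, (2 * ‖σ s‖ + 2 * κ * ‖R s‖ + κ * ‖k s‖))) := by
  have hU : uIcc α β = Icc α β := uIcc_of_le hαβ
  have hGK : IntervalIntegrable (fun s => G s * K s) volume α β :=
    hG.mul_continuousOn (by rwa [hU])
  -- Integrating factor for `G K`. Its modulus is `exp (m s - m α)`, which is nondecreasing and at
  -- least `1`.
  set P : ℝ → ℂ := fun s => Complex.exp (∫ x in α..s, G x * K x) with hP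
  have hPc : ContinuousOn P (Icc α β) :=
    Complex.continuous_exp.comp_continuousOn (continuousOn_primitive_Icc hαβ hGK)
  have hPn : ∀ s ∈ Icc α β, ‖P s‖ = Real.exp (m s - m α) := by
    intro s hs
    have hGs := intervalIntegrable_left hGK hs
    have e : (∫ x in α..s, G x * K x).re = ∫ x in α..s, (G x * K x).re :=
      (Complex.reCLM.intervalIntegral_comp_comm hGs).symm
    rw [hP, Complex.norm_exp, e]
    congr 1
    refine integral_eq_of_hasDerivAt_off_countable_of_le m _ hs.1 hS
      (hm.mono (Icc_subset_Icc_right hs.2)) (fun x hx => dm x ⟨⟨hx.1.1, hx.1.2.trans_le hs.2⟩, hx.2⟩)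
      ⟨hGs.1.re, hGs.2.re⟩
  set q : ℝ → ℝ := fun s => 2 * ‖σ s‖ * ‖ω s‖ + ‖R s‖ * (1 + ‖η s‖) with hq
  have hωn : ContinuousOn (fun s => ‖ω s‖) (uIcc α β) := by rw [hU]; exact hω.norm
  have hηn : ContinuousOn (fun s => ‖η s‖) (uIcc α β) := by rw [hU]; exact hη.norm
  have hqi : IntervalIntegrable q volume α β :=
    ((hσ.norm.const_mul 2).mul_continuousOn hωn).add
      (hR.norm.mul_continuousOn (continuousOn_const.add hηn))
  have hq0 : ∀ s, 0 ≤ q s := fun s => by positivity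
  set T : ℝ → ℂ := fun s => -(2 * σ s * ω s) - R s * (1 + η s) with hT
  have hTi : IntervalIntegrable T volume α β :=
    (((hσ.const_mul 2).mul_continuousOn (by rwa [hU])).neg).sub
      (hR.mul_continuousOn (by rw [hU]; exact continuousOn_const.add hη))
  have hTq : ∀ s, ‖T s‖ ≤ q s := by
    intro s
    refine (norm_sub_le _ _).trans ?_
    rw [norm_neg, norm_mul, norm_mul, norm_mul, Complex.norm_ofNat]
    have : ‖1 + η s‖ ≤ 1 + ‖η s‖ := by simpa using norm_add_le 1 (η s)
    have := mul_le_mul_of_nonneg_left this (norm_nonneg (R s))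
    simp only [hq]; linarith
  have bω : ∀ s ∈ Icc α β, ‖ω s‖ ≤ ‖ω α‖ + ∫ x in α..s, q x := by
    intro s hs
    have hsub : Icc α s ⊆ Icc α β := Icc_subset_Icc_right hs.2
    have hTs := intervalIntegrable_left hTi hs
    have hqs := intervalIntegrable_left hqi hs
    have hPT : IntervalIntegrable (fun x => T x * P x) volume α s :=
      hTs.mul_continuousOn (by rw [uIcc_of_le hs.1]; exact hPc.mono hsub)
    have key := integral_eq_of_hasDerivAt_off_countable_of_le (fun x => P x * ω x)
      (fun x => T x * P x) hs.1 hS ((hPc.mul hω).mono hsub) (fun x hx => by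
        have hx' : x ∈ Ioo α β \ S := ⟨⟨hx.1.1, hx.1.2.trans_le hs.2⟩, hx.2⟩
        have hKx : ContinuousAt K x := hK.continuousAt (Icc_mem_nhds hx'.1.1 hx'.1.2)
        have d1 : HasDerivAt P (P x * (G x * K x)) x :=
          (hasDerivAt_primitive hGK hx'.1 ((hGc x hx').mul hKx)).cexp
        refine (d1.mul (dω x hx')).congr_deriv ?_
        simp only [hT]; ring) hPT
    have hPα : P α = 1 := by simp [hP]
    -- From `(P ω)' = P T`. Monotonicity replaces `‖P x‖` by `‖P s‖`, which is then divided out, so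
    -- no exponential of `G K` survives.
    have hbound : ‖∫ x in α..s, T x * P x‖ ≤ ∫ x in α..s, q x * ‖P s‖ := by
      refine norm_integral_le_of_norm_le hs.1 (ae_of_all _ fun x hx => ?_) (hqs.mul_const _)
      rw [norm_mul]
      have hxI : x ∈ Icc α β := hsub (Ioc_subset_Icc_self hx)
      refine mul_le_mul (hTq x) ?_ (norm_nonneg _) (hq0 x)
      rw [hPn x hxI, hPn s hs]
      exact Real.exp_le_exp.2 (sub_le_sub_right (hmono hxI hs hx.2) _)
    have hP1 : 1 ≤ ‖P s‖ := by
      rw [hPn s hs, Real.one_le_exp_iff, sub_nonneg]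
      exact hmono (left_mem_Icc.2 hαβ) hs hs.1
    rw [key, hPα, one_mul, intervalIntegral.integral_mul_const] at hbound
    have h1 : ‖P s‖ * ‖ω s‖ ≤ ‖ω α‖ + (∫ x in α..s, q x) * ‖P s‖ := by
      rw [← norm_mul]
      have := norm_sub_norm_le (P s * ω s) (ω α)
      linarith
    have h2 : ‖ω α‖ ≤ ‖ω α‖ * ‖P s‖ := le_mul_of_one_le_right (norm_nonneg _) hP1
    have h3 : ‖P s‖ * ‖ω s‖ ≤ ‖P s‖ * (‖ω α‖ + ∫ x in α..s, q x) := by linarith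
    exact le_of_mul_le_mul_left h3 (by linarith)
  have hkη : IntervalIntegrable (fun s => ‖k s‖ * ‖η s‖) volume α β :=
    hk.norm.mul_continuousOn hηn
  have bη : ∀ s ∈ Icc α β, ‖K s‖ * ‖η s‖ ≤
      ‖ω s‖ + ‖ω α‖ + ‖K α‖ * ‖η α‖ + ∫ x in α..s, (q x + ‖k x‖ * ‖η x‖) := by
    intro s hs
    have hsub : Icc α s ⊆ Icc α β := Icc_subset_Icc_right hs.2
    have hi : IntervalIntegrable (fun x => T x + k x * η x) volume α β :=
      hTi.add (hk.mul_continuousOn (by rwa [hU]))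
    -- In the derivative of `ω + K η` the terms `-G K ω` and `K G ω` cancel, so `η` is estimated
    -- without any integral of `G`.
    have key := integral_eq_of_hasDerivAt_off_countable_of_le (fun x => ω x + K x * η x)
      (fun x => T x + k x * η x) hs.1 hS ((hω.add (hK.mul hη)).mono hsub) (fun x hx => by
        have hx' : x ∈ Ioo α β \ S := ⟨⟨hx.1.1, hx.1.2.trans_le hs.2⟩, hx.2⟩
        refine ((dω x hx').add ((dK x hx').mul (dη x hx'))).congr_deriv ?_
        simp only [hT]; ring) (intervalIntegrable_left hi hs)
    have hbound : ‖∫ x in α..s, (T x + k x * η x)‖ ≤ ∫ x in α..s, (q x + ‖k x‖ * ‖η x‖) := by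
      refine norm_integral_le_of_norm_le hs.1 (ae_of_all _ fun x _ => ?_)
        (intervalIntegrable_left (hqi.add hkη) hs)
      refine (norm_add_le _ _).trans ?_
      rw [norm_mul]
      exact add_le_add_left (hTq x) _
    rw [key] at hbound
    rw [← norm_mul, ← norm_mul]
    have e : K s * η s = (ω s + K s * η s - (ω α + K α * η α)) - ω s + ω α + K α * η α := by ring
    calc ‖K s * η s‖ ≤ ‖ω s + K s * η s - (ω α + K α * η α)‖ + ‖ω s‖ + ‖ω α‖ + ‖K α * η α‖ := by
          nth_rewrite 1 [e]
          refine (norm_add_le _ _).trans (add_le_add_left ?_ _)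
          refine (norm_add_le _ _).trans (add_le_add_left ?_ _)
          exact norm_sub_le _ _
      _ ≤ _ := by linarith
  -- With these weights `bη`, after inserting `bω` for `‖ω s‖`, and twice `bω` have the common
  -- right-hand side `2 ‖ω α‖ + ‖K α‖ ‖η α‖ + ∫ (2 q + ‖k‖ ‖η‖)`, so one Gronwall inequality handles
  -- both unknowns.
  set Z : ℝ → ℝ := fun s => max (‖η s‖ / κ) (2 * ‖ω s‖) with hZ
  have hZc : ContinuousOn Z (Icc α β) :=
    (hη.norm.div_const κ).sup (continuousOn_const.mul hω.norm)
  set b : ℝ → ℝ := fun s => 2 * ‖σ s‖ + 2 * κ * ‖R s‖ + κ * ‖k s‖ with hb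
  have hbi : IntervalIntegrable b volume α β :=
    ((hσ.norm.const_mul 2).add (hR.norm.const_mul (2 * κ))).add (hk.norm.const_mul κ)
  have h2R : IntervalIntegrable (fun s => 2 * ‖R s‖) volume α β := hR.norm.const_mul 2
  have hbZ : IntervalIntegrable (fun s => b s * Z s) volume α β :=
    hbi.mul_continuousOn (by rwa [hU])
  have hZle : ∀ s ∈ Icc α β, Z s ≤
      (2 * ‖ω α‖ + ‖K α‖ * ‖η α‖ + ∫ s in α..β, 2 * ‖R s‖) + ∫ x in α..s, b x * Z x := by
    intro s hs
    have hqs := intervalIntegrable_left hqi hs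
    have hks := intervalIntegrable_left hkη hs
    have i1 : ∫ x in α..s, (2 * q x + ‖k x‖ * ‖η x‖)
        ≤ ∫ x in α..s, (2 * ‖R x‖ + b x * Z x) := by
      refine integral_mono_on hs.1 ((hqs.const_mul 2).add hks)
        (intervalIntegrable_left (h2R.add hbZ) hs) fun x _ => ?_
      have z1 : ‖η x‖ ≤ κ * Z x := by
        rw [mul_comm, ← div_le_iff₀ hκ]; exact le_max_left _ _
      have z2 : 2 * ‖ω x‖ ≤ Z x := le_max_right _ _
      have t1 := mul_le_mul_of_nonneg_left z2 (norm_nonneg (σ x))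
      have t2 := mul_le_mul_of_nonneg_left z1 (norm_nonneg (R x))
      have t3 := mul_le_mul_of_nonneg_left z1 (norm_nonneg (k x))
      simp only [hq, hb]
      linarith
    have i2 : ∫ x in α..s, 2 * ‖R x‖ ≤ ∫ x in α..β, 2 * ‖R x‖ := by
      refine integral_mono_interval le_rfl hs.1 hs.2 (ae_of_all _ fun x => ?_) h2R
      simp only [Pi.zero_apply]; positivity
    rw [integral_add (intervalIntegrable_left h2R hs) (intervalIntegrable_left hbZ hs)] at i1
    have i3 : ∫ x in α..s, (2 * q x + ‖k x‖ * ‖η x‖)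
        = 2 * (∫ x in α..s, q x) + ∫ x in α..s, ‖k x‖ * ‖η x‖ := by
      rw [integral_add (hqs.const_mul 2) hks, intervalIntegral.integral_const_mul]
    have i4 : 0 ≤ ∫ x in α..s, ‖k x‖ * ‖η x‖ :=
      integral_nonneg hs.1 fun x _ => by positivity
    have i5 : ∫ x in α..s, (q x + ‖k x‖ * ‖η x‖)
        = (∫ x in α..s, q x) + ∫ x in α..s, ‖k x‖ * ‖η x‖ := integral_add hqs hks
    have w1 := bω s hs
    have w2 := bη s hs
    have w3 : ‖η s‖ / κ ≤ ‖K s‖ * ‖η s‖ := by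
      rw [div_le_iff₀ hκ]
      have := mul_le_mul_of_nonneg_right (hKκ s hs) (norm_nonneg (η s))
      linarith
    have : 0 ≤ ‖K α‖ * ‖η α‖ := by positivity
    refine max_le ?_ ?_ <;> linarith
  have hfin := gronwall_integral hαβ hS hZc hbi (fun s => by positivity) (fun s hs => by
    exact ((continuousAt_const.mul (hσc s hs).norm).add (continuousAt_const.mul (hRc s hs).norm)).add
      (continuousAt_const.mul (hkc s hs).norm)) hZle
  have : ‖η β‖ / κ ≤ Z β := le_max_left _ _
  rw [← div_le_iff₀' hκ]
  exact this.trans hfin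

end

section

open Set MeasureTheory intervalIntegral

/-- The bound of `linear_system_bound`, run from the right end of the interval. -/
theorem linear_system_bound_backward {α β κ : ℝ} (hαβ : α ≤ β) (hκ : 0 < κ) {S : Set ℝ}
    (hS : S.Countable) {η ω K G σ R k : ℝ → ℂ} {m : ℝ → ℝ}
    (hη : ContinuousOn η (Icc α β)) (hω : ContinuousOn ω (Icc α β)) (hK : ContinuousOn K (Icc α β))
    (hm : ContinuousOn m (Icc α β)) (hmono : AntitoneOn m (Icc α β))
    (hG : IntervalIntegrable G volume α β) (hσ : IntervalIntegrable σ volume α β)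
    (hR : IntervalIntegrable R volume α β) (hk : IntervalIntegrable k volume α β)
    (hGc : ∀ s ∈ Ioo α β \ S, ContinuousAt G s) (hσc : ∀ s ∈ Ioo α β \ S, ContinuousAt σ s)
    (hRc : ∀ s ∈ Ioo α β \ S, ContinuousAt R s) (hkc : ∀ s ∈ Ioo α β \ S, ContinuousAt k s)
    (dη : ∀ s ∈ Ioo α β \ S, HasDerivAt η (G s * ω s) s)
    (dω : ∀ s ∈ Ioo α β \ S,
      HasDerivAt ω (-(G s * K s + 2 * σ s) * ω s - R s * (1 + η s)) s)
    (dK : ∀ s ∈ Ioo α β \ S, HasDerivAt K (k s) s)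
    (dm : ∀ s ∈ Ioo α β \ S, HasDerivAt m (G s * K s).re s)
    (hKκ : ∀ s ∈ Icc α β, 1 ≤ κ * ‖K s‖) :
    ‖η α‖ ≤ κ * ((2 * ‖ω β‖ + ‖K β‖ * ‖η β‖ + ∫ s in α..β, 2 * ‖R s‖) *
      Real.exp (∫ s in α..β, (2 * ‖σ s‖ + 2 * κ * ‖R s‖ + κ * ‖k s‖))) := by
  have hmem : ∀ s ∈ Icc (-β) (-α), -s ∈ Icc α β := fun s hs => ⟨by linarith [hs.2], by linarith [hs.1]⟩
  have hmem' : ∀ s ∈ Ioo (-β) (-α) \ (Neg.neg ⁻¹' S), -s ∈ Ioo α β \ S := fun s hs =>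
    ⟨⟨by linarith [hs.1.2], by linarith [hs.1.1]⟩, hs.2⟩
  have hc {X : Type} [TopologicalSpace X] {f : ℝ → X} (hf : ContinuousOn f (Icc α β)) :
      ContinuousOn (fun s => f (-s)) (Icc (-β) (-α)) := hf.comp continuous_neg.continuousOn hmem
  have hi {f : ℝ → ℂ} (hf : IntervalIntegrable f volume α β) :
      IntervalIntegrable (fun s => -f (-s)) volume (-β) (-α) := by
    have := ((IntervalIntegrable.iff_comp_neg (f := f) (a := α) (b := β)).1 hf).symm
    exact this.neg
  have hcc {f : ℝ → ℂ} (hf : ∀ s ∈ Ioo α β \ S, ContinuousAt f s) :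
      ∀ s ∈ Ioo (-β) (-α) \ (Neg.neg ⁻¹' S), ContinuousAt (fun s => -f (-s)) s := fun s hs =>
    ((hf _ (hmem' s hs)).comp (f := fun s : ℝ => -s) continuous_neg.continuousAt).neg
  have hd {f : ℝ → ℂ} {f' : ℂ} {s : ℝ} (hf : HasDerivAt f f' (-s)) :
      HasDerivAt (fun s => f (-s)) (-f') s := by
    have := hf.scomp s (hasDerivAt_neg s)
    rw [neg_one_smul] at this
    exact this
  -- Under `s ↦ -s` the coefficients multiplying `ds` (`G`, `σ`, `R`, `k`) change sign, while `η`,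
  -- `ω`, `K`, `m` are merely reflected.
  have key := linear_system_bound (α := -β) (β := -α) (κ := κ) (S := Neg.neg ⁻¹' S)
    (η := fun s => η (-s)) (ω := fun s => ω (-s)) (K := fun s => K (-s)) (G := fun s => -G (-s))
    (σ := fun s => -σ (-s)) (R := fun s => -R (-s)) (k := fun s => -k (-s)) (m := fun s => m (-s))
    (by linarith) hκ (hS.preimage neg_injective) (hc hη) (hc hω) (hc hK) (hc hm)
    (fun x hx y hy hxy => hmono (hmem y hy) (hmem x hx) (by linarith))
    (hi hG) (hi hσ) (hi hR) (hi hk) (hcc hGc) (hcc hσc) (hcc hRc) (hcc hkc)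
    (fun s hs => (hd (dη _ (hmem' s hs))).congr_deriv (by ring))
    (fun s hs => (hd (dω _ (hmem' s hs))).congr_deriv (by ring))
    (fun s hs => hd (dK _ (hmem' s hs)))
    (fun s hs => by
      have := (dm _ (hmem' s hs)).scomp s (hasDerivAt_neg s)
      refine this.congr_deriv ?_
      simp)
    (fun s hs => hKκ _ (hmem s hs))
  simp only [norm_neg, neg_neg] at key
  rw [integral_comp_neg (fun s => 2 * ‖R s‖), integral_comp_neg
    (fun s => 2 * ‖σ s‖ + 2 * κ * ‖R s‖ + κ * ‖k s‖)] at key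
  simpa using key

end

/-! ### The incomplete gamma functions and their differential equations. -/

section

open Set MeasureTheory intervalIntegral

/-- The entire function `w^{-a} γ(a, w) = ∫_0^1 e^{-τ w} τ^{a-1} dτ`. -/
def gammaStar (a : ℝ) (w : ℂ) : ℂ :=
  ∫ τ in (0 : ℝ)..1, Complex.exp (-(τ * w)) * ((τ ^ (a - 1) : ℝ) : ℂ)

theorem intervalIntegrable_ofReal_rpow {r : ℝ} (hr : -1 < r) :
    IntervalIntegrable (fun τ : ℝ => ((τ ^ r : ℝ) : ℂ)) volume 0 1 :=
  have h : IntervalIntegrable (fun τ : ℝ => τ ^ r) volume 0 1 := intervalIntegrable_rpow' hr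
  ⟨h.1.ofReal, h.2.ofReal⟩

theorem intervalIntegrable_exp_mul_rpow (w : ℂ) {r : ℝ} (hr : -1 < r) :
    IntervalIntegrable (fun τ : ℝ => Complex.exp (-(τ * w)) * ((τ ^ r : ℝ) : ℂ)) volume 0 1 :=
  (intervalIntegrable_ofReal_rpow hr).continuousOn_mul (by fun_prop)

theorem mul_cpow_of_pos {τ : ℝ} (hτ : 0 < τ) {w : ℂ} (hw : w ≠ 0) (r : ℝ) :
    ((τ : ℂ) * w) ^ (r : ℂ) = ((τ ^ r : ℝ) : ℂ) * w ^ (r : ℂ) := by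
  have hτ' : (τ : ℂ) ≠ 0 := by exact_mod_cast hτ.ne'
  rw [Complex.cpow_def_of_ne_zero (mul_ne_zero hτ' hw), Complex.cpow_def_of_ne_zero hw,
    Complex.log_ofReal_mul hτ hw, Complex.ofReal_cpow hτ.le, Complex.cpow_def_of_ne_zero hτ',
    ← Complex.exp_add, ← Complex.ofReal_log hτ.le]
  congr 1; ring

theorem cpow_sub_one_mul {w : ℂ} (hw : w ≠ 0) (a : ℝ) :
    w ^ ((a - 1 : ℝ) : ℂ) * w = w ^ (a : ℂ) := by
  rw [Complex.ofReal_sub, Complex.ofReal_one, Complex.cpow_sub _ _ hw, Complex.cpow_one,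
    div_mul_cancel₀ _ hw]

theorem lowerGamma_eq {a : ℝ} (ha : 0 < a) (w : ℂ) :
    lowerGamma a w = w ^ (a : ℂ) * gammaStar a w := by
  rcases eq_or_ne w 0 with rfl | hw
  · have : (a : ℂ) ≠ 0 := by exact_mod_cast ha.ne'
    simp [lowerGamma, Complex.zero_cpow this]
  · rw [lowerGamma, gammaStar, ← intervalIntegral.integral_const_mul]
    refine integral_congr_Ioo_of_le zero_le_one fun τ hτ => ?_
    have e : (a : ℂ) - 1 = ((a - 1 : ℝ) : ℂ) := by push_cast; ring
    rw [e, mul_cpow_of_pos hτ.1 hw, ← cpow_sub_one_mul hw a]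
    ring

theorem gammaStar_zero {a : ℝ} (ha : 0 < a) : gammaStar a 0 = 1 / a := by
  have : ∫ τ in (0 : ℝ)..1, τ ^ (a - 1) = 1 / a := by
    rw [integral_rpow (Or.inl (by linarith))]
    simp [ha.ne']
  simp only [gammaStar, mul_zero, neg_zero, Complex.exp_zero, one_mul]
  rw [intervalIntegral.integral_ofReal, this]; simp

/-- Differentiation under the integral gives `D`; the identity is the integral over `[0, 1]` of the
`τ`-derivative of `e^{-τ w} τ^a`. -/
theorem exists_hasDerivAt_gammaStar {a : ℝ} (ha : 0 < a) (w : ℂ) :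
    ∃ D : ℂ, HasDerivAt (gammaStar a) D w ∧ w * D + a * gammaStar a w = Complex.exp (-w) := by
  have hr : -1 < a - 1 := by linarith
  have hd := (hasDerivAt_integral_of_dominated_loc_of_deriv_le (μ := volume) (a := 0) (b := 1)
    (F := fun (w : ℂ) (τ : ℝ) => Complex.exp (-(τ * w)) * ((τ ^ (a - 1) : ℝ) : ℂ))
    (F' := fun (w : ℂ) (τ : ℝ) => -(τ : ℂ) * Complex.exp (-(τ * w)) * ((τ ^ (a - 1) : ℝ) : ℂ))
    (bound := fun τ => Real.exp (‖w‖ + 1) * τ ^ (a - 1)) (x₀ := w)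
    (Metric.ball_mem_nhds w one_pos)
    (Filter.Eventually.of_forall fun x => (by
      simpa using (intervalIntegrable_exp_mul_rpow x hr).aestronglyMeasurable))
    (intervalIntegrable_exp_mul_rpow w hr)
    (by
      have := (intervalIntegrable_exp_mul_rpow w hr).continuousOn_mul
        (g := fun τ : ℝ => -(τ : ℂ)) (by fun_prop)
      have h := this.aestronglyMeasurable
      rw [uIoc_of_le zero_le_one]
      simpa [mul_assoc] using h)
    (ae_of_all _ fun τ hτ x hx => by
      rw [uIoc_of_le zero_le_one] at hτ
      rw [norm_mul, norm_mul, norm_neg, Complex.norm_real, Complex.norm_real, Complex.norm_exp,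
        Real.norm_of_nonneg hτ.1.le, Real.norm_of_nonneg (Real.rpow_nonneg hτ.1.le _)]
      refine mul_le_mul_of_nonneg_right ?_ (Real.rpow_nonneg hτ.1.le _)
      have hx1 : ‖x‖ ≤ ‖w‖ + 1 := by
        have := norm_sub_norm_le x w
        rw [mem_ball_iff_norm] at hx; linarith
      have h1 : (-(τ * x : ℂ)).re ≤ ‖w‖ + 1 := by
        refine (Complex.re_le_norm _).trans ?_
        rw [norm_neg, norm_mul, Complex.norm_real, Real.norm_of_nonneg hτ.1.le]
        exact (mul_le_of_le_one_left (norm_nonneg _) hτ.2).trans hx1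
      calc τ * Real.exp (-(τ * x : ℂ)).re ≤ 1 * Real.exp (‖w‖ + 1) :=
            mul_le_mul hτ.2 (Real.exp_le_exp.2 h1) (Real.exp_pos _).le zero_le_one
        _ = _ := one_mul _)
    ((intervalIntegrable_rpow' hr).const_mul _)
    (ae_of_all _ fun τ _ x _ => by
      have : HasDerivAt (fun x : ℂ => -((τ : ℂ) * x)) (-(τ : ℂ)) x := by
        simpa using ((hasDerivAt_id x).const_mul (τ : ℂ)).fun_neg
      exact (this.cexp.mul_const _).congr_deriv (by ring)))
  refine ⟨_, hd.2, ?_⟩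
  have hcont : ContinuousOn (fun τ : ℝ => Complex.exp (-(τ * w)) * ((τ ^ a : ℝ) : ℂ))
      (Icc 0 1) := by
    have : Continuous fun τ : ℝ => τ ^ a := Real.continuous_rpow_const ha.le
    exact Continuous.continuousOn (by fun_prop)
  have hint := ((hd.1.const_mul w).add ((intervalIntegrable_exp_mul_rpow w hr).const_mul (a : ℂ)))
  have key := integral_eq_sub_of_hasDerivAt_of_le zero_le_one hcont (fun τ hτ => by
      have d1 : HasDerivAt (fun τ : ℝ => Complex.exp (-(τ * w))) (Complex.exp (-(τ * w)) * -w) τ := by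
        have : HasDerivAt (fun τ : ℝ => -((τ : ℂ) * w)) (-w) τ := by
          simpa using ((Complex.ofRealCLM.hasDerivAt (x := τ)).mul_const w).fun_neg
        exact this.cexp
      have d2 : HasDerivAt (fun τ : ℝ => ((τ ^ a : ℝ) : ℂ)) ((a * τ ^ (a - 1) : ℝ) : ℂ) τ :=
        (Real.hasDerivAt_rpow_const (Or.inl hτ.1.ne')).ofReal_comp
      refine (d1.mul d2).congr_deriv ?_
      have : τ ^ a = τ * τ ^ (a - 1) := by
        rw [Real.rpow_sub_one hτ.1.ne']; field_simp [hτ.1.ne']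
      rw [this]
      push_cast
      ring) hint
  rw [integral_add (hd.1.const_mul w) ((intervalIntegrable_exp_mul_rpow w hr).const_mul (a : ℂ)),
    intervalIntegral.integral_const_mul, intervalIntegral.integral_const_mul] at key
  rw [gammaStar, key]
  simp [Real.zero_rpow ha.ne']

/-- The integrand `e^{-w} w^{a-1}` of the incomplete gamma functions. -/
def gammaIntegrand (a : ℝ) (w : ℂ) : ℂ := Complex.exp (-w) * w ^ ((a - 1 : ℝ) : ℂ)

theorem norm_gammaIntegrand (a : ℝ) (w : ℂ) :
    ‖gammaIntegrand a w‖ = Real.exp (-w.re) * ‖w‖ ^ (a - 1) := by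
  rw [gammaIntegrand, norm_mul, Complex.norm_exp, Complex.norm_cpow_real, Complex.neg_re]

theorem hasDerivAt_gammaIntegrand (a : ℝ) {w : ℂ} (hw : w ∈ Complex.slitPlane) :
    HasDerivAt (gammaIntegrand a)
      (-gammaIntegrand a w + (a - 1) * (gammaIntegrand a w / w)) w := by
  have hw0 := Complex.slitPlane_ne_zero hw
  have d1 : HasDerivAt (fun w : ℂ => Complex.exp (-w)) (Complex.exp (-w) * -1) w :=
    (hasDerivAt_id w).neg.cexp
  have d2 := (hasDerivAt_id w).cpow_const (c := ((a - 1 : ℝ) : ℂ)) hw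
  refine (d1.mul d2).congr_deriv ?_
  simp only [gammaIntegrand, id]
  rw [Complex.cpow_sub _ _ hw0, Complex.cpow_one]
  push_cast
  field_simp

theorem hasDerivAt_lowerGamma {a : ℝ} (ha : 0 < a) {w : ℂ} (hw : w ∈ Complex.slitPlane) :
    HasDerivAt (lowerGamma a) (gammaIntegrand a w) w := by
  have hw0 := Complex.slitPlane_ne_zero hw
  obtain ⟨D, hD, e⟩ := exists_hasDerivAt_gammaStar ha w
  have d2 := (hasDerivAt_id w).cpow_const (c := (a : ℂ)) hw
  have : lowerGamma a = fun w => w ^ (a : ℂ) * gammaStar a w := funext (lowerGamma_eq ha)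
  rw [this]
  refine (d2.mul hD).congr_deriv ?_
  simp only [gammaIntegrand, id, ← e, ← cpow_sub_one_mul hw0 a]
  push_cast
  ring

theorem tendsto_upperGamma_ofReal {a : ℝ} (ha : 0 < a) :
    Filter.Tendsto (fun x : ℝ => upperGamma a x) Filter.atTop (𝓝 0) := by
  have h := Complex.tendsto_partialGamma (s := (a : ℂ)) (by simpa using ha)
  have h2 : Filter.Tendsto (fun x : ℝ => lowerGamma a x) Filter.atTop (𝓝 (Complex.Gamma a)) := by
    rw [Complex.Gamma_eq_integral (by simpa using ha)]
    refine h.congr' ?_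
    filter_upwards [Filter.eventually_gt_atTop 0] with x hx
    rw [lowerGamma, Complex.partialGamma]
    have := intervalIntegral.integral_comp_mul_right (a := 0) (b := 1)
      (fun t : ℝ => Complex.exp (-(t : ℂ)) * (t : ℂ) ^ ((a : ℂ) - 1)) hx.ne'
    rw [zero_mul, one_mul, eq_inv_smul_iff₀ hx.ne'] at this
    rw [intervalIntegral.integral_mul_const, mul_comm]
    simp only [Complex.ofReal_neg, Complex.ofReal_exp]
    rw [← this]
    simp
  simpa [upperGamma] using h2.const_sub (Complex.Gamma a)

end

/-! ### Behaviour of `Γ(a, w)` as `Re w → +∞`. -/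

section

open Set MeasureTheory Filter

theorem tendsto_add_rpow_mul_exp_neg (a c : ℝ) :
    Tendsto (fun u : ℝ => (u + c) ^ a * Real.exp (-u)) atTop (𝓝 0) := by
  have h := ((tendsto_rpow_mul_exp_neg_mul_atTop_nhds_zero a 1 one_pos).comp
    (tendsto_atTop_add_const_right atTop c tendsto_id)).mul_const (Real.exp c)
  rw [zero_mul] at h
  refine h.congr fun u => ?_
  simp only [Function.comp, id]
  rw [mul_assoc, ← Real.exp_add]
  congr 2; ring

theorem integrableOn_add_rpow_mul_exp_neg (a : ℝ) :
    IntegrableOn (fun u : ℝ => (u + 1) ^ a * Real.exp (-u)) (Ioi 0) := by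
  refine integrable_of_isBigO_exp_neg (b := 1 / 2) (by norm_num) ?_ ?_
  · refine ContinuousOn.mul (ContinuousOn.rpow_const (by fun_prop) fun u hu => Or.inl ?_)
      (by fun_prop)
    have : (0 : ℝ) ≤ u := hu
    linarith
  · have h := ((tendsto_rpow_mul_exp_neg_mul_atTop_nhds_zero a (1 / 2) (by norm_num)).comp
      (tendsto_atTop_add_const_right atTop 1 tendsto_id)).mul_const (Real.exp (1 / 2))
    have h1 : (fun u : ℝ => (u + 1) ^ a * Real.exp (-u)) = fun u =>
        ((u + 1) ^ a * Real.exp (-(1 / 2) * (u + 1)) * Real.exp (1 / 2)) *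
          Real.exp (-(1 / 2) * u) := by
      funext u
      rw [mul_assoc, mul_assoc, ← Real.exp_add, ← Real.exp_add]
      congr 2; ring
    rw [h1]
    have h2 := (h.isBigO_one ℝ).mul (Asymptotics.isBigO_refl
      (fun u : ℝ => Real.exp (-(1 / 2) * u)) atTop)
    simpa using h2

theorem mem_slitPlane_of_re_pos {w : ℂ} (hw : 0 < w.re) : w ∈ Complex.slitPlane := Or.inl hw

theorem tendsto_gammaIntegrand_add (a : ℝ) (w : ℂ) :
    Tendsto (fun u : ℝ => Real.exp (-(w.re + u)) * (u + ‖w‖) ^ a) atTop (𝓝 0) := by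
  have h := (tendsto_add_rpow_mul_exp_neg a ‖w‖).const_mul (Real.exp (-w.re))
  rw [mul_zero] at h
  refine h.congr fun u => ?_
  rw [neg_add, Real.exp_add]; ring

theorem norm_gammaIntegrand_le {a : ℝ} (ha : 0 < a) {ξ : ℂ} {M : ℝ} (h1 : 1 ≤ ‖ξ‖) (hM : ‖ξ‖ ≤ M) :
    ‖gammaIntegrand a ξ‖ ≤ Real.exp (-ξ.re) * M ^ a := by
  rw [norm_gammaIntegrand]
  refine mul_le_mul_of_nonneg_left ?_ (Real.exp_pos _).le
  exact (Real.rpow_le_rpow_of_exponent_le h1 (by linarith)).trans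
    (Real.rpow_le_rpow (norm_nonneg _) hM ha.le)

/-- The limit on the positive real axis is transported along the vertical segment from `Re w + u` to
`w + u`. This has fixed length, and the integrand is exponentially small on it. -/
theorem tendsto_upperGamma_add {a : ℝ} (ha : 0 < a) (w : ℂ) (hw : 0 < w.re) :
    Tendsto (fun u : ℝ => upperGamma a (w + u)) atTop (𝓝 0) := by
  have h1 : Tendsto (fun u : ℝ => upperGamma a ((w.re + u : ℝ) : ℂ)) atTop (𝓝 0) :=
    (tendsto_upperGamma_ofReal ha).comp (tendsto_atTop_add_const_left atTop w.re tendsto_id)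
  have h2 : Tendsto (fun u : ℝ => upperGamma a (w + u) - upperGamma a ((w.re + u : ℝ) : ℂ))
      atTop (𝓝 0) := by
    have hl := (tendsto_gammaIntegrand_add a w).mul_const |w.im|
    rw [zero_mul] at hl
    refine squeeze_zero_norm' ?_ hl
    filter_upwards [eventually_ge_atTop 1] with u hu
    set p : ℂ := ((w.re + u : ℝ) : ℂ) with hp
    have hseg : ∀ ξ ∈ segment ℝ p (w + u), ξ.re = w.re + u ∧ ‖ξ‖ ≤ u + ‖w‖ := by
      intro ξ hξ
      rw [segment_eq_image'] at hξ
      obtain ⟨θ, hθ, rfl⟩ := hξ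
      have e : p + θ • (w + u - p) = u + (w.re + (θ * w.im : ℝ) * Complex.I) := by
        apply Complex.ext <;> simp [hp]
        ring
      beta_reduce
      rw [e]
      refine ⟨by simp; ring, (norm_add_le _ _).trans ?_⟩
      rw [Complex.norm_real, Real.norm_of_nonneg (by linarith)]
      refine add_le_add le_rfl ?_
      rw [Complex.norm_add_mul_I, Complex.norm_eq_sqrt_sq_add_sq w]
      refine Real.sqrt_le_sqrt ?_
      have : (θ * w.im) ^ 2 ≤ w.im ^ 2 := by
        rw [mul_pow]
        refine mul_le_of_le_one_left (sq_nonneg _) ?_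
        nlinarith [hθ.1, hθ.2]
      linarith
    have key := (convex_segment p (w + u)).norm_image_sub_le_of_norm_hasDerivWithin_le
      (f := lowerGamma a) (f' := gammaIntegrand a)
      (C := Real.exp (-(w.re + u)) * (u + ‖w‖) ^ a) (fun ξ hξ =>
        (hasDerivAt_lowerGamma ha (mem_slitPlane_of_re_pos (by
          rw [(hseg ξ hξ).1]; linarith))).hasDerivWithinAt)
      (fun ξ hξ => by
        obtain ⟨e1, e2⟩ := hseg ξ hξ
        have : 1 ≤ ‖ξ‖ := by
          have := Complex.re_le_norm ξ
          linarith
        rw [← e1]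
        exact norm_gammaIntegrand_le ha this e2)
      (right_mem_segment ℝ p (w + u)) (left_mem_segment ℝ p (w + u))
    have e1 : upperGamma a (w + u) - upperGamma a p = lowerGamma a p - lowerGamma a (w + u) := by
      simp [upperGamma]
    have e2 : ‖p - (w + u)‖ = |w.im| := by
      have : p - (w + u) = ((-w.im : ℝ) : ℂ) * Complex.I := by
        apply Complex.ext <;> simp [hp]
      rw [this, norm_mul, Complex.norm_I, mul_one, Complex.norm_real, Real.norm_eq_abs, abs_neg]
    rw [e1]
    rwa [e2] at key
  simpa using h2.add h1

/-- `Γ(a, w) ~ e^{-w} w^{a-1}` uniformly in the right half-plane. -/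
theorem exists_upperGamma_sub_le {a : ℝ} (ha : 0 < a) : ∃ C : ℝ, ∀ w : ℂ, 1 ≤ w.re →
    ‖upperGamma a w - gammaIntegrand a w‖ ≤ C * (‖gammaIntegrand a w‖ / ‖w‖) := by
  refine ⟨|a - 1| * ∫ u in Ioi (0 : ℝ), (u + 1) ^ a * Real.exp (-u), fun w hw => ?_⟩
  have hw1 : 1 ≤ ‖w‖ := hw.trans (Complex.re_le_norm w)
  have hre : ∀ u : ℝ, (w + u).re = w.re + u := fun u => by simp
  have hsl : ∀ u : ℝ, 0 ≤ u → w + u ∈ Complex.slitPlane := fun u hu =>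
    mem_slitPlane_of_re_pos (by rw [hre]; linarith)
  have hlow : ∀ u : ℝ, 0 ≤ u → ‖w‖ ≤ ‖w + u‖ := fun u hu => by
    rw [Complex.norm_def, Complex.norm_def]
    refine Real.sqrt_le_sqrt ?_
    simp only [Complex.normSq_apply, Complex.add_re, Complex.add_im, Complex.ofReal_re,
      Complex.ofReal_im, add_zero]
    nlinarith
  have hup : ∀ u : ℝ, 0 ≤ u → ‖w + u‖ ≤ ‖w‖ * (u + 1) := fun u hu => by
    refine (norm_add_le _ _).trans ?_
    rw [Complex.norm_real, Real.norm_of_nonneg hu]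
    nlinarith
  set c : ℝ := ‖gammaIntegrand a w‖ / ‖w‖ with hc
  have hbd : ∀ u : ℝ, 0 ≤ u → ‖gammaIntegrand a (w + u) / (w + u)‖
      ≤ c * ((u + 1) ^ a * Real.exp (-u)) := by
    intro u hu
    have hpos : 0 < ‖w‖ := by linarith
    have hposu : 0 < ‖w + u‖ := hpos.trans_le (hlow u hu)
    rw [norm_div, hc, norm_gammaIntegrand, norm_gammaIntegrand, hre]
    have hρ1 : 1 ≤ ‖w + u‖ / ‖w‖ := (one_le_div hpos).2 (hlow u hu)
    have hρ2 : ‖w + u‖ / ‖w‖ ≤ u + 1 := by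
      rw [div_le_iff₀ hpos, mul_comm]; exact hup u hu
    -- The ratio is at least `1`, so the exponent may be raised from `a - 2`, of unknown sign, to
    -- the positive `a`.
    have hρ : (‖w + u‖ / ‖w‖) ^ (a - 1 - 1) ≤ (u + 1) ^ a :=
      (Real.rpow_le_rpow_of_exponent_le hρ1 (by linarith)).trans
        (Real.rpow_le_rpow (by positivity) hρ2 ha.le)
    have e : ‖w + u‖ ^ (a - 1) / ‖w + u‖ = ‖w‖ ^ (a - 1) / ‖w‖ * (‖w + u‖ / ‖w‖) ^ (a - 1 - 1) := by
      rw [← Real.rpow_sub_one hposu.ne', ← Real.rpow_sub_one hpos.ne',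
        Real.div_rpow hposu.le hpos.le]
      have := (Real.rpow_pos_of_pos hpos (a - 1 - 1)).ne'
      field_simp
    rw [mul_div_assoc, e, neg_add, Real.exp_add]
    have : 0 ≤ Real.exp (-w.re) * Real.exp (-u) * (‖w‖ ^ (a - 1) / ‖w‖) := by positivity
    calc _ = Real.exp (-w.re) * Real.exp (-u) * (‖w‖ ^ (a - 1) / ‖w‖)
            * (‖w + u‖ / ‖w‖) ^ (a - 1 - 1) := by ring
      _ ≤ Real.exp (-w.re) * Real.exp (-u) * (‖w‖ ^ (a - 1) / ‖w‖) * (u + 1) ^ a :=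
        mul_le_mul_of_nonneg_left hρ this
      _ = _ := by ring
  -- The leading terms cancel: the derivative of `Γ(a, w) - e^{-w} w^{a-1}` is `-(a - 1) e^{-w}
  -- w^{a-2}`, smaller by a factor of order `1 / w`. It is integrated over the horizontal ray from
  -- `w`.
  have hder : ∀ u ∈ Ici (0 : ℝ), HasDerivAt
      (fun u : ℝ => upperGamma a (w + u) - gammaIntegrand a (w + u))
      (-((a - 1) * (gammaIntegrand a (w + u) / (w + u)))) u := by
    intro u hu
    have hl : HasDerivAt (fun u : ℝ => w + (u : ℂ)) 1 u := by
      simpa using (Complex.ofRealCLM.hasDerivAt (x := u)).const_add w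
    have h1 := (hasDerivAt_lowerGamma ha (hsl u hu)).const_sub (Complex.Gamma a)
    have h2 := hasDerivAt_gammaIntegrand a (hsl u hu)
    refine ((h1.comp u hl).sub (h2.comp u hl)).congr_deriv ?_
    ring
  have hmeas : ContinuousOn
      (fun u : ℝ => -((a - 1) * (gammaIntegrand a (w + u) / (w + u)))) (Ioi 0) := by
    intro u hu
    have hl : ContinuousAt (fun u : ℝ => w + (u : ℂ)) u := by fun_prop
    have hs := hsl u (le_of_lt hu)
    have h2 : ContinuousAt (fun u : ℝ => gammaIntegrand a (w + u)) u :=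
      (hasDerivAt_gammaIntegrand a hs).continuousAt.comp (f := fun u : ℝ => w + (u : ℂ)) hl
    exact ((continuousAt_const.mul
      (h2.div hl (Complex.slitPlane_ne_zero hs))).neg).continuousWithinAt
  have hbd' : ∀ u ∈ Ioi (0 : ℝ), ‖-((a - 1) * (gammaIntegrand a (w + u) / (w + u)))‖
      ≤ |a - 1| * c * ((u + 1) ^ a * Real.exp (-u)) := by
    intro u hu
    rw [norm_neg, norm_mul, mul_assoc]
    have : ‖(a : ℂ) - 1‖ = |a - 1| := by
      rw [← Complex.ofReal_one, ← Complex.ofReal_sub, Complex.norm_real, Real.norm_eq_abs]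
    rw [this]
    exact mul_le_mul_of_nonneg_left (hbd u (le_of_lt hu)) (abs_nonneg _)
  have hdom := (integrableOn_add_rpow_mul_exp_neg a).const_mul (|a - 1| * c)
  have hint : IntegrableOn
      (fun u : ℝ => -((a - 1) * (gammaIntegrand a (w + u) / (w + u)))) (Ioi 0) :=
    hdom.mono' (hmeas.aestronglyMeasurable measurableSet_Ioi)
      ((ae_restrict_iff' measurableSet_Ioi).2 (ae_of_all _ hbd'))
  have hlim : Tendsto (fun u : ℝ => upperGamma a (w + u) - gammaIntegrand a (w + u)) atTop
      (𝓝 0) := by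
    have hf : Tendsto (fun u : ℝ => gammaIntegrand a (w + u)) atTop (𝓝 0) := by
      refine squeeze_zero_norm' ?_ (tendsto_gammaIntegrand_add a w)
      filter_upwards [eventually_ge_atTop 0] with u hu
      rw [← hre]
      refine norm_gammaIntegrand_le ha (hw1.trans (hlow u hu)) ?_
      refine (norm_add_le _ _).trans ?_
      rw [Complex.norm_real, Real.norm_of_nonneg hu, add_comm]
    simpa using (tendsto_upperGamma_add ha w (by linarith)).sub hf
  have key := integral_Ioi_of_hasDerivAt_of_tendsto' hder hint hlim
  have hn := norm_integral_le_of_norm_le hdom ((ae_restrict_iff' measurableSet_Ioi).2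
    (ae_of_all _ hbd'))
  rw [key, integral_const_mul] at hn
  simp only [Complex.ofReal_zero, add_zero, zero_sub, norm_neg] at hn
  linarith

end

/-! ### The equation for `1 + η` and its linearisation. -/

section

open Set Filter

/-- `∑_{k, l = 1}^{n - 1} x_k x_l` split into the terms with `k + l < n` and those with
`k + l ≥ n`. -/
theorem sq_sum_Ico_eq {R : Type*} [CommRing R] (x : ℕ → R) (n : ℕ) :
    (∑ s ∈ Finset.Ico 1 n, x s) ^ 2 =
      ∑ s ∈ Finset.Ico 1 n, ∑ j ∈ Finset.Ico 1 s, x j * x (s - j) +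
        ∑ s ∈ Finset.Ico 1 n, ∑ k ∈ Finset.Ico s n, x k * x (s + n - k - 1) := by
  rw [sq, Finset.sum_mul_sum]
  have h1 : ∀ k ∈ Finset.Ico 1 n, ∑ l ∈ Finset.Ico 1 n, x k * x l =
      ∑ l ∈ Finset.Ico 1 (n - k), x k * x l + ∑ l ∈ Finset.Ico (n - k) n, x k * x l := by
    intro k hk
    rw [Finset.mem_Ico] at hk
    rw [Finset.sum_Ico_consecutive] <;> omega
  rw [Finset.sum_congr rfl h1, Finset.sum_add_distrib]
  congr 1
  · rw [Finset.sum_sigma', Finset.sum_sigma']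
    refine Finset.sum_bij' (fun p _ => ⟨p.1 + p.2, p.1⟩) (fun p _ => ⟨p.2, p.1 - p.2⟩) ?_ ?_ ?_ ?_ ?_
    · rintro ⟨k, l⟩ h; simp only [Finset.mem_sigma, Finset.mem_Ico] at h ⊢; omega
    · rintro ⟨k, l⟩ h; simp only [Finset.mem_sigma, Finset.mem_Ico] at h ⊢; omega
    · rintro ⟨k, l⟩ h; simp
    · rintro ⟨k, l⟩ h; simp only [Finset.mem_sigma, Finset.mem_Ico] at h; simp; omega
    · rintro ⟨k, l⟩ h; simp
  · rw [Finset.sum_sigma', Finset.sum_sigma']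
    refine Finset.sum_bij' (fun p _ => ⟨p.1 + p.2 + 1 - n, p.1⟩)
      (fun p _ => ⟨p.2, p.1 + n - p.2 - 1⟩) ?_ ?_ ?_ ?_ ?_
    · rintro ⟨k, l⟩ h; simp only [Finset.mem_sigma, Finset.mem_Ico] at h ⊢; omega
    · rintro ⟨k, l⟩ h; simp only [Finset.mem_sigma, Finset.mem_Ico] at h ⊢; omega
    · rintro ⟨k, l⟩ h; simp only [Finset.mem_sigma, Finset.mem_Ico] at h; simp; omega
    · rintro ⟨k, l⟩ h; simp only [Finset.mem_sigma, Finset.mem_Ico] at h; simp; omega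
    · rintro ⟨k, l⟩ h
      simp only [Finset.mem_sigma, Finset.mem_Ico] at h
      have : k + l + 1 - n + n - k - 1 = l := by omega
      simp [this]

/-- `(-1)^s F_s^- / a^s`. -/
def fTerm (a : ℝ) (z : ℂ) (s : ℕ) : ℂ := (-1) ^ s * (F s z / (a : ℂ) ^ s)

/-- `∑_{s=1}^{n-1} (-1)^s F_s^- / a^s`. -/
def fSum (n : ℕ) (a : ℝ) (z : ℂ) : ℂ := ∑ s ∈ Finset.Ico 1 n, fTerm a z s

/-- `∑_{s=1}^{n-1} (-1)^s E_s^- / a^s`. -/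
def eSum (n : ℕ) (a : ℝ) (z : ℂ) : ℂ := ∑ s ∈ Finset.Ico 1 n, (-1) ^ s * (E s z / (a : ℂ) ^ s)

/-- `1 + z / (a (z - 1)^2)`. -/
def kFun (a : ℝ) (z : ℂ) : ℂ := 1 + z / (a * (z - 1) ^ 2)

/-- `1 + z / (a (z - 1)^2) - (1 / 2a) ∑_{s=1}^{n-1} (-1)^s F_s^- / a^s`. -/
def ratioFun (n : ℕ) (a : ℝ) (z : ℂ) : ℂ := kFun a z - fSum n a z / (2 * a)

/-- The derivative of `eSum`. -/
def eSumDeriv (n : ℕ) (a : ℝ) (z : ℂ) : ℂ := (z - 1) / (2 * z) * fSum n a z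

/-- The residual of the truncated expansion. -/
def residual (n : ℕ) (a : ℝ) (z : ℂ) : ℂ :=
  -((z - 1) / (2 * z) * (fTerm a z n + 1 / (2 * a) *
    ∑ s ∈ Finset.Ico 1 n, ∑ k ∈ Finset.Ico s n, fTerm a z k * fTerm a z (s + n - k - 1)))

/-- The factor relating `h'` to `omegaFun`. -/
def gFun (a : ℝ) (z : ℂ) : ℂ := a * (1 - z) / z

/-- `h' / gFun` for a solution `h` of the first-order equation, in terms of `h`. -/
def omegaFun (n : ℕ) (a : ℝ) (z h : ℂ) : ℂ := Complex.exp (-eSum n a z) - ratioFun n a z * h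

variable {n : ℕ} {a : ℝ} {z : ℂ}

theorem hasDerivAt_F (s : ℕ) (hz : z ≠ 1) :
    HasDerivAt (F s) (-((z - 1)⁻¹ ^ 2 * (Polynomial.derivative (fPoly s)).eval (z - 1)⁻¹)) z := by
  refine (hasDerivAt_eval_inv (fPoly s) hz).congr_of_eventuallyEq ?_
  filter_upwards [isOpen_ne.mem_nhds hz] with t ht using F_eq_eval s t ht

theorem hasDerivAt_F_of_pos {s : ℕ} (hs : 1 ≤ s) (hz0 : z ≠ 0) (hz : z ≠ 1) :
    HasDerivAt (F s) ((z - 1) / (2 * z) *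
      (-(2 * F (s + 1) z) - ∑ j ∈ Finset.range (s + 1), F j z * F (s - j) z)) z := by
  have e : -(2 * F (s + 1) z) - ∑ j ∈ Finset.range (s + 1), F j z * F (s - j) z
      = (xiDeriv (fPoly s)).eval (z - 1)⁻¹ := by
    rw [xiDeriv_fPoly s hs]
    simp [Polynomial.eval_finsetSum, F_eq_eval _ z hz]
  refine (hasDerivAt_F s hz).congr_deriv ?_
  rw [e, ← eval_xiDeriv _ hz0 hz]
  ring

theorem hasDerivAt_eSum (hz0 : z ≠ 0) (hz : z ≠ 1) :
    HasDerivAt (eSum n a) (eSumDeriv n a z) z := by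
  have : HasDerivAt (eSum n a)
      (∑ s ∈ Finset.Ico 1 n, (-1) ^ s * (((z - 1) * F s z / (2 * z)) / (a : ℂ) ^ s)) z := by
    refine HasDerivAt.fun_sum fun s hs => ?_
    exact ((E_hasDerivAt s (Finset.mem_Ico.1 hs).1 hz0 hz).div_const _).const_mul _
  refine this.congr_deriv ?_
  rw [eSumDeriv, fSum, Finset.mul_sum]
  refine Finset.sum_congr rfl fun s _ => ?_
  rw [fTerm]; ring

theorem hasDerivAt_kFun (ha : a ≠ 0) (hz : z ≠ 1) :
    HasDerivAt (kFun a) (-((z + 1) / (z - 1) ^ 3) / a) z := by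
  have hz' : z - 1 ≠ 0 := sub_ne_zero.2 hz
  have ha' : (a : ℂ) ≠ 0 := by exact_mod_cast ha
  have h := ((hasDerivAt_id z).div ((((hasDerivAt_id z).sub_const 1).pow 2).const_mul (a : ℂ))
    (mul_ne_zero ha' (pow_ne_zero 2 hz'))).const_add 1
  refine h.congr_deriv ?_
  simp only [id]
  field_simp
  simp
  ring

theorem fTerm_mul {j s : ℕ} (hj : j ≤ s) :
    fTerm a z j * fTerm a z (s - j) = (-1) ^ s / (a : ℂ) ^ s * (F j z * F (s - j) z) := by
  have e1 : (-1 : ℂ) ^ s = (-1) ^ j * (-1) ^ (s - j) := by rw [← pow_add]; congr 1; omega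
  have e2 : (a : ℂ) ^ s = (a : ℂ) ^ j * (a : ℂ) ^ (s - j) := by rw [← pow_add]; congr 1; omega
  rw [fTerm, fTerm, e1, e2]
  simp only [div_eq_mul_inv, mul_inv]
  ring

theorem sum_Ico_succ_shift {R : Type*} [CommRing R] (x : ℕ → R) {n : ℕ} (hn : 1 ≤ n) :
    x 1 + ∑ s ∈ Finset.Ico 1 n, x (s + 1) = ∑ s ∈ Finset.Ico 1 n, x s + x n := by
  induction n, hn using Nat.le_induction with
  | base => simp
  | succ n hn ih =>
    rw [Finset.sum_Ico_succ_top hn, Finset.sum_Ico_succ_top hn, ← add_assoc, ih]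

/-- This is `dY/dξ = -S (1 + Y)` for the truncated series. By the recursion the derivatives of the
`F_s` telescope; the products of total degree below `n` cancel against the square of the truncated
sum (`sq_sum_Ico_eq`). The term of degree `n` and the products of degree at least `n` remain as
`residual`. -/
theorem hasDerivAt_ratioFun (hn : 1 ≤ n) (ha : a ≠ 0) (hz0 : z ≠ 0) (hz : z ≠ 1) :
    HasDerivAt (ratioFun n a) (residual n a z - eSumDeriv n a z * ratioFun n a z) z := by
  have ha' : (a : ℂ) ≠ 0 := by exact_mod_cast ha
  have hz' : z - 1 ≠ 0 := sub_ne_zero.2 hz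
  have hS : HasDerivAt (fSum n a) (∑ s ∈ Finset.Ico 1 n, (-1) ^ s * (((z - 1) / (2 * z) *
      (-(2 * F (s + 1) z) - ∑ j ∈ Finset.range (s + 1), F j z * F (s - j) z)) / (a : ℂ) ^ s)) z :=
    HasDerivAt.fun_sum fun s hs =>
      ((hasDerivAt_F_of_pos (Finset.mem_Ico.1 hs).1 hz0 hz).div_const _).const_mul _
  refine ((hasDerivAt_kFun ha hz).sub (hS.div_const (2 * (a : ℂ)))).congr_deriv ?_
  set x := fTerm a z with hx
  have hterm : ∀ s ∈ Finset.Ico 1 n, (-1) ^ s * (((z - 1) / (2 * z) *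
      (-(2 * F (s + 1) z) - ∑ j ∈ Finset.range (s + 1), F j z * F (s - j) z)) / (a : ℂ) ^ s)
      = (z - 1) / (2 * z) * (2 * a * x (s + 1) - 2 * x 0 * x s -
        ∑ j ∈ Finset.Ico 1 s, x j * x (s - j)) := by
    intro s hs
    have hs1 := (Finset.mem_Ico.1 hs).1
    have e1 : ∑ j ∈ Finset.range (s + 1), x j * x (s - j)
        = (-1) ^ s / (a : ℂ) ^ s * ∑ j ∈ Finset.range (s + 1), F j z * F (s - j) z := by
      rw [Finset.mul_sum]
      refine Finset.sum_congr rfl fun j hj => fTerm_mul ?_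
      have := Finset.mem_range.1 hj; omega
    have e2 := sum_range_succ_eq_Ico x s hs1
    have e3 : 2 * a * x (s + 1) = (-1) ^ s / (a : ℂ) ^ s * -(2 * F (s + 1) z) := by
      rw [hx, fTerm, pow_succ, pow_succ]; field_simp
    have e4 : ∑ j ∈ Finset.Ico 1 s, x j * x (s - j)
        = ∑ j ∈ Finset.range (s + 1), x j * x (s - j) - 2 * (x 0 * x s) := by rw [e2]; ring
    rw [e3, e4, e1]
    ring
  rw [Finset.sum_congr rfl hterm, ← Finset.mul_sum, Finset.sum_sub_distrib, Finset.sum_sub_distrib,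
    ← Finset.mul_sum, ← Finset.mul_sum]
  have hsq := sq_sum_Ico_eq x n
  have hsh := sum_Ico_succ_shift x hn
  have hK : kFun a z = 1 - x 0 / a := by
    rw [kFun, hx, fTerm, F]; field_simp; simp
  have h1 : -((z + 1) / (z - 1) ^ 3) / a = -((z - 1) / (2 * z) * x 1) := by
    rw [hx, fTerm, F]; field_simp
  rw [residual, eSumDeriv, ratioFun, hK, h1, fSum, ← hx]
  have h2 : (2 * (a : ℂ))⁻¹ * (2 * a) = 1 := inv_mul_cancel₀ (mul_ne_zero two_ne_zero ha')
  have h3 : (2 * (a : ℂ))⁻¹ * 2 = (a : ℂ)⁻¹ := by field_simp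
  simp only [div_eq_mul_inv] at *
  linear_combination (-(z - 1) * (2 * z)⁻¹) * hsh + (-(z-1) * (2 * z)⁻¹ * (2 * (a : ℂ))⁻¹) * hsq
    - ((z - 1) * (2 * z)⁻¹ * ∑ s ∈ Finset.Ico 1 n, x (s + 1)) * h2
    + ((z - 1) * (2 * z)⁻¹ * x 0 * ∑ s ∈ Finset.Ico 1 n, x s) * h3

/-- The correction `-fSum / (2a)` in `ratioFun` contributes exactly one `eSumDeriv`; the other one
in the coefficient `2σ` of `hasDerivAt_omegaFun` comes from differentiating the exponential and
`ratioFun`. -/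
theorem gFun_mul_ratioFun (ha : a ≠ 0) (hz0 : z ≠ 0) :
    gFun a z * ratioFun n a z = gFun a z * kFun a z + eSumDeriv n a z := by
  have ha' : (a : ℂ) ≠ 0 := by exact_mod_cast ha
  rw [ratioFun, gFun, eSumDeriv]
  field_simp
  ring

/-- The right-hand side is the derivative of `-2 (a ξ - E_0^-)`, whose real part is `-2 Ξ`. -/
theorem gFun_mul_kFun (ha : a ≠ 0) (hz0 : z ≠ 0) (hz : z ≠ 1) :
    gFun a z * kFun a z = -a + a / z + 1 / (1 - z) := by
  have ha' : (a : ℂ) ≠ 0 := by exact_mod_cast ha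
  have hz' : z - 1 ≠ 0 := sub_ne_zero.2 hz
  have hz'' : 1 - z ≠ 0 := sub_ne_zero.2 hz.symm
  rw [kFun, gFun]
  field_simp
  ring

/-- If `h` solves the first-order equation along the path `p`, then `omegaFun` solves the
linearised one. -/
theorem hasDerivAt_omegaFun {p h : ℝ → ℂ} {p' : ℂ} {s : ℝ} (hn : 1 ≤ n) (ha : a ≠ 0)
    (hp0 : p s ≠ 0) (hp1 : p s ≠ 1) (hp : HasDerivAt p p' s)
    (hh : HasDerivAt h (gFun a (p s) * p' * omegaFun n a (p s) (h s)) s) :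
    HasDerivAt (fun s => omegaFun n a (p s) (h s))
      (-(gFun a (p s) * p' * kFun a (p s) + 2 * (eSumDeriv n a (p s) * p'))
        * omegaFun n a (p s) (h s) - residual n a (p s) * p' * h s) s := by
  have d1 : HasDerivAt (fun s => eSum n a (p s)) (eSumDeriv n a (p s) * p') s :=
    (hasDerivAt_eSum hp0 hp1).comp s hp
  have d2 : HasDerivAt (fun s => ratioFun n a (p s)) _ s :=
    (hasDerivAt_ratioFun hn ha hp0 hp1).comp s hp
  refine (d1.fun_neg.cexp.sub (d2.mul hh)).congr_deriv ?_
  have e := gFun_mul_ratioFun (n := n) ha hp0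
  have hω : omegaFun n a (p s) (h s)
    = Complex.exp (-eSum n a (p s)) - ratioFun n a (p s) * h s := rfl
  linear_combination (-p' * omegaFun n a (p s) (h s)) * e + (p' * eSumDeriv n a (p s)) * hω

/-- `1 + η_n^{(0)}`. -/
def hZero (n : ℕ) (a : ℝ) (z : ℂ) : ℂ :=
  a * (1 - z) * Complex.exp (a * z - eSum n a z) * gammaStar a (a * z)

/-- The inhomogeneous term `exp (-eSum)` is what remains of `e^{-w}` in the identity of
`exists_hasDerivAt_gammaStar` once the prefactor is multiplied in. -/
theorem hasDerivAt_hZero (ha : 0 < a) (hz0 : z ≠ 0) (hz : z ≠ 1) :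
    HasDerivAt (hZero n a) (gFun a z * omegaFun n a z (hZero n a z)) z := by
  have ha' : (a : ℂ) ≠ 0 := by exact_mod_cast ha.ne'
  have hz'' : 1 - z ≠ 0 := sub_ne_zero.2 hz.symm
  obtain ⟨D, hD, e⟩ := exists_hasDerivAt_gammaStar ha ((a : ℂ) * z)
  have dl : HasDerivAt (fun z : ℂ => (a : ℂ) * z) a z := by
    simpa using (hasDerivAt_id z).const_mul (a : ℂ)
  have d1 : HasDerivAt (fun z : ℂ => (a : ℂ) * (1 - z)) (a * -1) z :=
    ((hasDerivAt_id z).const_sub 1).const_mul (a : ℂ)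
  have d2 := (dl.sub (hasDerivAt_eSum (n := n) (a := a) hz0 hz)).cexp
  have d3 : HasDerivAt (fun z : ℂ => gammaStar a (a * z)) (D * a) z := hD.comp z dl
  refine ((d1.mul d2).mul d3).congr_deriv ?_
  have eg := gFun_mul_ratioFun (n := n) ha.ne' hz0
  rw [gFun_mul_kFun ha.ne' hz0 hz] at eg
  rw [omegaFun, mul_sub (gFun a z), ← mul_assoc (gFun a z), eg]
  have ex : Complex.exp (-eSum n a z)
      = Complex.exp (a * z - eSum n a z) * Complex.exp (-(a * z)) := by
    rw [← Complex.exp_add]; congr 1; ring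
  rw [ex, ← e, hZero, gFun]
  simp only [Pi.mul_apply, Pi.sub_apply]
  field_simp
  ring

/-- The general solution of the first-order equation, with `ℓ` in the role of `log z`. -/
def hInfAux (n : ℕ) (a : ℝ) (z ℓ : ℂ) : ℂ :=
  hZero n a z + a * Complex.Gamma a * (a : ℂ) ^ (-a : ℂ) * (z - 1)
    * Complex.exp (a * z - eSum n a z - a * ℓ)

/-- `1 + η_n^{(∞)}`. -/
def hInf (n : ℕ) (a : ℝ) (z : ℂ) : ℂ := hInfAux n a z (Complex.log z)

/-- The term added to `hZero` solves the homogeneous equation. Only the derivative of `ℓ` enters, so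
the logarithm may be continued along a path that reaches the cut. -/
theorem hasDerivAt_hInfAux {p ℓ : ℝ → ℂ} {p' : ℂ} {s : ℝ} (ha : 0 < a)
    (hp0 : p s ≠ 0) (hp1 : p s ≠ 1) (hp : HasDerivAt p p' s) (hℓ : HasDerivAt ℓ (p' / p s) s) :
    HasDerivAt (fun s => hInfAux n a (p s) (ℓ s))
      (gFun a (p s) * p' * omegaFun n a (p s) (hInfAux n a (p s) (ℓ s))) s := by
  have hp1' : 1 - p s ≠ 0 := sub_ne_zero.2 hp1.symm
  have d0 : HasDerivAt (fun s => hZero n a (p s)) _ s := (hasDerivAt_hZero ha hp0 hp1).comp s hp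
  have d1 : HasDerivAt (fun s => eSum n a (p s)) (eSumDeriv n a (p s) * p') s :=
    (hasDerivAt_eSum hp0 hp1).comp s hp
  have d2 := (((hp.const_mul (a : ℂ)).sub d1).sub (hℓ.const_mul (a : ℂ))).cexp
  have d3 := (hp.sub_const 1).const_mul (a * Complex.Gamma a * (a : ℂ) ^ (-a : ℂ))
  refine (d0.add (d3.mul d2)).congr_deriv ?_
  have eg := gFun_mul_ratioFun (n := n) ha.ne' hp0
  rw [gFun_mul_kFun ha.ne' hp0 hp1] at eg
  have e1 : 1 / (1 - p s) * (p s - 1) = -1 := by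
    field_simp; ring
  simp only [omegaFun, hInfAux, Pi.sub_apply]
  linear_combination (p' * (a * Complex.Gamma a * (a : ℂ) ^ (-a : ℂ) * (p s - 1)
    * Complex.exp (a * p s - eSum n a (p s) - a * ℓ s))) * eg +
    (p' * (a * Complex.Gamma a * (a : ℂ) ^ (-a : ℂ)
    * Complex.exp (a * p s - eSum n a (p s) - a * ℓ s))) * e1

end

/-! ### Recovering `γ` and `Γ`; initial values at `0` and `∞`. -/

section

open Set Filter

variable {n : ℕ} {a : ℝ} {z : ℂ}

theorem lowerGamma_eq_hZero (ha : 0 < a) (hz : z ≠ 1) :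
    lowerGamma a (a * z) =
      ((a : ℂ) * z) ^ (a : ℂ) / (a * (1 - z)) * expFactor n a z * hZero n a z := by
  have ha' : (a : ℂ) ≠ 0 := by exact_mod_cast ha.ne'
  have hz' : 1 - z ≠ 0 := sub_ne_zero.2 hz.symm
  have e : expFactor n a z * Complex.exp (a * z - eSum n a z) = 1 := by
    rw [expFactor, ← Complex.exp_add, eSum]
    rw [show ∀ x y : ℂ, -x + y + (x - y) = 0 by intros; ring, Complex.exp_zero]
  rw [lowerGamma_eq ha, hZero, div_mul_eq_mul_div, div_mul_eq_mul_div,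
    eq_div_iff (mul_ne_zero ha' hz')]
  linear_combination (-(((a : ℂ) * z) ^ (a : ℂ) * gammaStar a (a * z) * (a * (1 - z)))) * e

theorem upperGamma_eq_hInf (ha : 0 < a) (hz0 : z ≠ 0) (hz : z ≠ 1) :
    upperGamma a (a * z) =
      ((a : ℂ) * z) ^ (a : ℂ) / (a * (z - 1)) * expFactor n a z * hInf n a z := by
  have ha' : (a : ℂ) ≠ 0 := by exact_mod_cast ha.ne'
  have hz' : z - 1 ≠ 0 := sub_ne_zero.2 hz
  have hz'' : 1 - z ≠ 0 := sub_ne_zero.2 hz.symm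
  have e : expFactor n a z * Complex.exp (a * z - eSum n a z) = 1 := by
    rw [expFactor, ← Complex.exp_add, eSum]
    rw [show ∀ x y : ℂ, -x + y + (x - y) = 0 by intros; ring, Complex.exp_zero]
  have e2 : Complex.exp (a * z - eSum n a z - a * Complex.log z)
      = Complex.exp (a * z - eSum n a z) * z ^ (-a : ℂ) := by
    rw [Complex.cpow_def_of_ne_zero hz0, ← Complex.exp_add]; congr 1; ring
  have e3 : (a : ℂ) ^ (a : ℂ) * (a : ℂ) ^ (-a : ℂ) = 1 := by
    rw [Complex.cpow_neg]; exact mul_inv_cancel₀ (by simp [Complex.cpow_eq_zero_iff, ha'])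
  have e4 : z ^ (a : ℂ) * z ^ (-a : ℂ) = 1 := by
    rw [Complex.cpow_neg]; exact mul_inv_cancel₀ (by simp [Complex.cpow_eq_zero_iff, hz0])
  have e5 : ((a : ℂ) * z) ^ (a : ℂ) = (a : ℂ) ^ (a : ℂ) * z ^ (a : ℂ) := by
    rw [mul_cpow_of_pos ha hz0, Complex.ofReal_cpow ha.le]
  have e6 : ((a : ℂ) * z) ^ (a : ℂ) * ((a : ℂ) ^ (-a : ℂ) * z ^ (-a : ℂ)) = 1 := by
    rw [e5]; linear_combination (z ^ (a : ℂ) * z ^ (-a : ℂ)) * e3 + e4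
  rw [upperGamma, lowerGamma_eq_hZero (n := n) ha hz, hInf, hInfAux, e2]
  have e7 : ((a : ℂ) * z) ^ (a : ℂ) / (a * (1 - z)) = -(((a : ℂ) * z) ^ (a : ℂ) / (a * (z - 1))) := by
    rw [← neg_sub z 1, mul_neg, div_neg]
  rw [e7]
  have e8 : ((a : ℂ) * z) ^ (a : ℂ) / (a * (z - 1)) * (a * (z - 1)) = ((a : ℂ) * z) ^ (a : ℂ) :=
    div_mul_cancel₀ _ (mul_ne_zero ha' hz')
  linear_combination (-(expFactor n a z * Complex.Gamma a * (a : ℂ) ^ (-a : ℂ)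
    * Complex.exp (a * z - eSum n a z) * z ^ (-a : ℂ))) * e8
    - (Complex.Gamma a * ((a : ℂ) * z) ^ (a : ℂ) * ((a : ℂ) ^ (-a : ℂ) * z ^ (-a : ℂ))) * e
    - Complex.Gamma a * e6

theorem continuousAt_E {s : ℕ} (hs : 1 ≤ s) (hz : z ≠ 1) : ContinuousAt (E s) z := by
  refine (hasDerivAt_eval_inv (ePoly s) hz).continuousAt.congr ?_
  filter_upwards [isOpen_ne.mem_nhds hz] with t ht using (E_eq_eval s hs t ht).symm

theorem continuousAt_eSum (hz : z ≠ 1) : ContinuousAt (eSum n a) z :=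
  tendsto_finsetSum _ fun _ hs =>
    ((continuousAt_E (Finset.mem_Ico.1 hs).1 hz).div_const _).const_mul _

theorem continuousAt_fTerm (s : ℕ) (hz : z ≠ 1) : ContinuousAt (fun z => fTerm a z s) z :=
  ((hasDerivAt_F s hz).continuousAt.div_const _).const_mul _

theorem continuousAt_fSum (hz : z ≠ 1) : ContinuousAt (fSum n a) z :=
  tendsto_finsetSum _ fun s _ => continuousAt_fTerm s hz

theorem continuousAt_kFun (ha : a ≠ 0) (hz : z ≠ 1) : ContinuousAt (kFun a) z :=
  (hasDerivAt_kFun ha hz).continuousAt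

theorem continuousAt_ratioFun (ha : a ≠ 0) (hz : z ≠ 1) : ContinuousAt (ratioFun n a) z :=
  (continuousAt_kFun ha hz).sub ((continuousAt_fSum hz).div_const _)

theorem continuousAt_hZero (ha : 0 < a) (hz : z ≠ 1) : ContinuousAt (hZero n a) z := by
  obtain ⟨D, hD, -⟩ := exists_hasDerivAt_gammaStar ha ((a : ℂ) * z)
  have dl : ContinuousAt (fun z : ℂ => (a : ℂ) * z) z := by fun_prop
  have d3 : ContinuousAt (fun z : ℂ => gammaStar a (a * z)) z :=
    hD.continuousAt.comp (f := fun z : ℂ => (a : ℂ) * z) dl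
  have d2 : ContinuousAt (fun z : ℂ => Complex.exp (a * z - eSum n a z)) z :=
    (dl.sub (continuousAt_eSum hz)).cexp
  have d1 : ContinuousAt (fun z : ℂ => (a : ℂ) * (1 - z)) z := by fun_prop
  exact (d1.mul d2).mul d3

theorem F_zero (s : ℕ) : F s 0 = 0 := by
  rw [F_eq_eval s 0 (by simp)]
  have : ((0 : ℂ) - 1)⁻¹ = -1 := by norm_num
  rw [this, eval_fPoly_neg_one]

theorem E_zero {s : ℕ} (hs : 1 ≤ s) : E s 0 = 0 := by
  rw [E_eq_eval s hs 0 (by simp)]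
  have : ((0 : ℂ) - 1)⁻¹ = -1 := by norm_num
  rw [this, eval_ePoly_eq_zero _ eval_fPoly_neg_one]

theorem eSum_zero : eSum n a 0 = 0 :=
  Finset.sum_eq_zero fun s hs => by simp [E_zero (Finset.mem_Ico.1 hs).1]

theorem fSum_zero : fSum n a 0 = 0 :=
  Finset.sum_eq_zero fun s _ => by simp [fTerm, F_zero]

theorem hZero_zero (ha : 0 < a) : hZero n a 0 = 1 := by
  have ha' : (a : ℂ) ≠ 0 := by exact_mod_cast ha.ne'
  simp [hZero, eSum_zero, gammaStar_zero ha, ha']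

/-- The initial error in `linear_system_bound`. -/
def startError (n : ℕ) (a : ℝ) (z h : ℂ) : ℝ :=
  2 * ‖omegaFun n a z h‖ + ‖kFun a z‖ * ‖h - 1‖

/-- At `z = 0` all coefficients vanish and `h = ratioFun = kFun = 1`, so both terms of `startError`
are zero there; the rest is continuity. -/
theorem tendsto_startError_zero (ha : 0 < a) :
    Tendsto (fun z => startError n a z (hZero n a z)) (𝓝 0) (𝓝 0) := by
  have h1 : (0 : ℂ) ≠ 1 := zero_ne_one
  have hh := continuousAt_hZero (n := n) ha h1
  have hω : ContinuousAt (fun z => omegaFun n a z (hZero n a z)) 0 :=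
    (continuousAt_eSum h1).fun_neg.cexp.sub ((continuousAt_ratioFun ha.ne' h1).mul hh)
  have hc : ContinuousAt (fun z => startError n a z (hZero n a z)) 0 :=
    (continuousAt_const.mul hω.norm).add
      ((continuousAt_kFun ha.ne' h1).norm.mul (hh.sub continuousAt_const).norm)
  have e : startError n a 0 (hZero n a 0) = 0 := by
    simp [startError, omegaFun, hZero_zero ha, eSum_zero, ratioFun, kFun, fSum_zero]
  have := hc.tendsto
  rwa [e] at this

theorem tendsto_F_cobounded (s : ℕ) : Tendsto (F s) (Bornology.cobounded ℂ) (𝓝 0) := by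
  have h := tendsto_eval_cobounded (fPoly s)
  rw [eval_fPoly_zero] at h
  refine h.congr' ?_
  filter_upwards [eventually_cobounded_ne_one] with z hz using (F_eq_eval s z hz).symm

theorem tendsto_eSum_cobounded : Tendsto (eSum n a) (Bornology.cobounded ℂ) (𝓝 0) := by
  have : Tendsto (eSum n a) (Bornology.cobounded ℂ)
      (𝓝 (∑ s ∈ Finset.Ico 1 n, (-1) ^ s * (0 / (a : ℂ) ^ s))) :=
    tendsto_finsetSum _ fun s hs =>
      ((E_tendsto s (Finset.mem_Ico.1 hs).1).div_const _).const_mul _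
  simpa using this

theorem tendsto_fSum_cobounded : Tendsto (fSum n a) (Bornology.cobounded ℂ) (𝓝 0) := by
  have : Tendsto (fSum n a) (Bornology.cobounded ℂ)
      (𝓝 (∑ s ∈ Finset.Ico 1 n, (-1) ^ s * (0 / (a : ℂ) ^ s))) :=
    tendsto_finsetSum _ fun s _ => ((tendsto_F_cobounded s).div_const _).const_mul _
  simpa using this

theorem kFun_eq (a : ℝ) (z : ℂ) : kFun a z = 1 - F 0 z / a := by
  rw [kFun, F]
  simp only [div_eq_mul_inv, mul_inv]
  ring

theorem tendsto_kFun_cobounded : Tendsto (kFun a) (Bornology.cobounded ℂ) (𝓝 1) := by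
  have : Tendsto (fun z => 1 - F 0 z / a) (Bornology.cobounded ℂ) (𝓝 (1 - 0 / (a : ℂ))) :=
    ((tendsto_F_cobounded 0).div_const _).const_sub 1
  simpa [← kFun_eq] using this

theorem comap_re_atTop_le_cobounded : comap Complex.re atTop ≤ Bornology.cobounded ℂ := by
  have h : Tendsto (fun z : ℂ => ‖z‖) (comap Complex.re atTop) atTop :=
    tendsto_atTop_mono Complex.re_le_norm tendsto_comap
  exact tendsto_norm_atTop_iff_cobounded.1 h

/-- `hInf` is the quotient of `Γ(a, az)` by its leading term, times `(1 - 1/z) exp (-eSum)`. The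
filter imposes nothing on `Im z`, as an admissible path is only required to satisfy `Re t → +∞`. -/
theorem tendsto_hInf (ha : 0 < a) : Tendsto (hInf n a) (comap Complex.re atTop) (𝓝 1) := by
  have ha' : (a : ℂ) ≠ 0 := by exact_mod_cast ha.ne'
  obtain ⟨C, hC⟩ := exists_upperGamma_sub_le ha
  have hre : Tendsto (fun z : ℂ => a * z.re) (comap Complex.re atTop) atTop :=
    tendsto_comap.const_mul_atTop ha
  have hlarge : ∀ᶠ z : ℂ in comap Complex.re atTop, 1 ≤ a * z.re ∧ 2 ≤ z.re :=
    (hre.eventually_ge_atTop 1).and (tendsto_comap.eventually_ge_atTop 2)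
  have h1 : Tendsto (fun z : ℂ => upperGamma a (a * z) / gammaIntegrand a (a * z))
      (comap Complex.re atTop) (𝓝 1) := by
    rw [tendsto_iff_norm_sub_tendsto_zero]
    have hz : Tendsto (fun z : ℂ => C * (a * z.re)⁻¹) (comap Complex.re atTop) (𝓝 0) := by
      simpa using hre.inv_tendsto_atTop.const_mul C
    refine squeeze_zero' (Eventually.of_forall fun _ => norm_nonneg _) ?_ hz
    filter_upwards [hlarge] with z hz
    have hw : ((a : ℂ) * z).re = a * z.re := by simp
    have hw1 : 1 ≤ ((a : ℂ) * z).re := by rw [hw]; exact hz.1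
    have hwn := hw1.trans (Complex.re_le_norm _)
    have hw0 : (a : ℂ) * z ≠ 0 := norm_pos_iff.1 (by linarith)
    have hg : 0 < ‖gammaIntegrand a (a * z)‖ := by
      rw [norm_gammaIntegrand]; have := norm_pos_iff.2 hw0; positivity
    have hb := hC _ hw1
    have hC0 : 0 ≤ C := by
      by_contra hneg
      push Not at hneg
      have : C * (‖gammaIntegrand a (a * z)‖ / ‖(a : ℂ) * z‖) < 0 :=
        mul_neg_of_neg_of_pos hneg (div_pos hg (by linarith))
      linarith [norm_nonneg (upperGamma a (a * z) - gammaIntegrand a (a * z))]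
    rw [div_sub_one (norm_pos_iff.1 hg), norm_div, div_le_iff₀ hg]
    refine hb.trans ?_
    rw [mul_assoc]
    refine mul_le_mul_of_nonneg_left ?_ hC0
    rw [div_eq_inv_mul]
    refine mul_le_mul_of_nonneg_right (inv_anti₀ (by linarith [hz.1]) ?_) hg.le
    rw [← hw]; exact Complex.re_le_norm _
  have hinv : Tendsto (fun z : ℂ => 1 - z⁻¹) (comap Complex.re atTop) (𝓝 1) := by
    simpa using (tendsto_inv₀_cobounded.mono_left comap_re_atTop_le_cobounded).const_sub (1 : ℂ)
  have hE : Tendsto (fun z : ℂ => Complex.exp (-eSum n a z)) (comap Complex.re atTop) (𝓝 1) := by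
    have := ((tendsto_eSum_cobounded (n := n) (a := a)).mono_left comap_re_atTop_le_cobounded).neg.cexp
    simpa using this
  have hprod := (h1.mul hinv).mul hE
  rw [one_mul, one_mul] at hprod
  refine hprod.congr' ?_
  filter_upwards [hlarge] with z hz
  have hz0 : z ≠ 0 := by rintro rfl; simp at hz; linarith [hz.2]
  have hz1 : z ≠ 1 := by rintro rfl; simp at hz
  have hz1' : z - 1 ≠ 0 := sub_ne_zero.2 hz1
  have hw0 : (a : ℂ) * z ≠ 0 := mul_ne_zero ha' hz0
  have hp : ((a : ℂ) * z) ^ ((a - 1 : ℝ) : ℂ) ≠ 0 := by simp [Complex.cpow_eq_zero_iff, hw0]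
  rw [upperGamma_eq_hInf (n := n) ha hz0 hz1, gammaIntegrand, ← cpow_sub_one_mul hw0 a]
  have e : expFactor n a z * Complex.exp (-eSum n a z) = Complex.exp (-(a * z)) := by
    rw [expFactor, ← Complex.exp_add, eSum]; congr 1; ring
  have he := Complex.exp_ne_zero (-(a * z))
  rw [← e] at he ⊢
  have he1 := left_ne_zero_of_mul he
  have he2 := right_ne_zero_of_mul he
  field_simp

theorem tendsto_startError_inf (ha : 0 < a) :
    Tendsto (fun z => startError n a z (hInf n a z)) (comap Complex.re atTop) (𝓝 0) := by
  have hh := tendsto_hInf (n := n) ha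
  have hE := (tendsto_eSum_cobounded (n := n) (a := a)).mono_left comap_re_atTop_le_cobounded
  have hF := (tendsto_fSum_cobounded (n := n) (a := a)).mono_left comap_re_atTop_le_cobounded
  have hK := (tendsto_kFun_cobounded (a := a)).mono_left comap_re_atTop_le_cobounded
  have h := (((hE.neg.cexp.sub ((hK.sub (hF.div_const (2 * (a : ℂ)))).mul hh)).norm.const_mul 2).add
    (hK.norm.mul (hh.sub_const 1).norm))
  simpa [startError, omegaFun, ratioFun] using h

end

/-! ### Differentiation and estimates along paths. -/

section

open Set Filter MeasureTheory

/-- A continuous path on `[α, β]`, continuously differentiable off a countable set, with integrable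
derivative. -/
structure PiecewiseC1 (p : ℝ → ℂ) (α β : ℝ) : Prop where
  cont : ContinuousOn p (Icc α β)
  smooth : ∃ S : Set ℝ, S.Countable ∧
    ∀ s ∈ Ioo α β \ S, HasDerivAt p (deriv p s) s ∧ ContinuousAt (deriv p) s
  integrable : IntervalIntegrable (deriv p) volume α β

theorem PiecewiseC1.mono {p : ℝ → ℂ} {α β α' β' : ℝ} (h : PiecewiseC1 p α β) (h1 : α ≤ α')
    (h2 : β' ≤ β) (h3 : α' ≤ β') : PiecewiseC1 p α' β' := by
  refine ⟨h.cont.mono (Icc_subset_Icc h1 h2), ?_, h.integrable.mono_set ?_⟩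
  · obtain ⟨S, hS, hd⟩ := h.smooth
    exact ⟨S, hS, fun s hs => hd s ⟨⟨h1.trans_lt hs.1.1, hs.1.2.trans_le h2⟩, hs.2⟩⟩
  · rw [uIcc_of_le h3, uIcc_of_le (h1.trans (h3.trans h2))]
    exact Icc_subset_Icc h1 h2

theorem PiecewiseC1.trans {p : ℝ → ℂ} {α β γ : ℝ} (hα : α ≤ β) (hβ : β ≤ γ)
    (h : PiecewiseC1 p α β) (h' : PiecewiseC1 p β γ) : PiecewiseC1 p α γ := by
  refine ⟨?_, ?_, h.integrable.trans h'.integrable⟩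
  · rw [← Icc_union_Icc_eq_Icc hα hβ]
    exact h.cont.union_of_isClosed h'.cont isClosed_Icc isClosed_Icc
  · obtain ⟨S, hS, hd⟩ := h.smooth
    obtain ⟨S', hS', hd'⟩ := h'.smooth
    refine ⟨S ∪ S' ∪ {β}, (hS.union hS').union (countable_singleton β), fun s hs => ?_⟩
    obtain ⟨⟨h1, h2⟩, h3⟩ := hs
    simp only [mem_union, mem_singleton_iff, not_or] at h3
    rcases lt_or_gt_of_ne h3.2 with h4 | h4
    · exact hd s ⟨⟨h1, h4⟩, h3.1.1⟩
    · exact hd' s ⟨⟨h4, h2⟩, h3.1.2⟩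

theorem PiecewiseC1.refl (p : ℝ → ℂ) (α : ℝ) : PiecewiseC1 p α α := by
  refine ⟨by simp, ⟨∅, countable_empty, by simp⟩, by simp⟩

theorem PiecewiseC1.of_contDiffOn {p : ℝ → ℂ} {α β : ℝ} (hαβ : α < β)
    (h : ContDiffOn ℝ 2 p (Icc α β)) : PiecewiseC1 p α β := by
  have hc := h.continuousOn_derivWithin (uniqueDiffOn_Icc hαβ) (by norm_num)
  have heq : ∀ s ∈ Ioo α β, derivWithin p (Icc α β) s = deriv p s := fun s hs =>
    derivWithin_of_mem_nhds (Icc_mem_nhds hs.1 hs.2)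
  refine ⟨h.continuousOn, ⟨∅, countable_empty, fun s hs => ?_⟩, ?_⟩
  · have hs' := hs.1
    have hd : DifferentiableAt ℝ p s :=
      (h.differentiableOn (by norm_num) s (Ioo_subset_Icc_self hs')).differentiableAt
        (Icc_mem_nhds hs'.1 hs'.2)
    refine ⟨hd.hasDerivAt, (hc.continuousAt (Icc_mem_nhds hs'.1 hs'.2)).congr ?_⟩
    filter_upwards [Ioo_mem_nhds hs'.1 hs'.2] with t ht using heq t ht
  -- At the endpoints `deriv p` need not be the one-sided derivative, since two arcs may meet there
  -- at an angle; hence the open interval.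
  · rw [intervalIntegrable_iff_integrableOn_Ioo_of_le hαβ.le]
    exact (hc.integrableOn_Icc.mono_set Ioo_subset_Icc_self).congr_fun heq measurableSet_Ioo

theorem IsR2Chain.piecewiseC1 {p : ℝ → ℂ} (h : IsR2Chain p) : PiecewiseC1 p 0 1 := by
  obtain ⟨k, b, hb, h0, h1, harc⟩ := h
  have : ∀ j ≤ k + 1, PiecewiseC1 p 0 (b j) := by
    intro j
    induction j with
    | zero => intro _; rw [h0]; exact .refl p 0
    | succ j ih =>
      intro hj
      refine (ih (by omega)).trans (h0 ▸ hb.monotone (Nat.zero_le j)) (hb.monotone (Nat.le_succ j))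
        (.of_contDiffOn (hb (Nat.lt_succ_self j)) (harc j (by omega)).1)
  rw [← h1]; exact this _ le_rfl

theorem IsR2ChainInfinite.piecewiseC1 {p : ℝ → ℂ} (h : IsR2ChainInfinite p) {T : ℝ} (hT : 0 ≤ T) :
    PiecewiseC1 p 0 T := by
  obtain ⟨k, b, hb, h0, harc, hlast⟩ := h
  have : ∀ j ≤ k, PiecewiseC1 p 0 (b j) := by
    intro j
    induction j with
    | zero => intro _; rw [h0]; exact .refl p 0
    | succ j ih =>
      intro hj
      refine (ih (by omega)).trans (h0 ▸ hb.monotone (Nat.zero_le j)) (hb.monotone (Nat.le_succ j))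
        (.of_contDiffOn (hb (Nat.lt_succ_self j)) (harc j (by omega)).1)
  have hk : 0 ≤ b k := h0 ▸ hb.monotone (Nat.zero_le k)
  -- `T` may lie before the last arc; the path is followed at least one unit into that arc and then
  -- restricted to `[0, T]`.
  have hM : b k < max T (b k + 1) := lt_max_of_lt_right (lt_add_one _)
  have h2 : PiecewiseC1 p 0 (max T (b k + 1)) := (this k le_rfl).trans hk hM.le
    (.of_contDiffOn hM (hlast.1.mono Icc_subset_Ici_self))
  exact h2.mono le_rfl (le_max_left _ _) hT

section Calculus

variable {p : ℝ → ℂ} {α β : ℝ}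

theorem continuousOn_comp_path {X : Type*} [TopologicalSpace X] {f : ℂ → X} {S : Set ℝ}
    (hp : ContinuousOn p S) (h0 : ∀ s ∈ S, p s ≠ 0) (h1 : ∀ s ∈ S, p s ≠ 1)
    (hf : ∀ z, z ≠ 0 → z ≠ 1 → ContinuousAt f z) : ContinuousOn (fun s => f (p s)) S :=
  fun s hs => (hf _ (h0 s hs) (h1 s hs)).comp_continuousWithinAt (hp s hs)

/-- The quotient `p t / p s` equals `1` at `t = s`, so its principal logarithm is differentiable
even when `p s` lies on the cut. -/
theorem hasDerivAt_log_norm {p' : ℂ} {s : ℝ} (hp : HasDerivAt p p' s) (h0 : p s ≠ 0) :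
    HasDerivAt (fun s => Real.log ‖p s‖) (p' / p s).re s := by
  have h1 : HasDerivAt (fun t => Complex.log (p t / p s)) (p' / p s / (p s / p s)) s :=
    (hp.div_const (p s)).clog_real (by rw [div_self h0]; exact Complex.one_mem_slitPlane)
  rw [div_self h0, div_one] at h1
  have h2 := (Complex.reCLM.hasFDerivAt.comp_hasDerivAt s h1).add_const (Real.log ‖p s‖)
  refine h2.congr_of_eventuallyEq ?_
  filter_upwards [hp.continuousAt.eventually_ne h0] with t ht
  simp only [Function.comp, Complex.reCLM_apply, Complex.log_re, norm_div]
  rw [Real.log_div (norm_ne_zero_iff.2 ht) (norm_ne_zero_iff.2 h0)]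
  ring

/-- This identifies `m = -2 Ξ` in `linear_system_bound` and so turns monotonicity of `Ξ` into
damping. -/
theorem hasDerivAt_neg_two_mul_Xi {a : ℝ} {p' : ℂ} {s : ℝ} (ha : a ≠ 0) (hp : HasDerivAt p p' s)
    (h0 : p s ≠ 0) (h1 : p s ≠ 1) :
    HasDerivAt (fun s => -2 * Xi a (p s)) (gFun a (p s) * p' * kFun a (p s)).re s := by
  have h1' : 1 - p s ≠ 0 := sub_ne_zero.2 h1.symm
  have dre : HasDerivAt (fun s => (p s).re) p'.re s := Complex.reCLM.hasFDerivAt.comp_hasDerivAt s hp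
  have d1 := hasDerivAt_log_norm hp h0
  have d2 : HasDerivAt (fun s => Real.log ‖1 - p s‖) (-p' / (1 - p s)).re s :=
    hasDerivAt_log_norm (p := fun s => 1 - p s) (hp.const_sub 1) h1'
  refine ((((dre.sub_const 1).sub d1).const_mul (a / 2)).add (d2.const_mul (1 / 2))
    |>.const_mul (-2)).congr_deriv ?_
  have e : gFun a (p s) * p' * kFun a (p s)
      = (-a : ℝ) * p' + (a : ℝ) * (p' / p s) - (-p' / (1 - p s)) := by
    have := gFun_mul_kFun ha h0 h1
    push_cast
    linear_combination p' * this
  rw [e]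
  simp only [Complex.sub_re, Complex.add_re, Complex.re_ofReal_mul]
  ring

theorem continuousAt_Xi {a : ℝ} {z : ℂ} (h0 : z ≠ 0) (h1 : z ≠ 1) : ContinuousAt (Xi a) z := by
  have h1' : 1 - z ≠ 0 := sub_ne_zero.2 h1.symm
  have c1 : ContinuousAt (fun z : ℂ => Real.log ‖z‖) z :=
    continuousAt_id.norm.log (norm_ne_zero_iff.2 h0)
  have c2 : ContinuousAt (fun z : ℂ => Real.log ‖1 - z‖) z :=
    (continuousAt_const.sub continuousAt_id).norm.log (norm_ne_zero_iff.2 h1')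
  have c3 : ContinuousAt (fun z : ℂ => z.re) z := Complex.continuous_re.continuousAt
  exact (continuousAt_const.mul ((c3.sub continuousAt_const).sub c1)).add
    (continuousAt_const.mul c2)

theorem continuousAt_cFun {z : ℂ} (h0 : z ≠ 0) : ContinuousAt (fun z : ℂ => (z - 1) / (2 * z)) z :=
  (continuousAt_id.sub continuousAt_const).div (continuousAt_const.mul continuousAt_id)
    (mul_ne_zero two_ne_zero h0)

theorem continuousAt_eSumDeriv {n : ℕ} {a : ℝ} {z : ℂ} (h0 : z ≠ 0) (h1 : z ≠ 1) :
    ContinuousAt (eSumDeriv n a) z :=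
  (continuousAt_cFun h0).mul (continuousAt_fSum h1)

theorem continuousAt_residual {n : ℕ} {a : ℝ} {z : ℂ} (h0 : z ≠ 0) (h1 : z ≠ 1) :
    ContinuousAt (residual n a) z :=
  ((continuousAt_cFun h0).mul ((continuousAt_fTerm n h1).add (continuousAt_const.mul
    (tendsto_finsetSum _ fun _ _ => tendsto_finsetSum _ fun _ _ =>
      (continuousAt_fTerm _ h1).mul (continuousAt_fTerm _ h1))))).neg

theorem continuousAt_gFun {a : ℝ} {z : ℂ} (h0 : z ≠ 0) : ContinuousAt (gFun a) z :=
  (continuousAt_const.mul (continuousAt_const.sub continuousAt_id)).div continuousAt_id h0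

theorem continuousAt_cube {z : ℂ} (h1 : z ≠ 1) :
    ContinuousAt (fun z : ℂ => (z + 1) / (z - 1) ^ 3) z :=
  (continuousAt_id.add continuousAt_const).div ((continuousAt_id.sub continuousAt_const).pow 3)
    (pow_ne_zero 3 (sub_ne_zero.2 h1))

theorem PiecewiseC1.intervalIntegrable_comp_mul (hp : PiecewiseC1 p α β) (hαβ : α ≤ β)
    (h0 : ∀ s ∈ Icc α β, p s ≠ 0) (h1 : ∀ s ∈ Icc α β, p s ≠ 1) {f : ℂ → ℂ}
    (hf : ∀ z, z ≠ 0 → z ≠ 1 → ContinuousAt f z) :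
    IntervalIntegrable (fun s => f (p s) * deriv p s) volume α β :=
  hp.integrable.continuousOn_mul (by
    rw [uIcc_of_le hαβ]; exact continuousOn_comp_path hp.cont h0 h1 hf)

/-- The factor bounding `‖h - 1‖` at the end of a path, for a rate of growth integrated along it. -/
theorem path_bound {n : ℕ} {a κ : ℝ} {h : ℝ → ℂ} (hn : 1 ≤ n) (ha : 0 < a) (hκ : 0 < κ)
    (hαβ : α ≤ β) (hp : PiecewiseC1 p α β)
    (h0 : ∀ s ∈ Icc α β, p s ≠ 0) (h1 : ∀ s ∈ Icc α β, p s ≠ 1)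
    (hh : ContinuousOn h (Icc α β))
    (dh : ∀ s ∈ Ioo α β, ∀ p', HasDerivAt p p' s →
      HasDerivAt h (gFun a (p s) * p' * omegaFun n a (p s) (h s)) s)
    (hK : ∀ s ∈ Icc α β, 1 ≤ κ * ‖kFun a (p s)‖) :
    (AntitoneOn (fun s => Xi a (p s)) (Icc α β) → ‖h β - 1‖ ≤
      κ * ((startError n a (p α) (h α) + ∫ s in α..β, 2 * ‖residual n a (p s) * deriv p s‖) *
        Real.exp (∫ s in α..β, (2 * ‖eSumDeriv n a (p s) * deriv p s‖
          + 2 * κ * ‖residual n a (p s) * deriv p s‖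
          + κ * ‖-((p s + 1) / (p s - 1) ^ 3) / a * deriv p s‖)))) ∧
    (MonotoneOn (fun s => Xi a (p s)) (Icc α β) → ‖h α - 1‖ ≤
      κ * ((startError n a (p β) (h β) + ∫ s in α..β, 2 * ‖residual n a (p s) * deriv p s‖) *
        Real.exp (∫ s in α..β, (2 * ‖eSumDeriv n a (p s) * deriv p s‖
          + 2 * κ * ‖residual n a (p s) * deriv p s‖
          + κ * ‖-((p s + 1) / (p s - 1) ^ 3) / a * deriv p s‖)))) := by
  have ha0 := ha.ne'
  have cc {X : Type} [TopologicalSpace X] {f : ℂ → X}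
      (hf : ∀ z, z ≠ 0 → z ≠ 1 → ContinuousAt f z) :
      ContinuousOn (fun s => f (p s)) (Icc α β) := continuousOn_comp_path hp.cont h0 h1 hf
  obtain ⟨S, hS, hd⟩ := hp.smooth
  have ca {f : ℂ → ℂ} (hf : ∀ z, z ≠ 0 → z ≠ 1 → ContinuousAt f z) :
      ∀ s ∈ Ioo α β \ S, ContinuousAt (fun s => f (p s) * deriv p s) s := fun s hs =>
    ((cc hf).continuousAt (Icc_mem_nhds hs.1.1 hs.1.2)).mul (hd s hs).2
  have hIcc : ∀ s ∈ Ioo α β \ S, s ∈ Icc α β := fun s hs => Ioo_subset_Icc_self hs.1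
  have fK : ∀ z, z ≠ 0 → z ≠ 1 → ContinuousAt (kFun a) z := fun z _ hz => continuousAt_kFun ha0 hz
  have fR : ∀ z, z ≠ 0 → z ≠ 1 → ContinuousAt (residual n a) z := fun z => continuousAt_residual
  have fσ : ∀ z, z ≠ 0 → z ≠ 1 → ContinuousAt (eSumDeriv n a) z := fun z => continuousAt_eSumDeriv
  have fG : ∀ z, z ≠ 0 → z ≠ 1 → ContinuousAt (gFun a) z := fun z hz _ => continuousAt_gFun hz
  have fk : ∀ z, z ≠ 0 → z ≠ 1 → ContinuousAt (fun z : ℂ => -((z + 1) / (z - 1) ^ 3) / (a : ℂ)) z :=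
    fun z _ hz => (continuousAt_cube hz).fun_neg.div_const _
  have hωc : ContinuousOn (fun s => omegaFun n a (p s) (h s)) (Icc α β) :=
    (cc fun z _ hz => (continuousAt_eSum (n := n) (a := a) hz).fun_neg.cexp).sub
      ((cc fun z _ hz => continuousAt_ratioFun (n := n) ha0 hz).mul hh)
  have hmc : ContinuousOn (fun s => -2 * Xi a (p s)) (Icc α β) :=
    continuousOn_const.mul (cc fun z => continuousAt_Xi)
  have dη : ∀ s ∈ Ioo α β \ S, HasDerivAt (fun s => h s - 1)
      (gFun a (p s) * deriv p s * omegaFun n a (p s) (h s)) s :=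
    fun s hs => (dh s hs.1 _ (hd s hs).1).sub_const 1
  have dω : ∀ s ∈ Ioo α β \ S, HasDerivAt (fun s => omegaFun n a (p s) (h s))
      (-(gFun a (p s) * deriv p s * kFun a (p s) + 2 * (eSumDeriv n a (p s) * deriv p s)) *
        omegaFun n a (p s) (h s) - residual n a (p s) * deriv p s * (1 + (h s - 1))) s := by
    intro s hs
    have := hasDerivAt_omegaFun hn ha0 (h0 s (hIcc s hs)) (h1 s (hIcc s hs)) (hd s hs).1
      (dh s hs.1 _ (hd s hs).1)
    rwa [add_sub_cancel]
  have dK : ∀ s ∈ Ioo α β \ S, HasDerivAt (fun s => kFun a (p s))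
      (-((p s + 1) / (p s - 1) ^ 3) / a * deriv p s) s := fun s hs =>
    (hasDerivAt_kFun ha0 (h1 s (hIcc s hs))).comp s (hd s hs).1
  have dm : ∀ s ∈ Ioo α β \ S, HasDerivAt (fun s => -2 * Xi a (p s))
      (gFun a (p s) * deriv p s * kFun a (p s)).re s := fun s hs =>
    hasDerivAt_neg_two_mul_Xi ha0 (hd s hs).1 (h0 s (hIcc s hs)) (h1 s (hIcc s hs))
  refine ⟨fun hX => ?_, fun hX => ?_⟩
  · exact linear_system_bound hαβ hκ hS (hh.sub continuousOn_const) hωc (cc fK) hmc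
      (fun x hx y hy hxy => by have := hX hx hy hxy; simp only at this ⊢; linarith)
      (hp.intervalIntegrable_comp_mul hαβ h0 h1 fG) (hp.intervalIntegrable_comp_mul hαβ h0 h1 fσ)
      (hp.intervalIntegrable_comp_mul hαβ h0 h1 fR) (hp.intervalIntegrable_comp_mul hαβ h0 h1 fk)
      (ca fG) (ca fσ) (ca fR) (ca fk) dη dω dK dm hK
  · exact linear_system_bound_backward hαβ hκ hS (hh.sub continuousOn_const) hωc (cc fK) hmc
      (fun x hx y hy hxy => by have := hX hx hy hxy; simp only at this ⊢; linarith)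
      (hp.intervalIntegrable_comp_mul hαβ h0 h1 fG) (hp.intervalIntegrable_comp_mul hαβ h0 h1 fσ)
      (hp.intervalIntegrable_comp_mul hαβ h0 h1 fR) (hp.intervalIntegrable_comp_mul hαβ h0 h1 fk)
      (ca fG) (ca fσ) (ca fR) (ca fk) dη dω dK dm hK

end Calculus

end

/-! ### Comparison with the integrals `Φ_n` and `Ψ_n`. -/

section

open Set Filter MeasureTheory

theorem norm_fTerm {a : ℝ} (ha : 0 < a) (z : ℂ) (s : ℕ) : ‖fTerm a z s‖ = (a ^ s)⁻¹ * ‖F s z‖ := by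
  rw [fTerm, norm_mul, norm_div, norm_pow, norm_pow, norm_neg, norm_one, one_pow, one_mul,
    Complex.norm_real, Real.norm_of_nonneg ha.le, div_eq_inv_mul]

/-- The factor `2` cancels the one in `(z - 1) / (2z)`. A product `F_k F_{s+n-k-1}` carries
`a^{-(s+n-1)}`, which together with `1 / (2a)` is `(1/2) a^{-n} a^{-s}`. -/
theorem two_mul_norm_residual_le {a : ℝ} (ha : 0 < a) (n : ℕ) (z d : ℂ) :
    2 * ‖residual n a z * d‖ ≤ (a ^ n)⁻¹ * (‖(z - 1) / z * F n z * d‖ +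
      1 / 2 * ∑ s ∈ Finset.Ico 1 n, (a ^ s)⁻¹ *
        ∑ k ∈ Finset.Ico s n, ‖(z - 1) / z * F k z * F (s + n - k - 1) z * d‖) := by
  set c : ℝ := ‖(z - 1) / z * d‖ with hc
  have e1 : 2 * ‖residual n a z * d‖ = c * ‖fTerm a z n + 1 / (2 * a) *
      ∑ s ∈ Finset.Ico 1 n, ∑ k ∈ Finset.Ico s n, fTerm a z k * fTerm a z (s + n - k - 1)‖ := by
    rw [hc, ← norm_mul, ← Complex.norm_ofNat 2, ← norm_mul, ← norm_neg, residual]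
    congr 1
    simp only [div_eq_mul_inv, mul_inv]
    ring
  have e2 : ‖∑ s ∈ Finset.Ico 1 n, ∑ k ∈ Finset.Ico s n, fTerm a z k * fTerm a z (s + n - k - 1)‖
      ≤ ∑ s ∈ Finset.Ico 1 n, ∑ k ∈ Finset.Ico s n,
        (a ^ (s + n - 1))⁻¹ * (‖F k z‖ * ‖F (s + n - k - 1) z‖) := by
    refine (norm_sum_le _ _).trans (Finset.sum_le_sum fun s hs =>
      (norm_sum_le _ _).trans (Finset.sum_le_sum fun k hk => ?_))
    rw [Finset.mem_Ico] at hs hk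
    rw [norm_mul, norm_fTerm ha, norm_fTerm ha]
    have : s + n - 1 = k + (s + n - k - 1) := by omega
    rw [this, pow_add, mul_inv]
    have : k + (s + n - k - 1) - k - 1 + 1 = s + n - k - 1 := by omega
    refine le_of_eq ?_
    ring_nf
  have e3 : ‖(1 : ℂ) / (2 * a)‖ = (2 * a)⁻¹ := by
    rw [norm_div, norm_one, norm_mul, Complex.norm_ofNat, Complex.norm_real,
      Real.norm_of_nonneg ha.le, one_div]
  rw [e1]
  calc c * _ ≤ c * ((a ^ n)⁻¹ * ‖F n z‖ + (2 * a)⁻¹ * ∑ s ∈ Finset.Ico 1 n, ∑ k ∈ Finset.Ico s n,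
        (a ^ (s + n - 1))⁻¹ * (‖F k z‖ * ‖F (s + n - k - 1) z‖)) := by
        refine mul_le_mul_of_nonneg_left ((norm_add_le _ _).trans ?_) (norm_nonneg _)
        rw [norm_fTerm ha, norm_mul, e3]
        gcongr
    _ = _ := by
        rw [mul_add, mul_add]
        congr 1
        · rw [hc]; simp only [norm_mul]; ring
        · simp only [Finset.mul_sum]
          refine Finset.sum_congr rfl fun s hs => Finset.sum_congr rfl fun k _ => ?_
          rw [Finset.mem_Ico] at hs
          have h1 : (a ^ (s + n - 1))⁻¹ * (2 * a)⁻¹ = (a ^ n)⁻¹ * (1 / 2 * (a ^ s)⁻¹) := by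
            have : a ^ (s + n) = a ^ (s + n - 1) * a := by rw [← pow_succ]; congr 1; omega
            have h2 : a ^ s * a ^ n = a ^ (s + n - 1) * a := by rw [← pow_add, this]
            have h3 : (a ^ s)⁻¹ * (a ^ n)⁻¹ = (a ^ (s + n - 1))⁻¹ * a⁻¹ := by
              rw [← mul_inv, h2, mul_inv]
            rw [mul_inv]; linear_combination (-1 / 2) * h3
          rw [hc]; simp only [norm_mul]
          linear_combination (‖(z - 1) / z‖ * ‖d‖ * ‖F k z‖ * ‖F (s + n - k - 1) z‖) * h1

theorem two_mul_norm_eSumDeriv_le {a : ℝ} (ha : 0 < a) (n : ℕ) (z d : ℂ) :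
    2 * ‖eSumDeriv n a z * d‖ ≤
      ∑ s ∈ Finset.range (n - 1), (a ^ (s + 1))⁻¹ * ‖(z - 1) / z * F (s + 1) z * d‖ := by
  set c : ℝ := ‖(z - 1) / z * d‖ with hc
  have e1 : 2 * ‖eSumDeriv n a z * d‖ = c * ‖fSum n a z‖ := by
    rw [hc, ← norm_mul, ← Complex.norm_ofNat 2, ← norm_mul, eSumDeriv]
    congr 1
    simp only [div_eq_mul_inv, mul_inv]
    ring
  rw [e1]
  have e2 : ‖fSum n a z‖ ≤ ∑ s ∈ Finset.range (n - 1), (a ^ (s + 1))⁻¹ * ‖F (s + 1) z‖ := by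
    rw [fSum, Finset.sum_Ico_eq_sum_range]
    refine (norm_sum_le _ _).trans (Finset.sum_le_sum fun s _ => ?_)
    rw [norm_fTerm ha, add_comm]
  refine (mul_le_mul_of_nonneg_left e2 (norm_nonneg _)).trans (le_of_eq ?_)
  rw [Finset.mul_sum]
  refine Finset.sum_congr rfl fun s _ => ?_
  simp only [norm_mul]; ring

section Integrals

variable {p : ℝ → ℂ} {α β : ℝ}

theorem ofReal_integral_le_pathInt (hαβ : α ≤ β) {S : Set ℝ} (hS : Ioc α β ⊆ S) {f : ℂ → ℂ}
    (hi : IntervalIntegrable (fun s => f (p s) * deriv p s) volume α β) :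
    ENNReal.ofReal (∫ s in α..β, ‖f (p s) * deriv p s‖) ≤ pathInt f p S := by
  rw [intervalIntegral.integral_of_le hαβ, ofReal_integral_norm_eq_lintegral_enorm hi.1, pathInt]
  exact lintegral_mono_set hS

variable {a : ℝ}

theorem continuousAt_Phi_integrand (n : ℕ) {z : ℂ} (h0 : z ≠ 0) (h1 : z ≠ 1) :
    ContinuousAt (fun t : ℂ => (t - 1) / t * F n t) z :=
  ((continuousAt_id.sub continuousAt_const).div continuousAt_id h0).mul
    (hasDerivAt_F n h1).continuousAt

theorem continuousAt_Phi_integrand₂ (k l : ℕ) {z : ℂ} (h0 : z ≠ 0) (h1 : z ≠ 1) :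
    ContinuousAt (fun t : ℂ => (t - 1) / t * F k t * F l t) z :=
  (continuousAt_Phi_integrand k h0 h1).mul (hasDerivAt_F l h1).continuousAt

theorem ofReal_integral_residual_le (n : ℕ) (ha : 0 < a) (hαβ : α ≤ β) (hp : PiecewiseC1 p α β)
    (h0 : ∀ s ∈ Icc α β, p s ≠ 0) (h1 : ∀ s ∈ Icc α β, p s ≠ 1) {S : Set ℝ} (hS : Ioc α β ⊆ S) :
    ENNReal.ofReal (∫ s in α..β, 2 * ‖residual n a (p s) * deriv p s‖)
      ≤ (ENNReal.ofReal a ^ n)⁻¹ * Phi n a p S := by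
  have hi1 := hp.intervalIntegrable_comp_mul hαβ h0 h1 (f := fun t => (t - 1) / t * F n t)
    fun z => continuousAt_Phi_integrand n
  have hi2 (k l : ℕ) := hp.intervalIntegrable_comp_mul hαβ h0 h1
    (f := fun t => (t - 1) / t * F k t * F l t) fun z => continuousAt_Phi_integrand₂ k l
  beta_reduce at hi1 hi2
  have hiR := hp.intervalIntegrable_comp_mul hαβ h0 h1 (f := residual n a) fun z =>
    continuousAt_residual (n := n) (a := a)
  have hi3 : ∀ s ∈ Finset.Ico 1 n, IntervalIntegrable (fun x => (a ^ s)⁻¹ *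
      ∑ k ∈ Finset.Ico s n, ‖(p x - 1) / p x * F k (p x) * F (s + n - k - 1) (p x) * deriv p x‖)
      volume α β := fun s _ => by
    refine IntervalIntegrable.const_mul ?_ _
    have := IntervalIntegrable.sum (μ := volume) (a := α) (b := β) (Finset.Ico s n)
      (f := fun k x => ‖(p x - 1) / p x * F k (p x) * F (s + n - k - 1) (p x) * deriv p x‖)
      fun k _ => (hi2 k (s + n - k - 1)).norm
    simpa [Finset.sum_fn] using this
  have hi4 : IntervalIntegrable (fun x => ∑ s ∈ Finset.Ico 1 n, (a ^ s)⁻¹ *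
      ∑ k ∈ Finset.Ico s n, ‖(p x - 1) / p x * F k (p x) * F (s + n - k - 1) (p x) * deriv p x‖)
      volume α β := by
    have := IntervalIntegrable.sum (μ := volume) (a := α) (b := β) (Finset.Ico 1 n) hi3
    simpa [Finset.sum_fn] using this
  have key := intervalIntegral.integral_mono_on hαβ (hiR.norm.const_mul 2)
    ((hi1.norm.add (hi4.const_mul (1 / 2))).const_mul (a ^ n)⁻¹)
    fun x _ => two_mul_norm_residual_le ha n (p x) (deriv p x)
  have hR : ∫ x in α..β, (a ^ n)⁻¹ * (‖(p x - 1) / p x * F n (p x) * deriv p x‖ +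
      1 / 2 * ∑ s ∈ Finset.Ico 1 n, (a ^ s)⁻¹ *
        ∑ k ∈ Finset.Ico s n, ‖(p x - 1) / p x * F k (p x) * F (s + n - k - 1) (p x) * deriv p x‖)
      = (a ^ n)⁻¹ * ((∫ x in α..β, ‖(p x - 1) / p x * F n (p x) * deriv p x‖) +
        1 / 2 * ∑ s ∈ Finset.Ico 1 n, (a ^ s)⁻¹ * ∑ k ∈ Finset.Ico s n,
          ∫ x in α..β, ‖(p x - 1) / p x * F k (p x) * F (s + n - k - 1) (p x) * deriv p x‖) := by
    rw [intervalIntegral.integral_const_mul, intervalIntegral.integral_add hi1.norm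
      (hi4.const_mul _), intervalIntegral.integral_const_mul,
      intervalIntegral.integral_finsetSum hi3]
    congr 3
    refine Finset.sum_congr rfl fun s _ => ?_
    rw [intervalIntegral.integral_const_mul, intervalIntegral.integral_finsetSum]
    exact fun k _ => (hi2 k (s + n - k - 1)).norm
  have nn {f : ℝ → ℂ} : 0 ≤ ∫ x in α..β, ‖f x‖ :=
    intervalIntegral.integral_nonneg hαβ fun x _ => norm_nonneg _
  rw [hR] at key
  refine (ENNReal.ofReal_le_ofReal key).trans ?_
  rw [ENNReal.ofReal_mul (by positivity), ENNReal.ofReal_inv_of_pos (by positivity),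
    ENNReal.ofReal_pow ha.le, Phi]
  refine mul_le_mul_right ?_ _
  rw [ENNReal.ofReal_add nn (mul_nonneg (by norm_num) (Finset.sum_nonneg fun s _ =>
    mul_nonneg (by positivity) (Finset.sum_nonneg fun k _ => nn)))]
  refine add_le_add (ofReal_integral_le_pathInt hαβ hS (f := fun t => (t - 1) / t * F n t) hi1) ?_
  rw [ENNReal.ofReal_mul (by norm_num), one_div, ENNReal.ofReal_inv_of_pos two_pos,
    ENNReal.ofReal_ofNat]
  refine mul_le_mul_right ?_ _
  rw [ENNReal.ofReal_sum_of_nonneg fun s _ =>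
    mul_nonneg (by positivity) (Finset.sum_nonneg fun k _ => nn)]
  refine Finset.sum_le_sum fun s _ => ?_
  rw [ENNReal.ofReal_mul (by positivity), ENNReal.ofReal_inv_of_pos (by positivity),
    ENNReal.ofReal_pow ha.le, ENNReal.ofReal_sum_of_nonneg fun k _ => nn]
  refine mul_le_mul_right ?_ _
  exact Finset.sum_le_sum fun k _ => ofReal_integral_le_pathInt hαβ hS
    (f := fun t => (t - 1) / t * F k t * F (s + n - k - 1) t) (hi2 k (s + n - k - 1))

theorem ofReal_integral_eSumDeriv_le (n : ℕ) (ha : 0 < a) (hαβ : α ≤ β) (hp : PiecewiseC1 p α β)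
    (h0 : ∀ s ∈ Icc α β, p s ≠ 0) (h1 : ∀ s ∈ Icc α β, p s ≠ 1) {S : Set ℝ} (hS : Ioc α β ⊆ S) :
    ENNReal.ofReal (∫ s in α..β, 2 * ‖eSumDeriv n a (p s) * deriv p s‖)
      ≤ (ENNReal.ofReal a)⁻¹ * Psi n a p S := by
  have hi1 (k : ℕ) := hp.intervalIntegrable_comp_mul hαβ h0 h1 
    (f := fun t => (t - 1) / t * F k t) fun z => continuousAt_Phi_integrand k
  have hiσ := hp.intervalIntegrable_comp_mul hαβ h0 h1 (f := eSumDeriv n a) fun z =>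
    continuousAt_eSumDeriv (n := n) (a := a)
  have hi2 : ∀ s ∈ Finset.range (n - 1), IntervalIntegrable (fun x => (a ^ (s + 1))⁻¹ *
      ‖(p x - 1) / p x * F (s + 1) (p x) * deriv p x‖) volume α β := fun s _ =>
    (hi1 (s + 1)).norm.const_mul _
  have hi3 := IntervalIntegrable.sum (μ := volume) (a := α) (b := β) (Finset.range (n - 1)) hi2
  rw [Finset.sum_fn] at hi3
  have key := intervalIntegral.integral_mono_on hαβ (hiσ.norm.const_mul 2) hi3
    fun x _ => two_mul_norm_eSumDeriv_le ha n (p x) (deriv p x)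
  have nn {f : ℝ → ℂ} : 0 ≤ ∫ x in α..β, ‖f x‖ :=
    intervalIntegral.integral_nonneg hαβ fun x _ => norm_nonneg _
  rw [intervalIntegral.integral_finsetSum hi2] at key
  refine (ENNReal.ofReal_le_ofReal key).trans ?_
  rw [ENNReal.ofReal_sum_of_nonneg fun s _ => by
    rw [intervalIntegral.integral_const_mul]; exact mul_nonneg (by positivity) nn, Psi]
  have h2 : ∑ s ∈ Finset.range (n - 1), ENNReal.ofReal (∫ x in α..β, (a ^ (s + 1))⁻¹ *
      ‖(p x - 1) / p x * F (s + 1) (p x) * deriv p x‖) ≤ (ENNReal.ofReal a)⁻¹ *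
      ∑ s ∈ Finset.range (n - 1), (ENNReal.ofReal a ^ s)⁻¹ *
        pathInt (fun t => (t - 1) / t * F (s + 1) t) p S := by
    rw [Finset.mul_sum]
    refine Finset.sum_le_sum fun s _ => ?_
    rw [intervalIntegral.integral_const_mul, pow_succ', mul_inv, ENNReal.ofReal_mul (by positivity),
      ENNReal.ofReal_mul (by positivity), ENNReal.ofReal_inv_of_pos ha,
      ENNReal.ofReal_inv_of_pos (by positivity), ENNReal.ofReal_pow ha.le, mul_assoc]
    exact mul_le_mul_right (mul_le_mul_right (ofReal_integral_le_pathInt hαβ hS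
      (f := fun t => (t - 1) / t * F (s + 1) t) (hi1 (s + 1))) _) _
  refine h2.trans (mul_le_mul_right ?_ _)
  exact le_mul_of_one_le_left zero_le (by norm_num)

theorem ofReal_integral_rate_le (n : ℕ) {κ : ℝ} (hκ : 0 < κ) (ha : 0 < a) (hαβ : α ≤ β)
    (hp : PiecewiseC1 p α β) (h0 : ∀ s ∈ Icc α β, p s ≠ 0) (h1 : ∀ s ∈ Icc α β, p s ≠ 1)
    {S : Set ℝ} (hS : Ioc α β ⊆ S) :
    ENNReal.ofReal (∫ s in α..β, (2 * ‖eSumDeriv n a (p s) * deriv p s‖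
          + 2 * κ * ‖residual n a (p s) * deriv p s‖
          + κ * ‖-((p s + 1) / (p s - 1) ^ 3) / a * deriv p s‖))
      ≤ (ENNReal.ofReal a)⁻¹ * Psi n a p S
        + ENNReal.ofReal κ * ((ENNReal.ofReal a ^ n)⁻¹ * Phi n a p S)
        + ENNReal.ofReal κ * ((ENNReal.ofReal a)⁻¹ *
          pathInt (fun t => (t + 1) / (t - 1) ^ 3) p S) := by
  have hiσ := hp.intervalIntegrable_comp_mul hαβ h0 h1 (f := eSumDeriv n a) fun z =>
    continuousAt_eSumDeriv (n := n) (a := a)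
  have hiR := hp.intervalIntegrable_comp_mul hαβ h0 h1 (f := residual n a) fun z =>
    continuousAt_residual (n := n) (a := a)
  have hik := hp.intervalIntegrable_comp_mul hαβ h0 h1
    (f := fun z => (z + 1) / (z - 1) ^ 3) fun z _ hz => continuousAt_cube hz
  have e : ∀ s, 2 * ‖eSumDeriv n a (p s) * deriv p s‖
          + 2 * κ * ‖residual n a (p s) * deriv p s‖
          + κ * ‖-((p s + 1) / (p s - 1) ^ 3) / a * deriv p s‖ =
        2 * ‖eSumDeriv n a (p s) * deriv p s‖
          + κ * (2 * ‖residual n a (p s) * deriv p s‖)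
          + κ * (a⁻¹ * ‖(p s + 1) / (p s - 1) ^ 3 * deriv p s‖) := fun s => by
    have : ‖-((p s + 1) / (p s - 1) ^ 3) / a * deriv p s‖
        = a⁻¹ * ‖(p s + 1) / (p s - 1) ^ 3 * deriv p s‖ := by
      rw [norm_mul, norm_div, norm_neg, Complex.norm_real, Real.norm_of_nonneg ha.le, norm_mul]
      ring
    rw [this]; ring
  simp only [e]
  have nn {f : ℝ → ℂ} : 0 ≤ ∫ x in α..β, ‖f x‖ :=
    intervalIntegral.integral_nonneg hαβ fun x _ => norm_nonneg _
  have nn2 {f : ℝ → ℂ} : 0 ≤ ∫ x in α..β, 2 * ‖f x‖ :=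
    intervalIntegral.integral_nonneg hαβ fun x _ => by positivity
  rw [intervalIntegral.integral_add ((hiσ.norm.const_mul 2).add
      ((hiR.norm.const_mul 2).const_mul κ)) ((hik.norm.const_mul _).const_mul κ),
    intervalIntegral.integral_add (hiσ.norm.const_mul 2) ((hiR.norm.const_mul 2).const_mul κ),
    intervalIntegral.integral_const_mul κ, intervalIntegral.integral_const_mul κ,
    intervalIntegral.integral_const_mul a⁻¹,
    ENNReal.ofReal_add (add_nonneg nn2 (mul_nonneg hκ.le nn2))
      (mul_nonneg hκ.le (mul_nonneg (by positivity) nn)),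
    ENNReal.ofReal_add nn2 (mul_nonneg hκ.le nn2), ENNReal.ofReal_mul hκ.le,
    ENNReal.ofReal_mul hκ.le, ENNReal.ofReal_mul (by positivity), ENNReal.ofReal_inv_of_pos ha]
  exact add_le_add (add_le_add (ofReal_integral_eSumDeriv_le n ha hαβ hp h0 h1 hS)
    (mul_le_mul_right (ofReal_integral_residual_le n ha hαβ hp h0 h1 hS) _))
    (mul_le_mul_right (mul_le_mul_right (ofReal_integral_le_pathInt hαβ hS
      (f := fun t => (t + 1) / (t - 1) ^ 3) hik) _) _)

end Integrals

end

/-! ### Passage to the bound with values in `[0, ∞]`. -/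

section

open Set Filter MeasureTheory

variable {n : ℕ} {a : ℝ} {p : ℝ → ℂ} {S : Set ℝ}

theorem kappa0_ne_zero (hS : S.Nonempty) : kappa0 a p S ≠ 0 := by
  obtain ⟨s, hs⟩ := hS
  intro h
  have : ‖1 + p s / (a * (p s - 1) ^ 2)‖ₑ⁻¹ ≤ 0 := h ▸ le_iSup₂_of_le s hs le_rfl
  simp at this

/-- In `[0, ∞]` the inverse of `0` is `∞`, so finiteness of `kappa0` excludes zeros of `kFun` on the
path. -/
theorem one_le_kappa0_mul (hκ : kappa0 a p S ≠ ⊤) {s : ℝ} (hs : s ∈ S) :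
    1 ≤ (kappa0 a p S).toReal * ‖kFun a (p s)‖ := by
  have h : ‖kFun a (p s)‖ₑ⁻¹ ≤ kappa0 a p S :=
    le_iSup₂_of_le (f := fun s (_ : s ∈ S) => ‖1 + p s / (a * (p s - 1) ^ 2)‖ₑ⁻¹) s hs le_rfl
  have h0 : kFun a (p s) ≠ 0 := by
    intro h0
    rw [h0, enorm_zero, ENNReal.inv_zero, top_le_iff] at h
    exact hκ h
  have h1 := ENNReal.toReal_mono hκ h
  rw [ENNReal.toReal_inv, toReal_enorm] at h1
  rw [← div_le_iff₀ (norm_pos_iff.2 h0), one_div]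
  exact h1

/-- From bounds on initial segments of a path to `errorBound`. -/
theorem enorm_le_errorBound (ha : 0 < a) (hS : S.Nonempty) (hΦ : Phi n a p S ≠ 0) {η : ℂ}
    {l : Filter ℝ} [l.NeBot] {ε : ℝ → ℝ} (hε : Tendsto ε l (𝓝 0)) (hε0 : ∀ t, 0 ≤ ε t)
    (H : kappa0 a p S ≠ ⊤ → ∀ᶠ t in l, ∃ x y : ℝ,
      ‖η‖ ≤ (kappa0 a p S).toReal * ((ε t + x) * Real.exp y) ∧
      ENNReal.ofReal x ≤ (ENNReal.ofReal a ^ n)⁻¹ * Phi n a p S ∧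
      ENNReal.ofReal y ≤ (ENNReal.ofReal a)⁻¹ * Psi n a p S
        + kappa0 a p S * ((ENNReal.ofReal a ^ n)⁻¹ * Phi n a p S)
        + kappa0 a p S * ((ENNReal.ofReal a)⁻¹ * pathInt (fun t => (t + 1) / (t - 1) ^ 3) p S)) :
    ‖η‖ₑ ≤ errorBound n a p S := by
  have hA0 : ENNReal.ofReal a ≠ 0 := (ENNReal.ofReal_pos.2 ha).ne'
  have hA : ENNReal.ofReal a ≠ ⊤ := ENNReal.ofReal_ne_top
  have hAn : (ENNReal.ofReal a ^ n)⁻¹ ≠ 0 := ENNReal.inv_ne_zero.2 (ENNReal.pow_ne_top hA)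
  have hκ0 := kappa0_ne_zero (a := a) (p := p) hS
  set κ₀ := kappa0 a p S with hκ
  set A := ENNReal.ofReal a with hA'
  set Φ := Phi n a p S with hΦ'
  set Ψ := Psi n a p S with hΨ'
  set I := pathInt (fun t => (t + 1) / (t - 1) ^ 3) p S with hI
  have hB : errorBound n a p S = κ₀ / A ^ n * Φ * EReal.exp
      ((1 / A * (2 + 2 * κ₀ + κ₀ * kappa2 p S / A) * Ψ + κ₀ / A * I + κ₀ / A ^ n * Φ : ℝ≥0∞) :
        EReal) := rfl
  clear_value κ₀ A Φ Ψ I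
  simp only [div_eq_mul_inv, one_mul] at hB
  rw [hB]
  set X := A⁻¹ * (2 + 2 * κ₀ + κ₀ * kappa2 p S * A⁻¹) * Ψ + κ₀ * A⁻¹ * I
    + κ₀ * (A ^ n)⁻¹ * Φ with hX
  -- With a zero prefactor an infinite exponent would give the bound `0 * ∞ = 0`; here it gives `∞`
  -- and nothing has to be proved.
  have hpre : κ₀ * (A ^ n)⁻¹ * Φ ≠ 0 := mul_ne_zero (mul_ne_zero hκ0 hAn) hΦ
  by_cases hXt : X = ⊤
  · rw [hXt]
    have : EReal.exp ((⊤ : ℝ≥0∞) : EReal) = ⊤ := by simp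
    rw [this, ENNReal.mul_top hpre]
    exact le_top
  -- The Gronwall exponent contains `Ψ / a` with coefficient `1` only, which the bracket `2 + 2κ₀ +
  -- κ₀κ₂ / a` exceeds.
  have hle : A⁻¹ * Ψ + κ₀ * ((A ^ n)⁻¹ * Φ) + κ₀ * (A⁻¹ * I) ≤ X := by
    rw [hX, ← mul_assoc κ₀, ← mul_assoc κ₀, add_right_comm]
    refine add_le_add (add_le_add (mul_le_mul_left (le_mul_of_one_le_right zero_le ?_) _) le_rfl)
      le_rfl
    calc (1 : ℝ≥0∞) ≤ 2 := by norm_num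
      _ ≤ 2 + 2 * κ₀ := le_self_add
      _ ≤ _ := le_self_add
  have hlast : κ₀ * (A ^ n)⁻¹ * Φ ≠ ⊤ := fun h => hXt (by rw [hX, h]; simp)
  -- The last summand of the exponent is finite, and since no factor of it is zero each factor must
  -- be finite.
  have hκt : κ₀ ≠ ⊤ := fun h => hlast (by
    rw [h, ENNReal.top_mul hAn, ENNReal.top_mul hΦ])
  have hφt : (A ^ n)⁻¹ * Φ ≠ ⊤ := fun h => hlast (by
    rw [mul_assoc, h, ENNReal.mul_top hκ0])
  have hb : ∀ᶠ t in l, ‖η‖ ≤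
      κ₀.toReal * ((ε t + ((A ^ n)⁻¹ * Φ).toReal) * Real.exp X.toReal) := by
    filter_upwards [H hκt] with t ht
    obtain ⟨x, y, h1, h2, h3⟩ := ht
    have hx : x ≤ ((A ^ n)⁻¹ * Φ).toReal := (ENNReal.ofReal_le_iff_le_toReal hφt).1 h2
    have hy : y ≤ X.toReal := (ENNReal.ofReal_le_iff_le_toReal hXt).1 (h3.trans hle)
    refine h1.trans (mul_le_mul_of_nonneg_left ?_ ENNReal.toReal_nonneg)
    have := hε0 t
    exact mul_le_mul (by linarith) (Real.exp_le_exp.2 hy) (Real.exp_pos _).le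
      (add_nonneg this ENNReal.toReal_nonneg)
  have hlim : Tendsto (fun t => κ₀.toReal * ((ε t + ((A ^ n)⁻¹ * Φ).toReal) * Real.exp X.toReal)) l
      (𝓝 (κ₀.toReal * ((0 + ((A ^ n)⁻¹ * Φ).toReal) * Real.exp X.toReal))) :=
    ((hε.add_const _).mul_const _).const_mul _
  have hfin := ge_of_tendsto hlim hb
  rw [zero_add] at hfin
  rw [← ofReal_norm]
  refine (ENNReal.ofReal_le_ofReal hfin).trans (le_of_eq ?_)
  rw [ENNReal.ofReal_mul ENNReal.toReal_nonneg, ENNReal.ofReal_mul ENNReal.toReal_nonneg,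
    ENNReal.ofReal_toReal hκt, ENNReal.ofReal_toReal hφt, ← EReal.exp_coe]
  have : ((X.toReal : ℝ) : EReal) = (X : EReal) := EReal.coe_ennreal_toReal hXt
  rw [this]
  ring

/-- A path along a smooth arc meets the zeros of `F_n^-` in a null set. -/
theorem Phi_ne_zero (hn : 1 ≤ n) {c : ℝ} (hc : 0 < c) (hp : ContDiffOn ℝ 2 p (Icc 0 c))
    (hd : ∀ s ∈ Ioo 0 c, deriv p s ≠ 0) (hS : Ioo 0 c ⊆ S)
    (h0 : ∀ s ∈ Ioo 0 c, p s ≠ 0) (h1 : ∀ s ∈ Ioo 0 c, p s ≠ 1) : Phi n a p S ≠ 0 := by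
  intro hΦ
  have hPC := PiecewiseC1.of_contDiffOn hc hp
  rw [Phi, add_eq_zero] at hΦ
  have hint := hΦ.1
  rw [pathInt] at hint
  have hint' : ∫⁻ s in Ioo 0 c, ‖(p s - 1) / p s * F n (p s) * deriv p s‖ₑ = 0 :=
    le_antisymm ((lintegral_mono_set hS).trans hint.le) zero_le
  have hcont : ContinuousOn (fun s => (p s - 1) / p s * F n (p s)) (Ioo 0 c) :=
    continuousOn_comp_path (f := fun t => (t - 1) / t * F n t)
      (hPC.cont.mono Ioo_subset_Icc_self) h0 h1 fun z => continuousAt_Phi_integrand n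
  have hmeas : AEMeasurable (fun s => ‖(p s - 1) / p s * F n (p s) * deriv p s‖ₑ)
      (volume.restrict (Ioo 0 c)) :=
    ((hcont.aestronglyMeasurable measurableSet_Ioo).mul
      (measurable_deriv p).aestronglyMeasurable).enorm
  rw [lintegral_eq_zero_iff' hmeas] at hint'
  have hae : (fun s => (p s - 1) / p s * F n (p s)) =ᵐ[volume.restrict (Ioo 0 c)] fun _ => 0 := by
    filter_upwards [hint', ae_restrict_mem measurableSet_Ioo] with s hs hs'
    simp only [Pi.zero_apply, enorm_eq_zero, mul_eq_zero] at hs ⊢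
    exact hs.resolve_right (hd s hs')
  have heq : EqOn (fun s => (p s - 1) / p s * F n (p s)) (fun _ => 0) (Ioo 0 c) :=
    Measure.eqOn_open_of_ae_eq hae isOpen_Ioo hcont continuousOn_const
  have hroot : ∀ s ∈ Ioo 0 c, (p s - 1)⁻¹ ∈ (fPoly n).rootSet ℂ := by
    intro s hs
    rw [Polynomial.mem_rootSet]
    refine ⟨fPoly_ne_zero n hn, ?_⟩
    have := heq hs
    simp only [mul_eq_zero, div_eq_zero_iff, sub_eq_zero, h0 s hs, h1 s hs, false_or] at this
    rw [F_eq_eval n _ (h1 s hs)] at this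
    simpa [Polynomial.aeval_def] using this
  have hm : c / 2 ∈ Ioo 0 c := ⟨by linarith, by linarith⟩
  have hconst : ∀ s ∈ Ioo 0 c, p s = p (c / 2) := by
    intro s hs
    have hci : ContinuousOn (fun s => (p s - 1)⁻¹) (Ioo 0 c) :=
      ((hPC.cont.mono Ioo_subset_Icc_self).sub continuousOn_const).inv₀
        fun s hs => sub_ne_zero.2 (h1 s hs)
    -- A continuous map from an interval into the finite root set is constant, which contradicts the
    -- nonvanishing derivative of the arc.
    have := isPreconnected_Ioo.constant_of_mapsTo 
      (Polynomial.rootSet_finite (fPoly n) ℂ).isDiscrete hci hroot hs hm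
    simpa using this
  refine hd _ hm ?_
  have : p =ᶠ[𝓝 (c / 2)] fun _ => p (c / 2) := by
    filter_upwards [Ioo_mem_nhds hm.1 hm.2] with s hs using hconst s hs
  rw [this.deriv_eq, deriv_const]

end

/-! ### The error bounds along admissible paths. -/

section

open Set Filter MeasureTheory

variable {n : ℕ} {a : ℝ} {z : ℂ} {p : ℝ → ℂ}

theorem startError_nonneg (n : ℕ) (a : ℝ) (z h : ℂ) : 0 ≤ startError n a z h := by
  rw [startError]; positivity

theorem IsR2Arc.deriv_ne_zero {S : Set ℝ} (h : IsR2Arc p S) {s : ℝ} (hs : S ∈ 𝓝 s) :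
    deriv p s ≠ 0 := by
  rw [← derivWithin_of_mem_nhds hs]
  exact h.2 s (mem_of_mem_nhds hs)

theorem IsR2Arc.mono_Icc {S : Set ℝ} {α β : ℝ} (h : IsR2Arc p S) (hS : Icc α β ⊆ S) :
    ContDiffOn ℝ 2 p (Icc α β) ∧ ∀ s ∈ Ioo α β, deriv p s ≠ 0 :=
  ⟨h.1.mono hS, fun _ hs => h.deriv_ne_zero (mem_of_superset (Icc_mem_nhds hs.1 hs.2) hS)⟩

theorem IsR2Chain.exists_first_arc (h : IsR2Chain p) : ∃ c : ℝ, 0 < c ∧ c ≤ 1 ∧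
    ContDiffOn ℝ 2 p (Icc 0 c) ∧ ∀ s ∈ Ioo 0 c, deriv p s ≠ 0 := by
  obtain ⟨k, b, hb, h0, h1, harc⟩ := h
  have := harc 0 (Nat.zero_le k)
  rw [h0] at this
  exact ⟨b (0 + 1), h0 ▸ hb (Nat.zero_lt_one), h1 ▸ hb.monotone (by omega),
    this.mono_Icc Subset.rfl⟩

theorem IsR2ChainInfinite.exists_first_arc (h : IsR2ChainInfinite p) : ∃ c : ℝ, 0 < c ∧
    ContDiffOn ℝ 2 p (Icc 0 c) ∧ ∀ s ∈ Ioo 0 c, deriv p s ≠ 0 := by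
  obtain ⟨k, b, hb, h0, harc, hlast⟩ := h
  rcases Nat.eq_zero_or_pos k with rfl | hk
  · rw [h0] at hlast
    exact ⟨1, one_pos, hlast.mono_Icc Icc_subset_Ici_self⟩
  · have := harc 0 hk
    rw [h0] at this
    exact ⟨b (0 + 1), h0 ▸ hb (Nat.zero_lt_one), this.mono_Icc Subset.rfl⟩

theorem ne_one_of_away {δ : ℝ} (hδ : 0 < δ) {w : ℂ} (h : δ ≤ ‖w - 1‖) : w ≠ 1 := by
  rintro rfl
  simp at h
  linarith

/-- Both `G` and `Ξ` are singular at `0`, so the estimate is run on `[t, 1]` and `t → 0+`. The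
initial error disappears in the limit, and integrals over the subpath are at most those over the
whole path. -/
theorem enorm_hZero_sub_one_le (hn : 1 ≤ n) (ha : 0 < a) (hp : PathFromZero a z p) :
    ‖hZero n a z - 1‖ₑ ≤ errorBound n a p (Icc 0 1) := by
  obtain ⟨δ, hδ, haway⟩ := hp.away
  have h1 : ∀ s ∈ Icc (0 : ℝ) 1, p s ≠ 1 := fun s hs => ne_one_of_away hδ (haway s hs)
  have hPC := hp.chain.piecewiseC1
  have hΦ : Phi n a p (Icc 0 1) ≠ 0 := by
    obtain ⟨c, hc, hc1, hcd, hd⟩ := hp.chain.exists_first_arc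
    have hsub : Ioo 0 c ⊆ Ioc (0 : ℝ) 1 := fun s hs => ⟨hs.1, hs.2.le.trans hc1⟩
    exact Phi_ne_zero hn hc hcd hd (hsub.trans Ioc_subset_Icc_self)
      (fun s hs => hp.ne_zero s (hsub hs)) (fun s hs => h1 s (Ioc_subset_Icc_self (hsub hs)))
  have hstart : Tendsto p (𝓝[>] 0) (𝓝 0) := by
    have h := hPC.cont 0 (left_mem_Icc.2 zero_le_one)
    rw [ContinuousWithinAt, hp.source] at h
    refine h.mono_left (nhdsWithin_le_of_mem ?_)
    exact mem_of_superset (Ioo_mem_nhdsGT one_pos) Ioo_subset_Icc_self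
  refine enorm_le_errorBound (l := 𝓝[>] (0 : ℝ)) ha ⟨0, left_mem_Icc.2 zero_le_one⟩ hΦ
    ((tendsto_startError_zero (n := n) ha).comp hstart) (fun t => startError_nonneg _ _ _ _)
    fun hκ => ?_
  filter_upwards [Ioo_mem_nhdsGT one_pos] with t ht
  have hsub : Icc t 1 ⊆ Ioc (0 : ℝ) 1 := fun s hs => ⟨ht.1.trans_le hs.1, hs.2⟩
  have hsub' : Icc t 1 ⊆ Icc (0 : ℝ) 1 := hsub.trans Ioc_subset_Icc_self
  have hPCt := hPC.mono ht.1.le le_rfl ht.2.le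
  have h0t : ∀ s ∈ Icc t 1, p s ≠ 0 := fun s hs => hp.ne_zero s (hsub hs)
  have h1t : ∀ s ∈ Icc t 1, p s ≠ 1 := fun s hs => h1 s (hsub' hs)
  have hκ0 : 0 < (kappa0 a p (Icc 0 1)).toReal :=
    ENNReal.toReal_pos (kappa0_ne_zero ⟨0, left_mem_Icc.2 zero_le_one⟩) hκ
  have key := (path_bound (h := fun s => hZero n a (p s)) hn ha hκ0 ht.2.le hPCt h0t h1t
    (continuousOn_comp_path hPCt.cont h0t h1t fun z _ hz => continuousAt_hZero ha hz)
    (fun s hs p' hp' => by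
      have hs' := Ioo_subset_Icc_self hs
      refine ((hasDerivAt_hZero ha (h0t s hs') (h1t s hs')).comp s hp').congr_deriv ?_
      ring) fun s hs => one_le_kappa0_mul hκ (hsub' hs)).1 (hp.antitone.mono hsub)
  have hS : Ioc t 1 ⊆ Icc (0 : ℝ) 1 := Ioc_subset_Icc_self.trans hsub'
  have hrate := ofReal_integral_rate_le n hκ0 ha ht.2.le hPCt h0t h1t hS
  rw [ENNReal.ofReal_toReal hκ] at hrate
  rw [hp.target] at key
  exact ⟨_, _, key, ofReal_integral_residual_le n ha ht.2.le hPCt h0t h1t hS, hrate⟩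

/-- Near `s` the imaginary part of `ℓ t - ℓ s` stays within `(-π, π)`, so this difference is the
principal logarithm of `p t / p s`. -/
theorem hasDerivAt_of_exp_eq {ℓ : ℝ → ℂ} {p' : ℂ} {s : ℝ} (hp : HasDerivAt p p' s)
    (hℓ : ContinuousAt ℓ s) (h0 : p s ≠ 0) (h : ∀ᶠ t in 𝓝 s, Complex.exp (ℓ t) = p t) :
    HasDerivAt ℓ (p' / p s) s := by
  have h1 : HasDerivAt (fun t => Complex.log (p t / p s)) (p' / p s / (p s / p s)) s :=
    (hp.div_const (p s)).clog_real (by rw [div_self h0]; exact Complex.one_mem_slitPlane)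
  rw [div_self h0, div_one] at h1
  refine (h1.add_const (ℓ s)).congr_of_eventuallyEq ?_
  have hc : ContinuousAt (fun t => (ℓ t - ℓ s).im) s :=
    Complex.continuous_im.continuousAt.comp (hℓ.sub continuousAt_const)
  have hsmall : ∀ᶠ t in 𝓝 s, (ℓ t - ℓ s).im ∈ Ioo (-Real.pi) Real.pi := by
    refine hc.eventually_mem (Ioo_mem_nhds ?_ ?_) <;> simp [Real.pi_pos]
  filter_upwards [h, hsmall] with t ht ht'
  rw [← ht, ← h.self_of_nhds, ← Complex.exp_sub, Complex.log_exp ht'.1 ht'.2.le, sub_add_cancel]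

/-- The solution is continued along the path with the continuous logarithm `log ‖p‖ + iθ`. At the
endpoint `z` it is `hInf` by the choice of `θ 0`, and far out it is again `hInf`, which supplies the
starting value. The backward estimate runs from `T` to `0`, and `T → ∞`. -/
theorem enorm_hInf_sub_one_le (hn : 1 ≤ n) (ha : 0 < a) (hp : PathToInfinity a z p) :
    ‖hInf n a z - 1‖ₑ ≤ errorBound n a p (Ici 0) := by
  obtain ⟨δ, hδ, haway⟩ := hp.away
  obtain ⟨θ, hθc, hθ0, hθ⟩ := hp.cut
  have h1 : ∀ s ∈ Ici (0 : ℝ), p s ≠ 1 := fun s hs => ne_one_of_away hδ (haway s hs)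
  have hΦ : Phi n a p (Ici 0) ≠ 0 := by
    obtain ⟨c, hc, hcd, hd⟩ := hp.chain.exists_first_arc
    have hsub : Ioo 0 c ⊆ Ici (0 : ℝ) := fun s hs => hs.1.le
    exact Phi_ne_zero hn hc hcd hd hsub (fun s hs => hp.ne_zero s (hsub hs))
      (fun s hs => h1 s (hsub hs))
  have hcont : ContinuousOn p (Ici 0) := fun s hs => by
    have hs' : (0 : ℝ) ≤ s := hs
    have h := (hp.chain.piecewiseC1 (T := s + 1) (by linarith)).cont s ⟨hs, by linarith⟩
    refine h.mono_of_mem_nhdsWithin ?_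
    rw [← Ici_inter_Iic]
    exact inter_mem_nhdsWithin _ (Iic_mem_nhds (by linarith))
  set ℓ : ℝ → ℂ := fun s => (Real.log ‖p s‖ : ℂ) + θ s * Complex.I with hℓ
  have hℓc : ContinuousOn ℓ (Ici 0) :=
    (Complex.continuous_ofReal.comp_continuousOn
      (hcont.norm.log fun s hs => norm_ne_zero_iff.2 (hp.ne_zero s hs))).add
      ((Complex.continuous_ofReal.comp_continuousOn hθc).mul continuousOn_const)
  have hℓe : ∀ s ∈ Ici (0 : ℝ), Complex.exp (ℓ s) = p s := fun s hs => by
    rw [hℓ, Complex.exp_add, ← Complex.ofReal_exp,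
      Real.exp_log (norm_pos_iff.2 (hp.ne_zero s hs)), ← (hθ s hs).2]
  set h : ℝ → ℂ := fun s => hInfAux n a (p s) (ℓ s) with hh
  have hh0 : h 0 = hInf n a z := by
    simp only [hh, hInf, hℓ, hp.source, hθ0, Complex.log]
  have hev : ∀ᶠ s in atTop, h s = hInf n a (p s) := by
    filter_upwards [hp.target.eventually_gt_atTop 0, eventually_ge_atTop 0] with s hs hs0
    have hn0 : 0 < ‖p s‖ := norm_pos_iff.2 (hp.ne_zero s hs0)
    obtain ⟨hθs, hps⟩ := hθ s hs0
    -- Where `Re p > 0` the argument cannot be `-π`; together with `|θ| ≤ π` this forces `θ` to be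
    -- the principal argument, so no multiple of `2π` can have accumulated.
    have hne : θ s ≠ -Real.pi := by
      intro hπ
      rw [hps, hπ, Complex.exp_mul_I, ← Complex.ofReal_cos, ← Complex.ofReal_sin] at hs
      simp at hs
      linarith
    have harg : Complex.arg (p s) = θ s := by
      rw [hps, Complex.exp_mul_I, ← Complex.ofReal_cos, ← Complex.ofReal_sin,
        Complex.ofReal_cos, Complex.ofReal_sin]
      have := abs_le.1 hθs
      exact Complex.arg_mul_cos_add_sin_mul_I hn0 ⟨lt_of_le_of_ne this.1 hne.symm, this.2⟩
    simp only [hh, hInf, hℓ, Complex.log, harg]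
  have hε : Tendsto (fun s => startError n a (p s) (h s)) atTop (𝓝 0) := by
    have h2 : Tendsto p atTop (comap Complex.re atTop) := tendsto_comap_iff.2 hp.target
    refine ((tendsto_startError_inf (n := n) ha).comp h2).congr' ?_
    filter_upwards [hev] with s hs
    rw [hs]; rfl
  rw [← hh0]
  refine enorm_le_errorBound (l := atTop) ha ⟨0, self_mem_Ici⟩ hΦ hε
    (fun t => startError_nonneg _ _ _ _) fun hκ => ?_
  filter_upwards [eventually_gt_atTop 0] with T hT
  have hsub : Icc 0 T ⊆ Ici (0 : ℝ) := Icc_subset_Ici_self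
  have hPC := hp.chain.piecewiseC1 hT.le
  have h0t : ∀ s ∈ Icc 0 T, p s ≠ 0 := fun s hs => hp.ne_zero s (hsub hs)
  have h1t : ∀ s ∈ Icc 0 T, p s ≠ 1 := fun s hs => h1 s (hsub hs)
  have hκ0 : 0 < (kappa0 a p (Ici 0)).toReal :=
    ENNReal.toReal_pos (kappa0_ne_zero ⟨0, self_mem_Ici⟩) hκ
  have hhc : ContinuousOn h (Icc 0 T) := by
    have c1 := continuousOn_comp_path hPC.cont h0t h1t
      fun z _ hz => continuousAt_hZero (n := n) ha hz
    have c2 := continuousOn_comp_path hPC.cont h0t h1t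
      fun z _ hz => continuousAt_eSum (n := n) (a := a) hz
    exact c1.add ((continuousOn_const.mul (hPC.cont.sub continuousOn_const)).mul
      (((continuousOn_const.mul hPC.cont).sub c2).sub
        (continuousOn_const.mul (hℓc.mono hsub))).cexp)
  have key := (path_bound (h := h) hn ha hκ0 hT.le hPC h0t h1t hhc
    (fun s hs p' hp' => by
      have hs' := Ioo_subset_Icc_self hs
      have hnhds : Ici (0 : ℝ) ∈ 𝓝 s := Ici_mem_nhds hs.1
      refine hasDerivAt_hInfAux ha (h0t s hs') (h1t s hs') hp' (hasDerivAt_of_exp_eq hp'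
        (hℓc.continuousAt hnhds) (h0t s hs') ?_)
      filter_upwards [hnhds] with t ht using hℓe t ht)
    fun s hs => one_le_kappa0_mul hκ (hsub hs)).2 (hp.monotone.mono hsub)
  have hS : Ioc 0 T ⊆ Ici (0 : ℝ) := Ioc_subset_Icc_self.trans hsub
  have hrate := ofReal_integral_rate_le n hκ0 ha hT.le hPC h0t h1t hS
  rw [ENNReal.ofReal_toReal hκ] at hrate
  exact ⟨_, _, key, ofReal_integral_residual_le n ha hT.le hPC h0t h1t hS, hrate⟩

end

/-! ### Integrals of `|dt| / |t - 1|^2` and monotonicity of `Ξ`. -/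

section

open Set Filter MeasureTheory

variable {a : ℝ} {z : ℂ} {p : ℝ → ℂ}

/-- The Cauchy kernel bounding `|dt| / |t - 1|^2` on a segment traversed with speed `L`. -/
def cauchyKernel (δ L s₀ s : ℝ) : ℝ := L / (δ ^ 2 + (L * (s - s₀)) ^ 2)

theorem cauchyKernel_nonneg {δ L : ℝ} (hL : 0 ≤ L) (s₀ s : ℝ) : 0 ≤ cauchyKernel δ L s₀ s := by
  rw [cauchyKernel]; positivity

theorem lintegral_cauchyKernel_le {δ L : ℝ} (hδ : 0 < δ) (hL : 0 ≤ L) (s₀ : ℝ) :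
    ∫⁻ s, ENNReal.ofReal (cauchyKernel δ L s₀ s) ≤ ENNReal.ofReal (Real.pi / δ) := by
  rcases hL.eq_or_lt with rfl | hL
  · simp [cauchyKernel]
  have e : cauchyKernel δ L s₀ = fun s => (L / δ ^ 2) * (1 + (L / δ * (s - s₀)) ^ 2)⁻¹ := by
    funext s
    rw [cauchyKernel]
    field_simp
  have hi : Integrable (cauchyKernel δ L s₀) := by
    rw [e]
    exact ((integrable_inv_one_add_sq.comp_mul_left' (by positivity)).comp_sub_right s₀).const_mul _
  rw [← ofReal_integral_eq_lintegral_ofReal hi (ae_of_all _ fun s =>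
    cauchyKernel_nonneg hL.le s₀ s), e]
  refine ENNReal.ofReal_le_ofReal (le_of_eq ?_)
  rw [integral_const_mul, integral_sub_right_eq_self (fun s => (1 + (L / δ * s) ^ 2)⁻¹) s₀,
    Measure.integral_comp_mul_left (fun s : ℝ => (1 + s ^ 2)⁻¹) (L / δ),
    integral_univ_inv_one_add_sq, abs_of_pos (by positivity), smul_eq_mul]
  field_simp

/-- The explicit paths have at most two straight pieces; each contributes one kernel of mass at most
`π / δ`. Speed `0` makes the second kernel vanish when there is only one piece. -/
theorem pathInt_inv_sq_le {δ L₁ L₂ s₁ s₂ : ℝ} (hδ : 0 < δ) (hL₁ : 0 ≤ L₁) (hL₂ : 0 ≤ L₂)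
    {S : Set ℝ} (h : ∀ᵐ s ∂volume.restrict S, ‖deriv p s‖ / ‖p s - 1‖ ^ 2 ≤
      cauchyKernel δ L₁ s₁ s + cauchyKernel δ L₂ s₂ s) :
    pathInt (fun t => ((t - 1) ^ 2)⁻¹) p S ≤ ENNReal.ofReal (2 * Real.pi / δ) := by
  have hm : ∀ L s₀, Measurable fun s => ENNReal.ofReal (cauchyKernel δ L s₀ s) := by
    intro L s₀; unfold cauchyKernel; fun_prop
  calc pathInt (fun t => ((t - 1) ^ 2)⁻¹) p S
      ≤ ∫⁻ s in S, (ENNReal.ofReal (cauchyKernel δ L₁ s₁ s)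
          + ENNReal.ofReal (cauchyKernel δ L₂ s₂ s)) := by
        refine lintegral_mono_ae ?_
        filter_upwards [h] with s hs
        rw [← ENNReal.ofReal_add (cauchyKernel_nonneg hL₁ _ _) (cauchyKernel_nonneg hL₂ _ _),
          ← ofReal_norm]
        refine ENNReal.ofReal_le_ofReal (le_trans (le_of_eq ?_) hs)
        rw [norm_mul, norm_inv, norm_pow, div_eq_inv_mul]
    _ ≤ ∫⁻ s, (ENNReal.ofReal (cauchyKernel δ L₁ s₁ s)
          + ENNReal.ofReal (cauchyKernel δ L₂ s₂ s)) := setLIntegral_le_lintegral _ _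
    _ = (∫⁻ s, ENNReal.ofReal (cauchyKernel δ L₁ s₁ s))
          + ∫⁻ s, ENNReal.ofReal (cauchyKernel δ L₂ s₂ s) := lintegral_add_left (hm _ _) _
    _ ≤ ENNReal.ofReal (Real.pi / δ) + ENNReal.ofReal (Real.pi / δ) :=
        add_le_add (lintegral_cauchyKernel_le hδ hL₁ s₁) (lintegral_cauchyKernel_le hδ hL₂ s₂)
    _ = ENNReal.ofReal (2 * Real.pi / δ) := by
        rw [← ENNReal.ofReal_add (by positivity) (by positivity)]; congr 1; ring

theorem div_sq_le_cauchyKernel {δ L s₀ s : ℝ} (hδ : 0 < δ) (hL : 0 ≤ L) {w : ℂ}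
    (h : δ ^ 2 + (L * (s - s₀)) ^ 2 ≤ ‖w‖ ^ 2) : L / ‖w‖ ^ 2 ≤ cauchyKernel δ L s₀ s := by
  rw [cauchyKernel]
  exact div_le_div_of_nonneg_left hL (by positivity) h

/-! ### Monotonicity of `Ξ` along horizontal and vertical segments -/

/-- To the right of `1` the distance to `1` grows, and `log ‖·‖` grows no faster than the real part
because the modulus is at least `1`. -/
theorem Xi_horizontal_right {z : ℂ} (ha : 0 < a) (hz : 1 < z.re) {s t : ℝ} (hs : 0 ≤ s)
    (hst : s ≤ t) : Xi a (z + s) ≤ Xi a (z + t) := by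
  have hn : 1 ≤ ‖z + s‖ := by
    have := Complex.re_le_norm (z + s)
    simp at this; linarith
  have h1 : Real.log ‖z + t‖ - Real.log ‖z + s‖ ≤ t - s := by
    have hsub : ‖z + t‖ ≤ ‖z + s‖ + (t - s) := by
      have e : z + t = (z + s) + ((t - s : ℝ) : ℂ) := by push_cast; ring
      rw [e]
      refine (norm_add_le _ _).trans ?_
      rw [Complex.norm_real, Real.norm_of_nonneg (by linarith)]
    have ht0 : 0 < ‖z + t‖ := by
      have := Complex.re_le_norm (z + t)
      simp at this; linarith
    rw [← Real.log_div ht0.ne' (by linarith)]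
    refine (Real.log_le_sub_one_of_pos (by positivity)).trans ?_
    rw [div_sub_one (by linarith), div_le_iff₀ (by linarith)]
    nlinarith
  have h2 : Real.log ‖1 - (z + s)‖ ≤ Real.log ‖1 - (z + t)‖ := by
    refine Real.log_le_log (norm_pos_iff.2 fun h => ?_) ?_
    · have := congrArg Complex.re h
      simp at this; linarith
    · rw [Complex.norm_eq_sqrt_sq_add_sq, Complex.norm_eq_sqrt_sq_add_sq]
      refine Real.sqrt_le_sqrt ?_
      simp only [Complex.sub_re, Complex.add_re, Complex.ofReal_re, Complex.one_re, Complex.sub_im,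
        Complex.add_im, Complex.ofReal_im, Complex.one_im]
      nlinarith
  simp only [Xi, Complex.add_re, Complex.ofReal_re]
  nlinarith

theorem Xi_ofReal (a x : ℝ) :
    Xi a (x : ℂ) = a / 2 * (x - 1 - Real.log |x|) + 1 / 2 * Real.log |1 - x| := by
  rw [Xi, ← Complex.ofReal_one, ← Complex.ofReal_sub, Complex.norm_real, Complex.norm_real,
    Complex.ofReal_re, Real.norm_eq_abs, Real.norm_eq_abs]

/-- On `(0, 1)` both `t - log t` and `log (1 - t)` decrease. On the negative axis `log (1 - t)`
increases as `t` moves away from `0`, but by less than `log |t|`, whose coefficient `a` is at least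
`1`. -/
theorem antitoneOn_Xi_real (ha : 1 ≤ a) {x : ℝ} (hx : x < 1) :
    AntitoneOn (fun u : ℝ => Xi a ((u * x : ℝ) : ℂ)) (Ioc 0 1) := by
  intro u hu v hv huv
  have hu0 := hu.1
  have hv0 := hv.1
  simp only [Xi_ofReal]
  rcases lt_trichotomy x 0 with h | rfl | h
  · have hU : u * x < 0 := mul_neg_of_pos_of_neg hu0 h
    have hV : v * x < 0 := mul_neg_of_pos_of_neg hv0 h
    have hUV : v * x ≤ u * x := mul_le_mul_of_nonpos_right huv h.le
    rw [abs_of_neg hU, abs_of_neg hV, abs_of_pos (by linarith), abs_of_pos (by linarith)]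
    have h1 : Real.log (1 - v * x) - Real.log (1 - u * x)
        ≤ Real.log (-(v * x)) - Real.log (-(u * x)) := by
      rw [← Real.log_div (by linarith) (by linarith), ← Real.log_div (by linarith) (by linarith)]
      refine Real.log_le_log (div_pos (by linarith) (by linarith)) ?_
      rw [div_le_div_iff₀ (by linarith) (by linarith)]
      nlinarith
    have h2 : 0 ≤ Real.log (-(v * x)) - Real.log (-(u * x)) :=
      sub_nonneg.2 (Real.log_le_log (by linarith) (by linarith))
    nlinarith
  · simp
  · have hU : 0 < u * x := mul_pos hu0 h
    have hV : 0 < v * x := mul_pos hv0 h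
    have hUV : u * x ≤ v * x := mul_le_mul_of_nonneg_right huv h.le
    have hV1 : v * x < 1 := by nlinarith [hv.2]
    rw [abs_of_pos hU, abs_of_pos hV, abs_of_pos (by linarith), abs_of_pos (by linarith)]
    have h1 : Real.log (1 - v * x) ≤ Real.log (1 - u * x) :=
      Real.log_le_log (by linarith) (by linarith)
    have h2 : v * x - u * x ≤ Real.log (v * x) - Real.log (u * x) := by
      have := Real.one_sub_inv_le_log_of_pos (x := v * x / (u * x)) (by positivity)
      rw [Real.log_div hV.ne' hU.ne', inv_div] at this
      refine le_trans ?_ this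
      rw [one_sub_div hV.ne', le_div_iff₀ hV]
      nlinarith
    nlinarith

theorem log_norm_add_mul_I (x y : ℝ) :
    Real.log ‖(x : ℂ) + y * Complex.I‖ = 1 / 2 * Real.log (x ^ 2 + y ^ 2) := by
  rw [Complex.norm_add_mul_I, Real.log_sqrt (by positivity)]; ring

/-- On a vertical line only the two logarithms change. Exponentiated, the comparison is Bernoulli's
inequality `1 + a e ≤ (1 + e) ^ a` combined with `x² + y² ≤ a ((1 - x)² + y²)`. -/
theorem Xi_vertical (ha : 1 ≤ a) {x : ℝ} (hx : x < 1) (hxa : x ^ 2 ≤ a * (1 - x) ^ 2) {y y' : ℝ}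
    (h0 : 0 < x ^ 2 + y ^ 2) (hy : y ^ 2 ≤ y' ^ 2) :
    Xi a (x + y' * Complex.I) ≤ Xi a (x + y * Complex.I) := by
  have key : Real.log ((1 - x) ^ 2 + y' ^ 2) - Real.log ((1 - x) ^ 2 + y ^ 2)
      ≤ a * (Real.log (x ^ 2 + y' ^ 2) - Real.log (x ^ 2 + y ^ 2)) := by
    have hq : 0 < (1 - x) ^ 2 + y ^ 2 := by nlinarith [sq_nonneg y]
    have h0' : 0 < x ^ 2 + y' ^ 2 := by linarith
    have hq' : 0 < (1 - x) ^ 2 + y' ^ 2 := by linarith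
    rw [← Real.log_div hq'.ne' hq.ne', ← Real.log_div h0'.ne' h0.ne',
      ← Real.log_rpow (by positivity)]
    refine Real.log_le_log (by positivity) ?_
    set e := (y' ^ 2 - y ^ 2) / (x ^ 2 + y ^ 2) with he
    have he0 : 0 ≤ e := div_nonneg (by linarith) h0.le
    have e1 : (x ^ 2 + y' ^ 2) / (x ^ 2 + y ^ 2) = 1 + e := by rw [he]; field_simp; ring
    rw [e1]
    refine le_trans ?_ (one_add_mul_self_le_rpow_one_add (by linarith) ha)
    have e2 : ((1 - x) ^ 2 + y' ^ 2) / ((1 - x) ^ 2 + y ^ 2)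
        = 1 + (y' ^ 2 - y ^ 2) / ((1 - x) ^ 2 + y ^ 2) := by field_simp; ring
    rw [e2, he, ← mul_div_assoc]
    refine add_le_add le_rfl ?_
    rw [div_le_div_iff₀ hq h0]
    have : x ^ 2 + y ^ 2 ≤ a * ((1 - x) ^ 2 + y ^ 2) := by nlinarith [sq_nonneg y]
    nlinarith [mul_le_mul_of_nonneg_left this (sub_nonneg.2 hy)]
  have e3 : ∀ y : ℝ, (1 : ℂ) - (x + y * Complex.I) = ((1 - x : ℝ) : ℂ) + ((-y : ℝ) : ℂ) * Complex.I := by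
    intro y; push_cast; ring
  simp only [Xi, e3, log_norm_add_mul_I, neg_sq]
  simp only [Complex.add_re, Complex.ofReal_re, Complex.mul_re, Complex.I_re, Complex.ofReal_im,
    Complex.I_im]
  nlinarith

end

/-! ### Explicit admissible paths and the half-planes they reach. -/

section

open Set Filter MeasureTheory

variable {a δ : ℝ} {z : ℂ} {p : ℝ → ℂ} {S : Set ℝ}

/-- The path `p` on `S` keeps the distance `δ` from `1`, and `|dt| / |t - 1|^2` has integral at most
`2π / δ` along it. -/
structure PathControl (δ : ℝ) (p : ℝ → ℂ) (S : Set ℝ) : Prop where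
  le_norm : ∀ s ∈ S, δ ≤ ‖p s - 1‖
  pathInt_le : pathInt (fun t => ((t - 1) ^ 2)⁻¹) p S ≤ ENNReal.ofReal (2 * Real.pi / δ)

theorem hasDerivAt_affine (c d : ℂ) (s : ℝ) : HasDerivAt (fun s : ℝ => c + s * d) d s := by
  simpa using ((Complex.ofRealCLM.hasDerivAt (x := s)).mul_const d).const_add c

theorem isR2Arc_of_eq_affine (hS : UniqueDiffOn ℝ S) {c d : ℂ} (hd : d ≠ 0)
    (h : ∀ s ∈ S, p s = c + s * d) : IsR2Arc p S := by
  have hc : ContDiff ℝ 2 fun s : ℝ => c + s * d :=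
    contDiff_const.add (Complex.ofRealCLM.contDiff.mul contDiff_const)
  refine ⟨hc.contDiffOn.congr h, fun s hs => ?_⟩
  rw [derivWithin_congr h (h s hs), (hasDerivAt_affine c d s).hasDerivWithinAt.derivWithin (hS s hs)]
  exact hd

theorem strictMono_mul_natCast {r : ℝ} (hr : 0 < r) : StrictMono fun i : ℕ => r * (i : ℝ) :=
  Nat.strictMono_cast.const_mul hr

theorem isR2Chain_segment {c d : ℂ} (hd : d ≠ 0) : IsR2Chain fun s : ℝ => c + s * d := by
  refine ⟨0, fun i => 1 * i, strictMono_mul_natCast one_pos, by simp, by simp, fun i hi => ?_⟩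
  refine isR2Arc_of_eq_affine (uniqueDiffOn_Icc (strictMono_mul_natCast one_pos i.lt_succ_self)) hd
    fun s _ => rfl

theorem sq_le_normSq_of_re {w : ℂ} {r q : ℝ} (h : r ≤ w.re ^ 2 + w.im ^ 2) (hq : q = r) :
    q ≤ ‖w‖ ^ 2 := by
  rw [Complex.sq_norm, Complex.normSq_apply, hq]
  linarith [h]

/-- On the horizontal segment from `0` to `x` the square of the distance to `1` is at least
`δ^2` plus the square of the distance to the endpoint closest to `1`. -/
theorem sq_add_sq_le_horizontal {x u : ℝ} (hδ : 0 < δ) (hδ1 : δ ≤ 1) (hx : δ ≤ 1 - x) (hu0 : 0 ≤ u)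
    (hu1 : u ≤ 1) : δ ^ 2 + (x * (u - if 0 < x then 1 else 0)) ^ 2 ≤ (u * x - 1) ^ 2 := by
  split_ifs with h
  · have h1 : 0 ≤ x * (1 - u) := mul_nonneg h.le (by linarith)
    nlinarith [mul_nonneg h1 hδ.le, mul_nonneg h1 (sub_nonneg.2 hx)]
  · have h1 : u * x ≤ 0 := mul_nonpos_of_nonneg_of_nonpos hu0 (not_lt.1 h)
    nlinarith

theorem exists_pathFromZero_real (ha : 1 ≤ a) (hδ : 0 < δ) (hδ1 : δ ≤ 1) {x : ℝ} (hx : δ ≤ 1 - x)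
    (hx0 : x ≠ 0) : ∃ p, PathFromZero a x p ∧ PathControl δ p (Icc 0 1) := by
  have hd : (x : ℂ) ≠ 0 := Complex.ofReal_ne_zero.2 hx0
  have key : ∀ s ∈ Icc (0 : ℝ) 1, δ ^ 2 + (|x| * (s - if 0 < x then 1 else 0)) ^ 2
      ≤ ‖(0 : ℂ) + s * x - 1‖ ^ 2 := fun s hs => by
    refine sq_le_normSq_of_re (r := δ ^ 2 + (x * (s - if 0 < x then 1 else 0)) ^ 2) ?_
      (by rw [mul_pow, sq_abs, ← mul_pow])
    simpa using sq_add_sq_le_horizontal hδ hδ1 hx hs.1 hs.2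
  have haway : ∀ s ∈ Icc (0 : ℝ) 1, δ ≤ ‖(0 : ℂ) + s * x - 1‖ := fun s hs =>
    le_of_sq_le_sq ((le_add_of_nonneg_right (sq_nonneg _)).trans (key s hs)) (norm_nonneg _)
  refine ⟨fun s => 0 + s * x, ⟨isR2Chain_segment hd, by simp, by simp, ?_, ⟨δ, hδ, haway⟩, ?_⟩,
    haway, ?_⟩
  · intro s hs
    simp [hs.1.ne', hx0]
  · have := antitoneOn_Xi_real ha (x := x) (by linarith)
    simpa using this
  · refine pathInt_inv_sq_le (L₁ := |x|) (s₁ := if 0 < x then 1 else 0) (L₂ := 0) (s₂ := 0) hδ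
      (abs_nonneg _) le_rfl ?_
    filter_upwards [ae_restrict_mem measurableSet_Icc] with s hs
    rw [(hasDerivAt_affine 0 x s).deriv, Complex.norm_real, Real.norm_eq_abs]
    exact (div_sq_le_cauchyKernel hδ (abs_nonneg _) (key s hs)).trans
      (le_add_of_nonneg_right (cauchyKernel_nonneg le_rfl _ _))

theorem exists_pathFromZero_imaginary (ha : 1 ≤ a) (hδ : 0 < δ) (hδ1 : δ ≤ 1) {y : ℝ} (hy0 : y ≠ 0) :
    ∃ p, PathFromZero a (y * Complex.I) p ∧ PathControl δ p (Icc 0 1) := by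
  have hd : (y : ℂ) * Complex.I ≠ 0 := mul_ne_zero (Complex.ofReal_ne_zero.2 hy0) Complex.I_ne_zero
  have key : ∀ s : ℝ, δ ^ 2 + (|y| * (s - 0)) ^ 2
      ≤ ‖(0 : ℂ) + s * (y * Complex.I) - 1‖ ^ 2 := fun s => by
    refine sq_le_normSq_of_re (r := δ ^ 2 + (s * y) ^ 2) ?_
      (by rw [mul_pow, sq_abs, sub_zero]; ring)
    have := pow_le_one₀ (n := 2) hδ.le hδ1
    simpa using this
  have haway : ∀ s ∈ Icc (0 : ℝ) 1, δ ≤ ‖(0 : ℂ) + s * (y * Complex.I) - 1‖ := fun s _ =>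
    le_of_sq_le_sq ((le_add_of_nonneg_right (sq_nonneg _)).trans (key s)) (norm_nonneg _)
  refine ⟨fun s => 0 + s * (y * Complex.I), ⟨isR2Chain_segment hd, by simp, by simp, ?_,
    ⟨δ, hδ, haway⟩, ?_⟩, haway, ?_⟩
  · intro s hs
    simp [hs.1.ne', hy0]
  · intro s hs t ht hst
    have := Xi_vertical (y := s * y) (y' := t * y) ha zero_lt_one (by simp; linarith)
      (by have := mul_ne_zero hs.1.ne' hy0; positivity)
      (by rw [mul_pow, mul_pow]; gcongr; exact hs.1.le)
    simpa [mul_assoc] using this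
  · refine pathInt_inv_sq_le (L₁ := |y|) (s₁ := 0) (L₂ := 0) (s₂ := 0) hδ (abs_nonneg _) le_rfl ?_
    refine ae_of_all _ fun s => ?_
    rw [(hasDerivAt_affine 0 _ s).deriv, norm_mul, Complex.norm_I, mul_one, Complex.norm_real,
      Real.norm_eq_abs]
    exact (div_sq_le_cauchyKernel hδ (abs_nonneg _) (key s)).trans
      (le_add_of_nonneg_right (cauchyKernel_nonneg le_rfl _ _))

/-- The broken line `0 → x → x + i y`. -/
def brokenPath (x y s : ℝ) : ℂ :=
  if s ≤ 1 / 2 then 0 + s * (2 * x) else (x - y * Complex.I) + s * (2 * (y * Complex.I))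

theorem brokenPath_of_le {x y s : ℝ} (hs : s ≤ 1 / 2) : brokenPath x y s = ((2 * s * x : ℝ) : ℂ) := by
  rw [brokenPath, if_pos hs]; push_cast; ring

theorem brokenPath_of_ge {x y s : ℝ} (hs : 1 / 2 ≤ s) :
    brokenPath x y s = x + (((2 * s - 1) * y : ℝ) : ℂ) * Complex.I := by
  rcases hs.eq_or_lt with rfl | hs
  · rw [brokenPath_of_le le_rfl]; simp
  · rw [brokenPath, if_neg hs.not_ge]; push_cast; ring

theorem hasDerivAt_brokenPath_of_lt {x y s : ℝ} (hs : s < 1 / 2) :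
    HasDerivAt (brokenPath x y) (2 * x) s := by
  refine (hasDerivAt_affine 0 _ s).congr_of_eventuallyEq ?_
  filter_upwards [Iio_mem_nhds hs] with t ht
  rw [brokenPath, if_pos (mem_Iio.1 ht).le]

theorem hasDerivAt_brokenPath_of_gt {x y s : ℝ} (hs : 1 / 2 < s) :
    HasDerivAt (brokenPath x y) (2 * (y * Complex.I)) s := by
  refine (hasDerivAt_affine (x - y * Complex.I) _ s).congr_of_eventuallyEq ?_
  filter_upwards [Ioi_mem_nhds hs] with t ht
  rw [brokenPath, if_neg (mem_Ioi.1 ht).not_ge]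

theorem isR2Chain_brokenPath {x y : ℝ} (hx : x ≠ 0) (hy : y ≠ 0) : IsR2Chain (brokenPath x y) := by
  refine ⟨1, fun i => 1 / 2 * i, strictMono_mul_natCast (by norm_num), by simp, by norm_num,
    fun i hi => ?_⟩
  have hud : UniqueDiffOn ℝ (Icc (1 / 2 * (i : ℝ)) (1 / 2 * ((i + 1 : ℕ) : ℝ))) :=
    uniqueDiffOn_Icc (strictMono_mul_natCast (by norm_num) i.lt_succ_self)
  interval_cases i
  · refine isR2Arc_of_eq_affine hud (c := 0) (d := 2 * x) (by simpa using hx) fun s hs => ?_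
    rw [brokenPath, if_pos (by simpa using hs.2)]
  · refine isR2Arc_of_eq_affine hud (c := x - y * Complex.I) (d := 2 * (y * Complex.I))
      (by simpa using hy) fun s hs => ?_
    rw [brokenPath_of_ge (by simpa using hs.1)]
    push_cast; ring

/-- On each leg the squared distance to `1` dominates `δ ^ 2` plus the squared distance to the point
of that leg closest to `1`. This gives both the lower bound `δ` and the Cauchy kernels. -/
theorem exists_pathFromZero_broken (ha : 1 ≤ a) (hδ : 0 < δ) (hδ1 : δ ≤ 1) {x y : ℝ}
    (hx : δ ≤ 1 - x) (hxa : x ^ 2 ≤ a * (1 - x) ^ 2) (hx0 : x ≠ 0) (hy0 : y ≠ 0) :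
    ∃ p, PathFromZero a (x + y * Complex.I) p ∧ PathControl δ p (Icc 0 1) := by
  have key1 : ∀ s ∈ Icc (0 : ℝ) (1 / 2),
      δ ^ 2 + (2 * |x| * (s - (if 0 < x then 1 else 0) / 2)) ^ 2
        ≤ ‖brokenPath x y s - 1‖ ^ 2 := fun s hs => by
    rw [brokenPath_of_le hs.2]
    refine sq_le_normSq_of_re (r := δ ^ 2 + (x * (2 * s - if 0 < x then 1 else 0)) ^ 2) ?_
      (by rw [mul_pow, mul_pow, sq_abs]; ring)
    have := sq_add_sq_le_horizontal (u := 2 * s) hδ hδ1 hx (by linarith [hs.1]) (by linarith [hs.2])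
    simpa using this
  have key2 : ∀ s : ℝ, 1 / 2 ≤ s →
      δ ^ 2 + (2 * |y| * (s - 1 / 2)) ^ 2 ≤ ‖brokenPath x y s - 1‖ ^ 2 := fun s hs => by
    rw [brokenPath_of_ge hs]
    refine sq_le_normSq_of_re (r := δ ^ 2 + ((2 * s - 1) * y) ^ 2) ?_
      (by rw [mul_pow, mul_pow, sq_abs]; ring)
    simp
    nlinarith
  have haway : ∀ s ∈ Icc (0 : ℝ) 1, δ ≤ ‖brokenPath x y s - 1‖ := fun s hs => by
    rcases le_total s (1 / 2) with h | h
    · exact le_of_sq_le_sq ((le_add_of_nonneg_right (sq_nonneg _)).trans (key1 s ⟨hs.1, h⟩))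
        (norm_nonneg _)
    · exact le_of_sq_le_sq ((le_add_of_nonneg_right (sq_nonneg _)).trans (key2 s h)) (norm_nonneg _)
  refine ⟨brokenPath x y, ⟨isR2Chain_brokenPath hx0 hy0, ?_, ?_, ?_, ⟨δ, hδ, haway⟩, ?_⟩, haway, ?_⟩
  · rw [brokenPath_of_le (by norm_num)]; simp
  · rw [brokenPath_of_ge (by norm_num)]; norm_num
  · intro s hs h
    rcases le_total s (1 / 2) with h' | h'
    · rw [brokenPath_of_le h'] at h
      simp [hs.1.ne', hx0] at h
    · rw [brokenPath_of_ge h'] at h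
      have := congrArg Complex.re h
      simp [hx0] at this
  · have hu : Ioc (0 : ℝ) 1 = Ioc 0 (1 / 2) ∪ Icc (1 / 2) 1 :=
      (Ioc_union_Icc_eq_Ioc (by norm_num) (by norm_num)).symm
    rw [hu]
    refine AntitoneOn.union_right (c := 1 / 2) ?_ ?_ (isGreatest_Ioc (by norm_num))
      (isLeast_Icc (by norm_num))
    · intro s hs t ht hst
      have := antitoneOn_Xi_real ha (x := x) (by linarith)
        (show 2 * s ∈ Ioc (0 : ℝ) 1 from ⟨by linarith [hs.1], by linarith [hs.2]⟩)
        (show 2 * t ∈ Ioc (0 : ℝ) 1 from ⟨by linarith [ht.1], by linarith [ht.2]⟩) (by linarith)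
      simpa only [brokenPath_of_le hs.2, brokenPath_of_le ht.2] using this
    · intro s hs t ht hst
      simp only [brokenPath_of_ge hs.1, brokenPath_of_ge ht.1]
      refine Xi_vertical ha (by linarith) hxa (by positivity) ?_
      rw [mul_pow, mul_pow]
      have := hs.1
      gcongr
      linarith
  · refine pathInt_inv_sq_le (L₁ := 2 * |x|) (s₁ := (if 0 < x then 1 else 0) / 2) (L₂ := 2 * |y|)
      (s₂ := 1 / 2) hδ (by positivity) (by positivity) ?_
    filter_upwards [ae_restrict_mem measurableSet_Icc,
      ae_restrict_of_ae (Measure.ae_ne volume (1 / 2 : ℝ))] with s hs hne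
    rcases lt_or_gt_of_ne hne with h | h
    · rw [(hasDerivAt_brokenPath_of_lt h).deriv]
      simp only [norm_mul, Complex.norm_ofNat, Complex.norm_real, Real.norm_eq_abs]
      exact (div_sq_le_cauchyKernel hδ (by positivity) (key1 s ⟨hs.1, h.le⟩)).trans
        (le_add_of_nonneg_right (cauchyKernel_nonneg (by positivity) _ _))
    · rw [(hasDerivAt_brokenPath_of_gt h).deriv]
      simp only [norm_mul, Complex.norm_ofNat, Complex.norm_real, Real.norm_eq_abs, Complex.norm_I,
        mul_one]
      exact (div_sq_le_cauchyKernel hδ (by positivity) (key2 s h.le)).trans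
        (le_add_of_nonneg_left (cauchyKernel_nonneg (by positivity) _ _))

/-- Real and purely imaginary `z` need single segments, because a leg of length zero would violate
the nonvanishing derivative of an arc. -/
theorem exists_pathFromZero (ha : 1 ≤ a) (hδ : 0 < δ) (hδ1 : δ ≤ 1) (hx : δ ≤ 1 - z.re)
    (hxa : z.re ^ 2 ≤ a * (1 - z.re) ^ 2) (hz : z ≠ 0) :
    ∃ p, PathFromZero a z p ∧ PathControl δ p (Icc 0 1) := by
  rw [← Complex.re_add_im z]
  by_cases hy : z.im = 0
  · have hx0 : z.re ≠ 0 := fun h => hz (Complex.ext h hy)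
    simpa [hy] using exists_pathFromZero_real ha hδ hδ1 hx hx0
  · by_cases hx0 : z.re = 0
    · simpa [hx0] using exists_pathFromZero_imaginary ha hδ hδ1 hy
    · exact exists_pathFromZero_broken ha hδ hδ1 hx hxa hx0 hy

theorem exists_pathToInfinity (ha : 0 < a) (hδ : 0 < δ) (hx : δ ≤ z.re - 1) :
    ∃ p, PathToInfinity a z p ∧ PathControl δ p (Ici 0) := by
  have key : ∀ s ∈ Ici (0 : ℝ), δ ^ 2 + (1 * (s - 0)) ^ 2 ≤ ‖z + s * 1 - 1‖ ^ 2 := fun s hs => by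
    have hs' : (0 : ℝ) ≤ s := hs
    refine sq_le_normSq_of_re (r := δ ^ 2 + s ^ 2) ?_ (by ring)
    simp
    nlinarith [sq_nonneg z.im, mul_nonneg hδ.le hs']
  have haway : ∀ s ∈ Ici (0 : ℝ), δ ≤ ‖z + s * 1 - 1‖ := fun s hs =>
    le_of_sq_le_sq ((le_add_of_nonneg_right (sq_nonneg _)).trans (key s hs)) (norm_nonneg _)
  have hre : ∀ s ∈ Ici (0 : ℝ), 0 < (z + (s : ℂ) * 1).re := fun s hs => by
    have hs' : (0 : ℝ) ≤ s := hs
    simp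
    linarith
  refine ⟨fun s => z + s * 1, ⟨⟨0, fun i => 1 * i, strictMono_mul_natCast one_pos, by simp,
    by simp, ?_⟩, by simp, ?_, ?_, ⟨δ, hδ, haway⟩, ?_, ?_⟩, haway, ?_⟩
  · exact isR2Arc_of_eq_affine (uniqueDiffOn_Ici _) one_ne_zero fun s _ => rfl
  · simpa using tendsto_atTop_add_const_left atTop z.re tendsto_id
  · intro s hs h
    have := hre s hs
    rw [h] at this
    simp at this
  · intro s hs t _ hst
    simpa using Xi_horizontal_right (z := z) ha (by linarith) hs hst
  · refine ⟨fun s => Complex.arg (z + s * 1), fun s hs => ?_, by simp, fun s _ => ⟨?_, ?_⟩⟩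
    · exact (ContinuousAt.comp (f := fun s : ℝ => z + (s : ℂ) * 1)
        (Complex.continuousAt_arg (Or.inl (hre s hs)))
        (hasDerivAt_affine z 1 s).continuousAt).continuousWithinAt
    · exact Complex.abs_arg_le_pi _
    · exact (Complex.norm_mul_exp_arg_mul_I _).symm
  · refine pathInt_inv_sq_le (L₁ := 1) (s₁ := 0) (L₂ := 0) (s₂ := 0) hδ zero_le_one le_rfl ?_
    filter_upwards [ae_restrict_mem measurableSet_Ici] with s hs
    rw [(hasDerivAt_affine z 1 s).deriv, norm_one]
    exact (div_sq_le_cauchyKernel hδ zero_le_one (key s hs)).trans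
      (le_add_of_nonneg_right (cauchyKernel_nonneg le_rfl _ _))

/-! ### The half-planes in the domains -/

theorem mem_ZZero_of_re (ha : 1 ≤ a) (hx : z.re < 1) (hxa : z.re ^ 2 ≤ a * (1 - z.re) ^ 2) :
    z ∈ ZZero a := by
  by_cases hz : z = 0
  · exact Or.inl hz
  · obtain ⟨p, hp, _⟩ := exists_pathFromZero (δ := min 1 (1 - z.re)) ha
      (lt_min one_pos (by linarith)) (min_le_left _ _) (min_le_right _ _) hxa hz
    exact Or.inr ⟨p, hp⟩

theorem mem_ZZero_of_re_le_xMinus (ha : 1 ≤ a) (hx : z.re ≤ xMinus a) : z ∈ ZZero a := by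
  have ha0 : 0 < a := by linarith
  set r := √(4 * a + 1) with hr
  have hr2 : r ^ 2 = 4 * a + 1 := Real.sq_sqrt (by linarith)
  have hr1 : 1 < r := by
    rw [hr, Real.lt_sqrt zero_le_one]; linarith
  -- `d = 1 - xMinus a` is the positive root of `a d² + d = 1`. For `0 ≤ x ≤ 1 - d` it gives `x² ≤ x
  -- ≤ 1 - d = a d² ≤ a (1 - x)²`.
  set d := (r - 1) / (2 * a) with hd
  have hd0 : 0 < d := div_pos (by linarith) (by linarith)
  have hda : a * d ^ 2 = 1 - d := by
    rw [hd]; field_simp; nlinarith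
  have hxd : z.re ≤ 1 - d := by
    refine hx.trans (le_of_eq ?_)
    rw [xMinus, ← hr, hd]; ring
  refine mem_ZZero_of_re ha (by linarith) ?_
  rcases le_total 0 z.re with h | h
  · have h1 : a * d ^ 2 ≤ a * (1 - z.re) ^ 2 := by gcongr; linarith
    nlinarith
  · nlinarith [sq_nonneg (1 - z.re)]

theorem mem_ZInf_of_xPlus_le_re (ha : 0 < a) (hx : xPlus a ≤ z.re) : z ∈ ZInf a := by
  have h : 1 < xPlus a := by
    have : 0 ≤ √(4 * a + 1) / (2 * a) := by positivity
    have : 0 < 1 / (2 * a) := by positivity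
    rw [xPlus]; linarith
  obtain ⟨p, hp, _⟩ := exists_pathToInfinity (δ := z.re - 1) ha (by linarith) le_rfl
  exact ⟨p, hp⟩

end

/-! ### Uniform `O(a^{-n})` bounds away from `1`. -/

section

open Set Filter MeasureTheory

variable {n : ℕ} {δ : ℝ}

/-- `G` is bounded uniformly in `a ≥ 1` and in the paths satisfying `PathControl δ`. -/
def UniformlyBounded (δ : ℝ) (G : ℝ → (ℝ → ℂ) → Set ℝ → ℝ≥0∞) : Prop :=
  ∃ M : ℝ≥0∞, M ≠ ⊤ ∧ ∀ a : ℝ, 1 ≤ a → ∀ (p : ℝ → ℂ) (S : Set ℝ), MeasurableSet S →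
    PathControl δ p S → G a p S ≤ M

namespace UniformlyBounded

variable {G H : ℝ → (ℝ → ℂ) → Set ℝ → ℝ≥0∞}

theorem add (hG : UniformlyBounded δ G) (hH : UniformlyBounded δ H) :
    UniformlyBounded δ fun a p S => G a p S + H a p S := by
  obtain ⟨M, hM, hG⟩ := hG
  obtain ⟨N, hN, hH⟩ := hH
  exact ⟨M + N, ENNReal.add_ne_top.2 ⟨hM, hN⟩, fun a ha p S hS hp =>
    add_le_add (hG a ha p S hS hp) (hH a ha p S hS hp)⟩

theorem mul (hG : UniformlyBounded δ G) (hH : UniformlyBounded δ H) :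
    UniformlyBounded δ fun a p S => G a p S * H a p S := by
  obtain ⟨M, hM, hG⟩ := hG
  obtain ⟨N, hN, hH⟩ := hH
  exact ⟨M * N, ENNReal.mul_ne_top hM hN, fun a ha p S hS hp =>
    mul_le_mul' (hG a ha p S hS hp) (hH a ha p S hS hp)⟩

theorem const {c : ℝ≥0∞} (hc : c ≠ ⊤) : UniformlyBounded δ fun _ _ _ => c :=
  ⟨c, hc, fun _ _ _ _ _ _ => le_rfl⟩

theorem inv_pow (s : ℕ) : UniformlyBounded δ fun a _ _ => (ENNReal.ofReal a ^ s)⁻¹ :=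
  ⟨1, ENNReal.one_ne_top, fun _ ha _ _ _ _ => ENNReal.inv_le_one.2
    (one_le_pow₀ (ENNReal.one_le_ofReal.2 ha))⟩

theorem sum {ι : Type*} (I : Finset ι) {K : ι → ℝ → (ℝ → ℂ) → Set ℝ → ℝ≥0∞}
    (h : ∀ i ∈ I, UniformlyBounded δ (K i)) :
    UniformlyBounded δ fun a p S => ∑ i ∈ I, K i a p S := by
  classical
  induction I using Finset.induction_on with
  | empty => simpa using const (δ := δ) ENNReal.zero_ne_top
  | insert i I hi ih =>
    simp only [Finset.sum_insert hi]
    exact (h i (Finset.mem_insert_self i I)).add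
      (ih fun j hj => h j (Finset.mem_insert_of_mem hj))

end UniformlyBounded

theorem exists_norm_eval_le (q : Polynomial ℂ) (r : ℝ) :
    ∃ C : ℝ, ∀ v : ℂ, ‖v‖ ≤ r → ‖q.eval v‖ ≤ C := by
  obtain ⟨C, hC⟩ := (isCompact_closedBall (0 : ℂ) r).exists_bound_of_continuousOn
    q.continuous.continuousOn
  exact ⟨C, fun v hv => hC v (mem_closedBall_zero_iff.2 hv)⟩

theorem norm_inv_sub_one_le {t : ℂ} (hδ : 0 < δ) (ht : δ ≤ ‖t - 1‖) : ‖(t - 1)⁻¹‖ ≤ 1 / δ := by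
  rw [norm_inv, ← one_div]
  exact one_div_le_one_div_of_le hδ ht

/-- On the path `|1 / (t - 1)| ≤ 1 / δ`, so the polynomial factor is bounded and the integral of
`|dt| / |t - 1|^2` does the rest. -/
theorem uniformlyBounded_pathInt (hδ : 0 < δ) {f : ℂ → ℂ} (q : Polynomial ℂ)
    (hf : ∀ t : ℂ, t ≠ 1 → ‖f t‖ ≤ ‖((t - 1) ^ 2)⁻¹‖ * ‖q.eval (t - 1)⁻¹‖) :
    UniformlyBounded δ fun _ p S => pathInt f p S := by
  obtain ⟨C, hC⟩ := exists_norm_eval_le q (1 / δ)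
  refine ⟨ENNReal.ofReal (2 * Real.pi / δ) * ENNReal.ofReal C,
    ENNReal.mul_ne_top ENNReal.ofReal_ne_top ENNReal.ofReal_ne_top, fun a _ p S hS hp => ?_⟩
  refine le_trans ?_ (mul_le_mul_left hp.pathInt_le _)
  simp only [pathInt]
  rw [← lintegral_mul_const' _ _ ENNReal.ofReal_ne_top]
  refine setLIntegral_mono' hS fun s hs => ?_
  have hd := hp.le_norm s hs
  have h : ‖f (p s) * deriv p s‖ ≤ ‖((p s - 1) ^ 2)⁻¹ * deriv p s‖ * C := by
    rw [norm_mul, norm_mul, mul_right_comm]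
    refine mul_le_mul_of_nonneg_right ((hf _ (ne_one_of_away hδ hd)).trans ?_) (norm_nonneg _)
    exact mul_le_mul_of_nonneg_left (hC _ (norm_inv_sub_one_le hδ hd)) (norm_nonneg _)
  rw [← ofReal_norm, ← ofReal_norm, ← ENNReal.ofReal_mul (norm_nonneg _)]
  exact ENNReal.ofReal_le_ofReal h

theorem exists_norm_mul_F_le (k : ℕ) (hk : 1 ≤ k) : ∃ q : Polynomial ℂ, ∀ t : ℂ, t ≠ 1 →
    ‖(t - 1) / t * F k t‖ ≤ ‖((t - 1) ^ 2)⁻¹‖ * ‖q.eval (t - 1)⁻¹‖ := by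
  obtain ⟨q, hq⟩ := sq_dvd_fPoly k hk
  refine ⟨q, fun t ht => ?_⟩
  have ht1 := sub_ne_zero.2 ht
  rcases eq_or_ne t 0 with rfl | ht0
  · simp
  · rw [← norm_mul, F_eq_eval k t ht, hq]
    refine le_of_eq (congrArg _ ?_)
    simp only [Polynomial.eval_mul, Polynomial.eval_pow, Polynomial.eval_add, Polynomial.eval_X,
      Polynomial.eval_one]
    field_simp
    ring

theorem uniformlyBounded_pathInt_F (hδ : 0 < δ) {k : ℕ} (hk : 1 ≤ k) :
    UniformlyBounded δ fun _ p S => pathInt (fun t => (t - 1) / t * F k t) p S := by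
  obtain ⟨q, hq⟩ := exists_norm_mul_F_le k hk
  exact uniformlyBounded_pathInt hδ q hq

theorem uniformlyBounded_pathInt_F_mul (hδ : 0 < δ) {k : ℕ} (hk : 1 ≤ k) (l : ℕ) :
    UniformlyBounded δ fun _ p S => pathInt (fun t => (t - 1) / t * F k t * F l t) p S := by
  obtain ⟨q, hq⟩ := exists_norm_mul_F_le k hk
  refine uniformlyBounded_pathInt hδ (q * fPoly l) fun t ht => ?_
  rw [norm_mul ((t - 1) / t * F k t), Polynomial.eval_mul, norm_mul (q.eval _), ← mul_assoc,
    F_eq_eval l t ht]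
  exact mul_le_mul_of_nonneg_right (hq t ht) (norm_nonneg _)

theorem uniformlyBounded_pathInt_remainder (hδ : 0 < δ) :
    UniformlyBounded δ fun _ p S => pathInt (fun t => (t + 1) / (t - 1) ^ 3) p S := by
  refine uniformlyBounded_pathInt hδ (1 + 2 * Polynomial.X) fun t ht => ?_
  have ht1 := sub_ne_zero.2 ht
  rw [← norm_mul]
  refine le_of_eq (congrArg _ ?_)
  simp only [Polynomial.eval_mul, Polynomial.eval_add, Polynomial.eval_X, Polynomial.eval_one,
    Polynomial.eval_ofNat]
  field_simp
  ring

theorem uniformlyBounded_Phi (hδ : 0 < δ) (hn : 1 ≤ n) : UniformlyBounded δ (Phi n) := by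
  refine (uniformlyBounded_pathInt_F hδ hn).add ((UniformlyBounded.const (by simp)).mul
    (.sum _ fun s hs => (UniformlyBounded.inv_pow s).mul (.sum _ fun k hk => ?_)))
  exact uniformlyBounded_pathInt_F_mul hδ
    ((Finset.mem_Ico.1 hs).1.trans (Finset.mem_Ico.1 hk).1) _

theorem uniformlyBounded_Psi (hδ : 0 < δ) : UniformlyBounded δ (Psi n) :=
  (UniformlyBounded.const (by simp)).mul (.sum _ fun s _ => (UniformlyBounded.inv_pow s).mul
    (uniformlyBounded_pathInt_F hδ (Nat.le_add_left 1 s)))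

theorem norm_div_sq_le {t : ℂ} (hδ : 0 < δ) (ht : δ ≤ ‖t - 1‖) :
    ‖t / (t - 1) ^ 2‖ ≤ 1 / δ + (1 / δ) ^ 2 := by
  have ht1 := sub_ne_zero.2 (ne_one_of_away hδ ht)
  have e : t / (t - 1) ^ 2 = (t - 1)⁻¹ + (t - 1)⁻¹ ^ 2 := by field_simp; ring
  have h := norm_inv_sub_one_le hδ ht
  rw [e]
  refine (norm_add_le _ _).trans ?_
  rw [norm_pow]
  gcongr

theorem uniformlyBounded_kappa2 (hδ : 0 < δ) : UniformlyBounded δ fun _ p S => kappa2 p S := by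
  refine ⟨ENNReal.ofReal (1 / δ + (1 / δ) ^ 2), ENNReal.ofReal_ne_top, fun a _ p S _ hp => ?_⟩
  refine iSup₂_le fun s hs => ?_
  rw [← ofReal_norm]
  exact ENNReal.ofReal_le_ofReal (norm_div_sq_le hδ (hp.le_norm s hs))

theorem kappa0_le_two (hδ : 0 < δ) {a : ℝ} (ha : 1 ≤ a) (haδ : 2 * (1 / δ + (1 / δ) ^ 2) ≤ a)
    {p : ℝ → ℂ} {S : Set ℝ} (hp : PathControl δ p S) : kappa0 a p S ≤ 2 := by
  refine iSup₂_le fun s hs => ?_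
  have ha0 : 0 < a := by linarith
  have h : ‖p s / (a * (p s - 1) ^ 2)‖ ≤ 1 / 2 := by
    rw [mul_comm, ← div_div, norm_div, Complex.norm_real, Real.norm_of_nonneg ha0.le,
      div_le_iff₀ ha0]
    linarith [norm_div_sq_le hδ (hp.le_norm s hs)]
  have h2 : 1 / 2 ≤ ‖1 + p s / (a * (p s - 1) ^ 2)‖ := by
    have := norm_sub_le_norm_add (1 : ℂ) (p s / (a * (p s - 1) ^ 2))
    rw [norm_one] at this
    linarith
  rw [ENNReal.inv_le_iff_inv_le, ← ofReal_norm]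
  refine le_trans (le_of_eq ?_) (ENNReal.ofReal_le_ofReal h2)
  rw [one_div, ENNReal.ofReal_inv_of_pos two_pos, ENNReal.ofReal_ofNat]

/-- Far from `t = 1` the error bound is `O(a^{-n})`. -/
theorem exists_errorBound_le (hn : 1 ≤ n) (hδ : 0 < δ) : ∃ K : ℝ≥0∞, K ≠ ⊤ ∧ ∀ a : ℝ, 1 ≤ a →
    2 * (1 / δ + (1 / δ) ^ 2) ≤ a → ∀ (p : ℝ → ℂ) (S : Set ℝ), MeasurableSet S →
    PathControl δ p S → errorBound n a p S ≤ K / ENNReal.ofReal a ^ n := by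
  obtain ⟨M₁, hM₁, h₁⟩ := uniformlyBounded_Phi hδ hn
  obtain ⟨M₂, hM₂, h₂⟩ := uniformlyBounded_Psi (n := n) hδ
  obtain ⟨M₃, hM₃, h₃⟩ := uniformlyBounded_pathInt_remainder hδ
  obtain ⟨M₄, hM₄, h₄⟩ := uniformlyBounded_kappa2 hδ
  set X : ℝ≥0∞ := 1 * (2 + 2 * 2 + 2 * M₄ * 1) * M₂ + 2 * 1 * M₃ + 2 * 1 * M₁ with hX
  have hXt : X ≠ ⊤ := by finiteness
  refine ⟨2 * M₁ * EReal.exp (X : EReal), ENNReal.mul_ne_top (by finiteness) ?_,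
    fun a ha haδ p S hS hp => ?_⟩
  · simpa using hXt
  · have hA : (ENNReal.ofReal a)⁻¹ ≤ 1 := ENNReal.inv_le_one.2 (ENNReal.one_le_ofReal.2 ha)
    have hAn : (ENNReal.ofReal a ^ n)⁻¹ ≤ 1 :=
      ENNReal.inv_le_one.2 (one_le_pow₀ (ENNReal.one_le_ofReal.2 ha))
    have hκ := kappa0_le_two hδ ha haδ hp
    have g₁ := h₁ a ha p S hS hp
    have g₂ := h₂ a ha p S hS hp
    have g₃ := h₃ a ha p S hS hp
    have g₄ := h₄ a ha p S hS hp
    have hle : 1 / ENNReal.ofReal a * (2 + 2 * kappa0 a p S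
        + kappa0 a p S * kappa2 p S / ENNReal.ofReal a) * Psi n a p S
        + kappa0 a p S / ENNReal.ofReal a * pathInt (fun t => (t + 1) / (t - 1) ^ 3) p S
        + kappa0 a p S / ENNReal.ofReal a ^ n * Phi n a p S ≤ X := by
      simp only [div_eq_mul_inv, one_mul]
      rw [hX]
      gcongr
      simpa only [div_eq_mul_inv] using g₃
    have hexp := EReal.exp_monotone (EReal.coe_ennreal_le_coe_ennreal_iff.2 hle)
    calc errorBound n a p S
        ≤ 2 / ENNReal.ofReal a ^ n * M₁ * EReal.exp (X : EReal) := by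
          rw [errorBound]
          gcongr
      _ = 2 * M₁ * EReal.exp (X : EReal) / ENNReal.ofReal a ^ n := by
          simp only [div_eq_mul_inv]; ring

theorem exists_norm_le_div_pow (hn : 1 ≤ n) (hδ : 0 < δ) : ∃ C : ℝ, 0 ≤ C ∧ ∀ a : ℝ, 1 ≤ a →
    2 * (1 / δ + (1 / δ) ^ 2) ≤ a → ∀ (p : ℝ → ℂ) (S : Set ℝ), MeasurableSet S →
    PathControl δ p S → ∀ η : ℂ, ‖η‖ₑ ≤ errorBound n a p S → ‖η‖ ≤ C / a ^ n := by
  obtain ⟨K, hK, h⟩ := exists_errorBound_le hn hδ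
  refine ⟨K.toReal, ENNReal.toReal_nonneg, fun a ha haδ p S hS hp η hη => ?_⟩
  have ha0 : 0 < a := by linarith
  have hA : ENNReal.ofReal a ^ n ≠ 0 := pow_ne_zero _ (ENNReal.ofReal_pos.2 ha0).ne'
  have := ENNReal.toReal_mono (ENNReal.div_ne_top hK hA) (hη.trans (h a ha haδ p S hS hp))
  rwa [toReal_enorm, ENNReal.toReal_div, ENNReal.toReal_pow, ENNReal.toReal_ofReal ha0.le] at this

theorem exists_norm_hZero_sub_one_le (hn : 1 ≤ n) (hδ : 0 < δ) : ∃ C A : ℝ, ∀ a : ℝ, A ≤ a →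
    ∀ z : ℂ, z.re ≤ 1 - δ → ‖hZero n a z - 1‖ ≤ C / a ^ n := by
  set d := min 1 δ with hd
  have hd0 : 0 < d := lt_min one_pos hδ
  obtain ⟨C, hC, h⟩ := exists_norm_le_div_pow hn hd0
  -- The first threshold secures `x² ≤ a (1 - x)²` for `x ≤ 1 - δ`: `(1 - x)²` suffices for `x ≤ 0`
  -- and `((1 - x) / δ)² ≥ 1` for `x ≥ 0`. The second makes `kappa0` at most `2`. The distance is `d
  -- = min 1 δ` since every path starts at `0`.
  refine ⟨C, max (1 + (1 / δ) ^ 2) (2 * (1 / d + (1 / d) ^ 2)), fun a ha z hz => ?_⟩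
  have ha1 : 1 + (1 / δ) ^ 2 ≤ a := (le_max_left _ _).trans ha
  have haδ := (le_max_right _ _).trans ha
  have ha2 : 1 ≤ a := le_trans (by linarith [sq_nonneg (1 / δ)]) ha1
  rcases eq_or_ne z 0 with rfl | hz0
  · rw [hZero_zero (by linarith), sub_self, norm_zero]
    positivity
  · have hx : z.re ^ 2 ≤ a * (1 - z.re) ^ 2 := by
      refine le_trans ?_ (mul_le_mul_of_nonneg_right ha1 (sq_nonneg _))
      have e : δ * (1 / δ) = 1 := by field_simp
      have : 1 ≤ ((1 - z.re) * (1 / δ)) ^ 2 := by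
        refine one_le_pow₀ ?_
        calc (1 : ℝ) = δ * (1 / δ) := e.symm
          _ ≤ (1 - z.re) * (1 / δ) := by gcongr; linarith
      rcases le_total z.re 0 with h0 | h0 <;> nlinarith
    obtain ⟨p, hp, hpc⟩ := exists_pathFromZero ha2 hd0 (min_le_left _ _)
      ((min_le_right _ _).trans (by linarith)) hx hz0
    exact h a ha2 haδ p _ measurableSet_Icc hpc _ (enorm_hZero_sub_one_le hn (by linarith) hp)

theorem exists_norm_hInf_sub_one_le (hn : 1 ≤ n) (hδ : 0 < δ) : ∃ C A : ℝ, ∀ a : ℝ, A ≤ a →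
    ∀ z : ℂ, 1 + δ ≤ z.re → ‖hInf n a z - 1‖ ≤ C / a ^ n := by
  obtain ⟨C, -, h⟩ := exists_norm_le_div_pow hn hδ
  refine ⟨C, max 1 (2 * (1 / δ + (1 / δ) ^ 2)), fun a ha z hz => ?_⟩
  have ha1 := (le_max_left _ _).trans ha
  obtain ⟨p, hp, hpc⟩ := exists_pathToInfinity (a := a) (z := z) (by linarith) hδ (by linarith)
  exact h a ha1 ((le_max_right _ _).trans ha) p _ measurableSet_Ici hpc _
    (enorm_hInf_sub_one_le hn (by linarith) hp)

theorem ne_one_of_mem_ZZero {a : ℝ} {z : ℂ} (hz : z ∈ ZZero a) : z ≠ 1 := by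
  rcases hz with rfl | ⟨p, hp⟩
  · exact zero_ne_one
  · obtain ⟨δ, hδ, h⟩ := hp.away
    exact ne_one_of_away hδ (hp.target ▸ h 1 (right_mem_Icc.2 zero_le_one))

theorem ne_zero_and_ne_one_of_mem_ZInf {a : ℝ} {z : ℂ} (hz : z ∈ ZInf a) : z ≠ 0 ∧ z ≠ 1 := by
  obtain ⟨p, hp⟩ := hz
  obtain ⟨δ, hδ, h⟩ := hp.away
  exact ⟨hp.source ▸ hp.ne_zero 0 self_mem_Ici,
    ne_one_of_away hδ (hp.source ▸ h 0 self_mem_Ici)⟩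

theorem tendsto_hInf_sub_one {a : ℝ} (ha : 0 < a) (n : ℕ) :
    Tendsto (fun x : ℝ => hInf n a x - 1) atTop (𝓝 0) := by
  have h : Tendsto (fun x : ℝ => (x : ℂ)) atTop (comap Complex.re atTop) :=
    tendsto_comap_iff.2 tendsto_id
  simpa using ((tendsto_hInf (n := n) ha).comp h).sub_const 1

end

end

end LGGamma

/-! ### The theorem, with `η = h - 1`. -/

theorem mainTheorem1 :
    -- the coefficients: rational, with a pole at most at `1`, given by the integral, zero at `0`, `∞`
    (∀ s : ℕ, 1 ≤ s →
      (∃ (P : Polynomial ℂ) (m : ℕ), ∀ z : ℂ, z ≠ 1 →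
        LGGamma.E s z = z * P.eval z / (z - 1) ^ m) ∧
      (∀ z : ℂ, z ≠ 0 → z ≠ 1 →
        HasDerivAt (LGGamma.E s) ((z - 1) * LGGamma.F s z / (2 * z)) z) ∧
      Filter.Tendsto (LGGamma.E s) (Bornology.cobounded ℂ) (𝓝 0)) ∧
    -- the domains
    (∀ a : ℝ, 1 ≤ a →
      (∀ z : ℂ, z.re ≤ LGGamma.xMinus a → z ∈ LGGamma.ZZero a) ∧
      (∀ y : ℝ, (y : ℂ) * Complex.I ∈ LGGamma.ZZero a)) ∧
    (∀ a : ℝ, 0 < a → ∀ z : ℂ, LGGamma.xPlus a ≤ z.re → z ∈ LGGamma.ZInf a) ∧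
    -- the expansions
    ∃ η₀ ηinf : ℕ → ℝ → ℂ → ℂ,
      (∀ n : ℕ, 1 ≤ n → ∀ a : ℝ, 0 < a →
        (∀ z ∈ LGGamma.ZZero a,
          LGGamma.lowerGamma a (a * z) =
            ((a : ℂ) * z) ^ (a : ℂ) / (a * (1 - z)) * LGGamma.expFactor n a z *
              (1 + η₀ n a z)) ∧
        η₀ n a 0 = 0 ∧
        (∀ (z : ℂ) (p : ℝ → ℂ), LGGamma.PathFromZero a z p →
          ‖η₀ n a z‖ₑ ≤ LGGamma.errorBound n a p (Set.Icc 0 1)) ∧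
        (∀ z ∈ LGGamma.ZInf a,
          LGGamma.upperGamma a (a * z) =
            ((a : ℂ) * z) ^ (a : ℂ) / (a * (z - 1)) * LGGamma.expFactor n a z *
              (1 + ηinf n a z)) ∧
        Filter.Tendsto (fun x : ℝ => ηinf n a x) Filter.atTop (𝓝 0) ∧
        (∀ (z : ℂ) (p : ℝ → ℂ), LGGamma.PathToInfinity a z p →
          ‖ηinf n a z‖ₑ ≤ LGGamma.errorBound n a p (Set.Ici 0))) ∧
      -- the errors are `O(a^{-n})` as `a → ∞`, uniformly in `z` in closed half-planes not containing 1
      (∀ n : ℕ, 1 ≤ n → ∀ δ : ℝ, 0 < δ → ∃ C A : ℝ, ∀ a : ℝ, A ≤ a →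
        (∀ z : ℂ, z.re ≤ 1 - δ → ‖η₀ n a z‖ ≤ C / a ^ n) ∧
        (∀ z : ℂ, 1 + δ ≤ z.re → ‖ηinf n a z‖ ≤ C / a ^ n)) := by
  refine ⟨fun s hs => ⟨LGGamma.E_rational s hs, fun z hz0 hz => LGGamma.E_hasDerivAt s hs hz0 hz,
      LGGamma.E_tendsto s hs⟩,
    fun a ha => ⟨fun z hz => LGGamma.mem_ZZero_of_re_le_xMinus ha hz, fun y =>
      LGGamma.mem_ZZero_of_re ha (by simp) (by simp; linarith)⟩,
    fun a ha z hz => LGGamma.mem_ZInf_of_xPlus_le_re ha hz,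
    fun n a z => LGGamma.hZero n a z - 1, fun n a z => LGGamma.hInf n a z - 1,
    fun n hn a ha => ⟨fun z hz => ?_, ?_, fun z p hp => LGGamma.enorm_hZero_sub_one_le hn ha hp,
      fun z hz => ?_, LGGamma.tendsto_hInf_sub_one ha n,
      fun z p hp => LGGamma.enorm_hInf_sub_one_le hn ha hp⟩, fun n hn δ hδ => ?_⟩
  · rw [add_sub_cancel]
    exact LGGamma.lowerGamma_eq_hZero ha (LGGamma.ne_one_of_mem_ZZero hz)
  · exact sub_eq_zero.2 (LGGamma.hZero_zero ha)
  · rw [add_sub_cancel]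
    obtain ⟨hz0, hz1⟩ := LGGamma.ne_zero_and_ne_one_of_mem_ZInf hz
    exact LGGamma.upperGamma_eq_hInf ha hz0 hz1
  · obtain ⟨C, A, h⟩ := LGGamma.exists_norm_hZero_sub_one_le hn hδ
    obtain ⟨C', A', h'⟩ := LGGamma.exists_norm_hInf_sub_one_le hn hδ
    -- The threshold `0` keeps `a ^ n` nonnegative, so that enlarging the constant enlarges the
    -- quotient.
    refine ⟨max C C', max 0 (max A A'), fun a ha => ?_⟩
    have ha0 : 0 ≤ a := (le_max_left _ _).trans ha
    have hA : A ≤ a := (le_max_left _ _).trans ((le_max_right _ _).trans ha)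
    have hA' : A' ≤ a := (le_max_right _ _).trans ((le_max_right _ _).trans ha)
    exact ⟨fun z hz => (h a hA z hz).trans (by gcongr; exact le_max_left _ _),
      fun z hz => (h' a hA' z hz).trans (by gcongr; exact le_max_right _ _)⟩
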